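/- Let $\mathcal I=\{[x_i,y_i)\mid 1\le i\le n\}$ be a family of $n$ nonempty half-open intervals on the real line, let $\kappa$ be the number of distinct lengths and $\ell_{\mathcal I}$ the total length of these intervals, and let $B$ be a nonempty half-open interval of length $\ell_B$. For $\tau+\sigma=n$, say that $\textsc{Pack}(\tau,\sigma)$ (respectively, $\textsc{Cover}(\tau,\sigma)$) holds if one can choose $\tau$ of the intervals and translate each of them (zero-distance moves are allowed), keeping the other $\sigma$ intervals unmoved, so that afterwards the $n$ intervals are pairwise disjoint and contained in $B$ (respectively, so that the union of the $n$ intervals contains $B$). The problem $\textsc{Pack}^*$ (respectively, $\textsc{Cover}^*$) asks for the minimum $\tau^*$ of $\tau$ and the maximum $\sigma^*$ of $\sigma$, where $\tau^*+\sigma^*=n$; it is assumed that $\ell_{\mathcal I}\le\ell_B$ for $\textsc{Pack}^*$ and $\ell_{\mathcal I}\ge\ell_B$ for $\textsc{Cover}^*$. The input consists of $n$ and the endpoints of $B$ and of the intervals. Running time is the number of steps of a uniform program on a random access machine with unit-cost arithmetic and comparisons on real numbers and on words of $O(\log n)$ bits, conversion of words to reals, and conversion of the floor of a real to a word when it fits.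 Restricted to instances with $\kappa=1$: 1. $\textsc{Pack}^*$ and $\textsc{Cover}^*$ each admit an algorithm running in $O(n\log n+n\min\{\sigma^*,\tau^*\})$ time. 2. $\textsc{Cover}^*$ admits an algorithm running in $O(n\log^2 n)$ time. (For $n=1$, where these expressions vanish, the time is $O(1)$.) Moreover, let $n\ge 0$, let $\pi$ be a permutation of $\{0,1,\dots,n+1\}$ and, for $d\ge 1$, let $\sigma(d,n+1)$ be the maximum $h$ such that there is a sequence of indices $0=s_0<s_1<\dots<s_{h+1}=n+1$ with at most $d$ drops, a drop being an index $k$, $0\le k\le h$, with $\pi_{s_k}>\pi_{s_{k+1}}$. Then $\sigma(d,n+1)$ is concave for $1\le d\le n+1$, that is, $\sigma(d+1,n+1)-\sigma(d,n+1)\le\sigma(d,n+1)-\sigma(d-1,n+1)$ for $1<d<n+1$. -/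

import Mathlib

namespace MoveIntervals

/-! ### The problems -/

/-- `n` half-open intervals `[left i, right i)` and a target interval `B = [boxLeft, boxRight)`. -/
structure Family (n : ℕ) where
  left : Fin n → ℝ
  right : Fin n → ℝ
  left_lt_right : ∀ i, left i < right i
  boxLeft : ℝ
  boxRight : ℝ
  boxLeft_lt_boxRight : boxLeft < boxRight

namespace Family

variable {n : ℕ}

/-- The length of the `i`-th interval. -/
def len (I : Family n) (i : Fin n) : ℝ := I.right i - I.left i

/-- The length `ℓ_B` of the target interval. -/
def boxLen (I : Family n) : ℝ := I.boxRight - I.boxLeft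

/-- The total length `ℓ_I` of the intervals. -/
def totalLen (I : Family n) : ℝ := ∑ i, I.len i

/-- The number `κ` of distinct lengths. -/
noncomputable def kappa (I : Family n) : ℕ := (Finset.univ.image I.len).card

/-- The target interval `B`. -/
def box (I : Family n) : Set ℝ := Set.Ico I.boxLeft I.boxRight

/-- The `i`-th interval after it has been translated so that its left endpoint is `z i`. -/
def placed (I : Family n) (z : Fin n → ℝ) (i : Fin n) : Set ℝ := Set.Ico (z i) (z i + I.len i)

/-- With left endpoints `z`, the intervals are pairwise disjoint and contained in `B`. -/
def IsPacked (I : Family n) (z : Fin n → ℝ) : Prop :=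
  (∀ i j, i ≠ j → Disjoint (I.placed z i) (I.placed z j)) ∧ ∀ i, I.placed z i ⊆ I.box

/-- With left endpoints `z`, the union of the intervals contains `B`. -/
def IsCovered (I : Family n) (z : Fin n → ℝ) : Prop := I.box ⊆ ⋃ i, I.placed z i

/-- The configuration `Good` can be achieved by moving `τ` intervals and keeping the other `σ`
unmoved (zero-distance moves are allowed). -/
def Achievable (I : Family n) (Good : (Fin n → ℝ) → Prop) (τ σ : ℕ) : Prop :=
  ∃ M : Finset (Fin n), M.card = τ ∧ Mᶜ.card = σ ∧
    ∃ z : Fin n → ℝ, (∀ i, i ∉ M → z i = I.left i) ∧ Good z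

/-- `Pack(τ, σ)`. -/
def Pack (I : Family n) (τ σ : ℕ) : Prop := I.Achievable I.IsPacked τ σ

/-- `Cover(τ, σ)`. -/
def Cover (I : Family n) (τ σ : ℕ) : Prop := I.Achievable I.IsCovered τ σ

end Family

/-- `τ` and `σ` are the optimal values `τ*` and `σ*` for the decision problem `Q`. -/
def IsOptimal (Q : ℕ → ℕ → Prop) (τ σ : ℕ) : Prop :=
  IsLeast {t | ∃ s, Q t s} τ ∧ IsGreatest {s | ∃ t, Q t s} σ

/-! ### The machine model

A random access machine with two kinds of cells. Word cells hold integers of absolute value at most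
`W`, real cells hold real numbers. A program is a fixed finite text of a structured language over
finitely many variables and arrays; it contains integer constants only. The operations are
`+, -, *, /` and comparisons on words and on reals, conversion of a word to a real, and conversion
of the floor of a real to a word. A word operation whose result does not fit in a word, a division
by zero, and an array access with negative index have no result, and then the program has no
execution. Each operation costs one step. -/

/-- The memory: word variables, word arrays, real variables, real arrays. -/
structure Memory where
  ivar : ℕ → ℤ
  iarr : ℕ → ℕ → ℤ
  rvar : ℕ → ℝ
  rarr : ℕ → ℕ → ℝ

/-- The value `v` if it fits in a word. -/
def word (W : ℕ) (v : ℤ) : Option ℤ := if |v| ≤ (W : ℤ) then some v else none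

/-- A word as an array index. -/
def index (v : ℤ) : Option ℕ := if 0 ≤ v then some v.toNat else none

/-- Word-valued expressions. -/
inductive IExpr where
  | lit (c : ℤ)
  | var (x : ℕ)
  | get (a : ℕ) (i : IExpr)
  | add (e f : IExpr)
  | sub (e f : IExpr)
  | mul (e f : IExpr)
  | div (e f : IExpr)

namespace IExpr

/-- The number of operations in an expression. -/
def cost : IExpr → ℕ
  | lit _ => 1
  | var _ => 1
  | get _ i => i.cost + 1
  | add e f => e.cost + f.cost + 1
  | sub e f => e.cost + f.cost + 1
  | mul e f => e.cost + f.cost + 1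
  | div e f => e.cost + f.cost + 1

/-- The value of an expression (`div` rounds down). -/
def eval (W : ℕ) (m : Memory) : IExpr → Option ℤ
  | lit c => word W c
  | var x => word W (m.ivar x)
  | get a i => do word W (m.iarr a (← index (← i.eval W m)))
  | add e f => do word W ((← e.eval W m) + (← f.eval W m))
  | sub e f => do word W ((← e.eval W m) - (← f.eval W m))
  | mul e f => do word W ((← e.eval W m) * (← f.eval W m))
  | div e f => do
      let a ← e.eval W m
      let b ← f.eval W m
      if b = 0 then none else word W (Int.fdiv a b)

end IExpr

/-- Real-valued expressions. -/
inductive RExpr where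
  | ofWord (e : IExpr)
  | var (x : ℕ)
  | get (a : ℕ) (i : IExpr)
  | add (e f : RExpr)
  | sub (e f : RExpr)
  | mul (e f : RExpr)
  | div (e f : RExpr)

namespace RExpr

/-- The number of operations in an expression. -/
def cost : RExpr → ℕ
  | ofWord e => e.cost + 1
  | var _ => 1
  | get _ i => i.cost + 1
  | add e f => e.cost + f.cost + 1
  | sub e f => e.cost + f.cost + 1
  | mul e f => e.cost + f.cost + 1
  | div e f => e.cost + f.cost + 1

/-- The value of an expression. -/
noncomputable def eval (W : ℕ) (m : Memory) : RExpr → Option ℝ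
  | ofWord e => do return ((← e.eval W m : ℤ) : ℝ)
  | var x => some (m.rvar x)
  | get a i => do return m.rarr a (← index (← i.eval W m))
  | add e f => do return (← e.eval W m) + (← f.eval W m)
  | sub e f => do return (← e.eval W m) - (← f.eval W m)
  | mul e f => do return (← e.eval W m) * (← f.eval W m)
  | div e f => do
      let a ← e.eval W m
      let b ← f.eval W m
      if b = 0 then none else some (a / b)

end RExpr

/-- Tests. -/
inductive BExpr where
  | ilt (e f : IExpr)
  | rlt (e f : RExpr)
  | neg (b : BExpr)
  | conj (b c : BExpr)

namespace BExpr

/-- The number of operations in a test. -/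
def cost : BExpr → ℕ
  | ilt e f => e.cost + f.cost + 1
  | rlt e f => e.cost + f.cost + 1
  | neg b => b.cost + 1
  | conj b c => b.cost + c.cost + 1

/-- The value of a test; the second argument of `conj` is evaluated only if the first one is true.
-/
noncomputable def eval (W : ℕ) (m : Memory) : BExpr → Option Bool
  | ilt e f => do return decide ((← e.eval W m) < (← f.eval W m))
  | rlt e f => do return decide ((← e.eval W m) < (← f.eval W m))
  | neg b => do return !(← b.eval W m)
  | conj b c => do if (← b.eval W m) then c.eval W m else return false

end BExpr

/-- Programs. -/
inductive Prog where
  | skip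
  | isetVar (x : ℕ) (e : IExpr)
  | isetArr (a : ℕ) (i : IExpr) (e : IExpr)
  | rsetVar (x : ℕ) (e : RExpr)
  | rsetArr (a : ℕ) (i : IExpr) (e : RExpr)
  | floorTo (x : ℕ) (e : RExpr)
  | seq (p q : Prog)
  | ite (b : BExpr) (p q : Prog)
  | loop (b : BExpr) (p : Prog)

namespace Memory

/-- Write to a word variable. -/
def setIVar (m : Memory) (x : ℕ) (v : ℤ) : Memory :=
  { m with ivar := Function.update m.ivar x v }

/-- Write to a cell of a word array. -/
def setIArr (m : Memory) (a k : ℕ) (v : ℤ) : Memory :=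
  { m with iarr := Function.update m.iarr a (Function.update (m.iarr a) k v) }

/-- Write to a real variable. -/
def setRVar (m : Memory) (x : ℕ) (v : ℝ) : Memory :=
  { m with rvar := Function.update m.rvar x v }

/-- Write to a cell of a real array. -/
def setRArr (m : Memory) (a k : ℕ) (v : ℝ) : Memory :=
  { m with rarr := Function.update m.rarr a (Function.update (m.rarr a) k v) }

end Memory

/-- `Runs W p m t m'`: with words of absolute value at most `W`, the program `p` started on the
memory `m` halts after `t` steps with memory `m'`. -/
inductive Runs (W : ℕ) : Prog → Memory → ℕ → Memory → Prop
  | skip (m : Memory) : Runs W .skip m 1 m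
  | isetVar {m : Memory} {x : ℕ} {e : IExpr} {v : ℤ} (he : e.eval W m = some v) :
      Runs W (.isetVar x e) m (e.cost + 1) (m.setIVar x v)
  | isetArr {m : Memory} {a : ℕ} {i e : IExpr} {u v : ℤ} {k : ℕ} (hi : i.eval W m = some u)
      (hk : index u = some k) (he : e.eval W m = some v) :
      Runs W (.isetArr a i e) m (i.cost + e.cost + 1) (m.setIArr a k v)
  | rsetVar {m : Memory} {x : ℕ} {e : RExpr} {v : ℝ} (he : e.eval W m = some v) :
      Runs W (.rsetVar x e) m (e.cost + 1) (m.setRVar x v)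
  | rsetArr {m : Memory} {a : ℕ} {i : IExpr} {e : RExpr} {u : ℤ} {v : ℝ} {k : ℕ}
      (hi : i.eval W m = some u) (hk : index u = some k) (he : e.eval W m = some v) :
      Runs W (.rsetArr a i e) m (i.cost + e.cost + 1) (m.setRArr a k v)
  | floorTo {m : Memory} {x : ℕ} {e : RExpr} {r : ℝ} {v : ℤ} (he : e.eval W m = some r)
      (hv : word W ⌊r⌋ = some v) :
      Runs W (.floorTo x e) m (e.cost + 1) (m.setIVar x v)
  | seq {m m' m'' : Memory} {p q : Prog} {s t : ℕ} (hp : Runs W p m s m')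
      (hq : Runs W q m' t m'') : Runs W (.seq p q) m (s + t) m''
  | iteTrue {m m' : Memory} {b : BExpr} {p q : Prog} {t : ℕ} (hb : b.eval W m = some true)
      (hp : Runs W p m t m') : Runs W (.ite b p q) m (b.cost + 1 + t) m'
  | iteFalse {m m' : Memory} {b : BExpr} {p q : Prog} {t : ℕ} (hb : b.eval W m = some false)
      (hq : Runs W q m t m') : Runs W (.ite b p q) m (b.cost + 1 + t) m'
  | loopDone {m : Memory} {b : BExpr} {p : Prog} (hb : b.eval W m = some false) :
      Runs W (.loop b p) m (b.cost + 1) m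
  | loopStep {m m' m'' : Memory} {b : BExpr} {p : Prog} {s t : ℕ} (hb : b.eval W m = some true)
      (hp : Runs W p m s m') (hl : Runs W (.loop b p) m' t m'') :
      Runs W (.loop b p) m (b.cost + 1 + s + t) m''

/-- The initial memory: word variable `0` holds `n`, real variables `0` and `1` hold the endpoints
of `B`, real arrays `0` and `1` hold the left and right endpoints of the intervals, and all other
cells hold `0`. -/
noncomputable def Family.input {n : ℕ} (I : Family n) : Memory where
  ivar := fun x => if x = 0 then (n : ℤ) else 0
  iarr := fun _ _ => 0
  rvar := fun x => if x = 0 then I.boxLeft else if x = 1 then I.boxRight else 0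
  rarr := fun a k =>
    if h : k < n then
      if a = 0 then I.left ⟨k, h⟩ else if a = 1 then I.right ⟨k, h⟩ else 0
    else 0

/-- On the instances that satisfy `Adm`, the optimization version of the decision problem `Q` is
solved by one program, on words of `O(log n)` bits, in `O(T n τ* σ*)` steps: the program halts with
`σ*` in word variable `0` and `τ*` in word variable `1`. The summand `1` in the bound matters only
where `T` vanishes, as `n log n` does at `n = 1`. -/
def SolvableInTime (Adm : ∀ n : ℕ, Family n → Prop) (Q : ∀ n : ℕ, Family n → ℕ → ℕ → Prop)
    (T : ℕ → ℕ → ℕ → ℝ) : Prop :=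
  ∃ (p : Prog) (K : ℕ) (C : ℝ), ∀ (n : ℕ) (I : Family n), Adm n I →
    ∃ (τ σ t : ℕ) (m : Memory), IsOptimal (Q n I) τ σ ∧
      Runs ((n + 2) ^ K) p I.input t m ∧ m.ivar 0 = (σ : ℤ) ∧ m.ivar 1 = (τ : ℤ) ∧
      (t : ℝ) ≤ C * (T n τ σ + 1)

/-! ### Drops -/

/-- The number of drops of `π` along the sequence of indices `s`: the number of inversions between
consecutive entries. -/
def drops {n h : ℕ} (π : Equiv.Perm (Fin (n + 2))) (s : Fin (h + 2) → Fin (n + 2)) : ℕ :=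
  (Finset.univ.filter fun k : Fin (h + 1) => π (s k.succ) < π (s k.castSucc)).card

/-- `σ(d, n + 1)`: the maximum `h` for which some sequence of `h + 2` indices increasing from `0` to
`n + 1` has at most `d` drops. Such sequences exist for all `d ≥ 1`. -/
noncomputable def maxKept {n : ℕ} (π : Equiv.Perm (Fin (n + 2))) (d : ℕ) : ℕ :=
  sSup {h : ℕ | ∃ s : Fin (h + 2) → Fin (n + 2), StrictMono s ∧ s 0 = 0 ∧
    s (Fin.last (h + 1)) = Fin.last (n + 1) ∧ drops π s ≤ d}

end MoveIntervals

namespace MoveIntervals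

/-! ### Evaluation of expressions -/

section Memory

variable (m : Memory) (a b k j x y : ℕ) (v : ℤ) (r : ℝ)

/-! After scaling, all intervals have length 1 and the box is `[0, N)`. In a packing or a covering
give the intervals integer ranks from left to right. For packing, `N ≥ n`, and the interval of rank
`c` lies at `c + H`, where `H` is the free space accumulated so far; for covering, `N ≤ n`, and it
lies at `c - H`, where `H` is the accumulated overlap. In both cases `H` never decreases and stays
between 0 and the slack `|N - n|`. An unmoved interval prescribes its position, hence `H` modulo 1.
Conversely, a nondecreasing `H` with the prescribed residues determines integer ranks for the kept
intervals, and the moved ones take the free ranks. So both problems ask for the largest number of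
items on a monotone height path (`Items.Reach`) whose end height is at most the slack. Packing needs
in addition that kept intervals are pairwise disjoint and lie in the box (the bound `p`). Covering
needs that kept intervals at one position get different ranks, and that an interval outside the box
uses up a whole unit of slack (the flag `st`). The translations are `IsPackItems.keeps_iff` and
`IsCoverItems.keeps_iff`; a box with `N ≥ 2 * n` is treated apart, since there the residues are
irrelevant and the floors might not fit in a word.

The least end height for each prefix and each number of kept items obeys a recursion with two
predecessors (`Items.minHeight`). The table is filled in pairs: row `c` (exactly `c` items kept) and
diagonal `c` (exactly `c` items not kept). This stops after about `min σ* τ*` rounds of linear cost,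
which together with merge sort gives the first bound (`tableProg_spec`).

Without predecessor bounds the optimum is concave when the end height grows in unit steps
(`Items.best_concave`): raise the path that ends at `D - 1` by 1; it then starts above the path that
ends at `D + 1` and ends below it unless the latter already ends by `D`, so the two cross and their
tails can be exchanged. For a permutation, the integer part of the height counts drops and the
fractional part is the scaled value, so the concavity of `maxKept` is an instance.

Concavity also gives the `n log² n` algorithm. Charge a penalty `l` for each unit of height. By
concavity some integer `l ≤ n` is tight (`Items.exists_lagrange_eq`), and a binary search finds it
because the penalized optimum is convex in `l`. For fixed `l`, raising the integer part of the
height costs `l`, so only the `l` largest values need a threshold for the fractional part. These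
thresholds are monotone, and an item is inserted by one binary search, as in patience sorting
(`Items.Window.succ`).

The machine model is handled by total correctness triples with step counts: `Ends.of_wp` for
straight-line code, `Ends.loop` for loops, and `Runs.frame` for everything a program leaves alone.
-/

@[simp] theorem Memory.ivar_setIVar : (m.setIVar x v).ivar y = if y = x then v else m.ivar y := by
  simp [Memory.setIVar, Function.update_apply]
@[simp] theorem Memory.iarr_setIVar : (m.setIVar x v).iarr = m.iarr := rfl
@[simp] theorem Memory.rvar_setIVar : (m.setIVar x v).rvar = m.rvar := rfl
@[simp] theorem Memory.rarr_setIVar : (m.setIVar x v).rarr = m.rarr := rfl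
@[simp] theorem Memory.ivar_setRVar : (m.setRVar x r).ivar = m.ivar := rfl
@[simp] theorem Memory.iarr_setRVar : (m.setRVar x r).iarr = m.iarr := rfl
@[simp] theorem Memory.rvar_setRVar : (m.setRVar x r).rvar y = if y = x then r else m.rvar y := by
  simp [Memory.setRVar, Function.update_apply]
@[simp] theorem Memory.rarr_setRVar : (m.setRVar x r).rarr = m.rarr := rfl
@[simp] theorem Memory.ivar_setIArr : (m.setIArr a k v).ivar = m.ivar := rfl
@[simp] theorem Memory.iarr_setIArr :
    (m.setIArr a k v).iarr b j = if b = a ∧ j = k then v else m.iarr b j := by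
  by_cases h : b = a
  · subst h; simp [Memory.setIArr, Function.update_apply]
  · simp [Memory.setIArr, h]
@[simp] theorem Memory.rvar_setIArr : (m.setIArr a k v).rvar = m.rvar := rfl
@[simp] theorem Memory.rarr_setIArr : (m.setIArr a k v).rarr = m.rarr := rfl
@[simp] theorem Memory.ivar_setRArr : (m.setRArr a k r).ivar = m.ivar := rfl
@[simp] theorem Memory.iarr_setRArr : (m.setRArr a k r).iarr = m.iarr := rfl
@[simp] theorem Memory.rvar_setRArr : (m.setRArr a k r).rvar = m.rvar := rfl
@[simp] theorem Memory.rarr_setRArr :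
    (m.setRArr a k r).rarr b j = if b = a ∧ j = k then r else m.rarr b j := by
  by_cases h : b = a
  · subst h; simp [Memory.setRArr, Function.update_apply]
  · simp [Memory.setRArr, h]

end Memory

/-- The value of a word expression when no operation overflows. -/
def IExpr.val (m : Memory) : IExpr → ℤ
  | lit c => c
  | var x => m.ivar x
  | get a i => m.iarr a (i.val m).toNat
  | add e f => e.val m + f.val m
  | sub e f => e.val m - f.val m
  | mul e f => e.val m * f.val m
  | div e f => Int.fdiv (e.val m) (f.val m)

/-- No operation of the expression fails. -/
def IExpr.Ok (W : ℕ) (m : Memory) : IExpr → Prop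
  | lit c => |c| ≤ (W : ℤ)
  | var x => |m.ivar x| ≤ (W : ℤ)
  | get a i => i.Ok W m ∧ 0 ≤ i.val m ∧ |m.iarr a (i.val m).toNat| ≤ (W : ℤ)
  | add e f => e.Ok W m ∧ f.Ok W m ∧ |e.val m + f.val m| ≤ (W : ℤ)
  | sub e f => e.Ok W m ∧ f.Ok W m ∧ |e.val m - f.val m| ≤ (W : ℤ)
  | mul e f => e.Ok W m ∧ f.Ok W m ∧ |e.val m * f.val m| ≤ (W : ℤ)
  | div e f => e.Ok W m ∧ f.Ok W m ∧ f.val m ≠ 0 ∧ |Int.fdiv (e.val m) (f.val m)| ≤ (W : ℤ)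

theorem word_eq {W : ℕ} {v : ℤ} (h : |v| ≤ (W : ℤ)) : word W v = some v := if_pos h

theorem index_eq {v : ℤ} (h : 0 ≤ v) : index v = some v.toNat := if_pos h

/-- Separates a partial evaluation into a total value and arithmetic side conditions; later goals
are thus plain inequalities about integers. -/
theorem IExpr.eval_eq {W : ℕ} {m : Memory} : ∀ {e : IExpr}, e.Ok W m → e.eval W m = some (e.val m)
  | lit _, h => word_eq h
  | var _, h => word_eq h
  | get _ _, h => by simp [eval, val, eval_eq h.1, index_eq h.2.1, word_eq h.2.2]
  | add _ _, h => by simp [eval, val, eval_eq h.1, eval_eq h.2.1, word_eq h.2.2]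
  | sub _ _, h => by simp [eval, val, eval_eq h.1, eval_eq h.2.1, word_eq h.2.2]
  | mul _ _, h => by simp [eval, val, eval_eq h.1, eval_eq h.2.1, word_eq h.2.2]
  | div _ _, h => by
      simp [eval, val, eval_eq h.1, eval_eq h.2.1, if_neg h.2.2.1, word_eq h.2.2.2]

/-- The value of a real expression when no operation fails. -/
noncomputable def RExpr.val (m : Memory) : RExpr → ℝ
  | ofWord e => (e.val m : ℝ)
  | var x => m.rvar x
  | get a i => m.rarr a (i.val m).toNat
  | add e f => e.val m + f.val m
  | sub e f => e.val m - f.val m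
  | mul e f => e.val m * f.val m
  | div e f => e.val m / f.val m

/-- No operation of the expression fails. -/
def RExpr.Ok (W : ℕ) (m : Memory) : RExpr → Prop
  | ofWord e => e.Ok W m
  | var _ => True
  | get _ i => i.Ok W m ∧ 0 ≤ i.val m
  | add e f => e.Ok W m ∧ f.Ok W m
  | sub e f => e.Ok W m ∧ f.Ok W m
  | mul e f => e.Ok W m ∧ f.Ok W m
  | div e f => e.Ok W m ∧ f.Ok W m ∧ f.val m ≠ 0

theorem RExpr.eval_eq {W : ℕ} {m : Memory} : ∀ {e : RExpr}, e.Ok W m → e.eval W m = some (e.val m)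
  | ofWord _, h => by simp [eval, val, IExpr.eval_eq h]
  | var _, _ => rfl
  | get _ _, h => by simp [eval, val, IExpr.eval_eq h.1, index_eq h.2]
  | add _ _, h => by simp [eval, val, eval_eq h.1, eval_eq h.2]
  | sub _ _, h => by simp [eval, val, eval_eq h.1, eval_eq h.2]
  | mul _ _, h => by simp [eval, val, eval_eq h.1, eval_eq h.2]
  | div _ _, h => by simp [eval, val, eval_eq h.1, eval_eq h.2.1, if_neg h.2.2]

/-- The test is true. -/
def BExpr.Holds (m : Memory) : BExpr → Prop
  | ilt e f => e.val m < f.val m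
  | rlt e f => e.val m < f.val m
  | neg b => ¬ b.Holds m
  | conj b c => b.Holds m ∧ c.Holds m

/-- No operation of the test fails. -/
def BExpr.Ok (W : ℕ) (m : Memory) : BExpr → Prop
  | ilt e f => e.Ok W m ∧ f.Ok W m
  | rlt e f => e.Ok W m ∧ f.Ok W m
  | neg b => b.Ok W m
  | conj b c => b.Ok W m ∧ (b.Holds m → c.Ok W m)

open Classical in
theorem BExpr.eval_eq {W : ℕ} {m : Memory} :
    ∀ {b : BExpr}, b.Ok W m → b.eval W m = some (decide (b.Holds m))
  | ilt _ _, h => by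
      simp only [eval, Holds, IExpr.eval_eq h.1, IExpr.eval_eq h.2]
      exact congrArg some (decide_eq_decide.2 Iff.rfl)
  | rlt _ _, h => by
      simp only [eval, Holds, RExpr.eval_eq h.1, RExpr.eval_eq h.2]
      exact congrArg some (decide_eq_decide.2 Iff.rfl)
  | neg b, h => by
      have h' : b.Ok W m := h
      by_cases hb : b.Holds m <;> simp [eval, Holds, eval_eq h', hb]
  | conj b c, h => by
      by_cases hb : b.Holds m
      · simp [eval, Holds, eval_eq h.1, eval_eq (h.2 hb), hb]
      · simp [eval, Holds, eval_eq h.1, hb]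

theorem BExpr.eval_true {W : ℕ} {m : Memory} {b : BExpr} (h : b.Ok W m) (hb : b.Holds m) :
    b.eval W m = some true := by simp [BExpr.eval_eq h, hb]

theorem BExpr.eval_false {W : ℕ} {m : Memory} {b : BExpr} (h : b.Ok W m) (hb : ¬ b.Holds m) :
    b.eval W m = some false := by simp [BExpr.eval_eq h, hb]

/-! ### Total correctness with time bounds -/

/-- Started on `m`, the program `p` halts within `T` steps in a memory that satisfies `Q`. -/
def Ends (W : ℕ) (p : Prog) (m : Memory) (T : ℕ) (Q : Memory → Prop) : Prop :=
  ∃ t m', Runs W p m t m' ∧ t ≤ T ∧ Q m'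

theorem Ends.mono {W : ℕ} {p : Prog} {m : Memory} {T T' : ℕ} {Q Q' : Memory → Prop}
    (h : Ends W p m T Q) (hT : T ≤ T') (hQ : ∀ m', Q m' → Q' m') : Ends W p m T' Q' := by
  obtain ⟨t, m', hr, ht, hq⟩ := h
  exact ⟨t, m', hr, ht.trans hT, hQ _ hq⟩

theorem Ends.seq {W : ℕ} {p q : Prog} {m : Memory} {S T : ℕ} {Q R : Memory → Prop}
    (hp : Ends W p m S Q) (hq : ∀ m', Q m' → Ends W q m' T R) : Ends W (.seq p q) m (S + T) R := by
  obtain ⟨s, m', hr, hs, hQ⟩ := hp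
  obtain ⟨t, m'', hr', ht, hR⟩ := hq m' hQ
  exact ⟨s + t, m'', .seq hr hr', by omega, hR⟩

/-- The word variables that a program writes. -/
def Prog.iv : Prog → List ℕ
  | isetVar x _ => [x]
  | floorTo x _ => [x]
  | seq p q => p.iv ++ q.iv
  | ite _ p q => p.iv ++ q.iv
  | loop _ p => p.iv
  | _ => []

/-- The word arrays that a program writes. -/
def Prog.ia : Prog → List ℕ
  | isetArr a _ _ => [a]
  | seq p q => p.ia ++ q.ia
  | ite _ p q => p.ia ++ q.ia
  | loop _ p => p.ia
  | _ => []

/-- The real variables that a program writes. -/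
def Prog.rv : Prog → List ℕ
  | rsetVar x _ => [x]
  | seq p q => p.rv ++ q.rv
  | ite _ p q => p.rv ++ q.rv
  | loop _ p => p.rv
  | _ => []

/-- The real arrays that a program writes. -/
def Prog.ra : Prog → List ℕ
  | rsetArr a _ _ => [a]
  | seq p q => p.ra ++ q.ra
  | ite _ p q => p.ra ++ q.ra
  | loop _ p => p.ra
  | _ => []

/-- The two memories agree on all cells that the program does not write. -/
structure Prog.Frame (p : Prog) (m m' : Memory) : Prop where
  ivar : ∀ x, x ∉ p.iv → m'.ivar x = m.ivar x
  iarr : ∀ x, x ∉ p.ia → m'.iarr x = m.iarr x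
  rvar : ∀ x, x ∉ p.rv → m'.rvar x = m.rvar x
  rarr : ∀ x, x ∉ p.ra → m'.rarr x = m.rarr x

/-- For a concrete program the lists of written cells are computable, so preservation of all other
cells is later proved by `decide`, and invariants need to mention only what changes. -/
theorem Runs.frame {W : ℕ} {p : Prog} {m m' : Memory} {t : ℕ} (h : Runs W p m t m') :
    p.Frame m m' := by
  induction h with
  | skip => constructor <;> simp
  | isetVar => constructor <;> simp +contextual [Prog.iv]
  | floorTo => constructor <;> simp +contextual [Prog.iv]
  | rsetVar => constructor <;> simp +contextual [Prog.rv]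
  | isetArr =>
    constructor <;> simp +contextual [Prog.ia]
    intro x hx; funext j; simp [hx]
  | rsetArr =>
    constructor <;> simp +contextual [Prog.ra]
    intro x hx; funext j; simp [hx]
  | seq _ _ ih₁ ih₂ =>
    constructor <;> simp only [Prog.iv, Prog.ia, Prog.rv, Prog.ra, List.mem_append, not_or] <;>
      intro x hx
    · rw [ih₂.ivar x hx.2, ih₁.ivar x hx.1]
    · rw [ih₂.iarr x hx.2, ih₁.iarr x hx.1]
    · rw [ih₂.rvar x hx.2, ih₁.rvar x hx.1]
    · rw [ih₂.rarr x hx.2, ih₁.rarr x hx.1]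
  | iteTrue _ _ ih =>
    constructor <;> simp only [Prog.iv, Prog.ia, Prog.rv, Prog.ra, List.mem_append, not_or] <;>
      intro x hx
    exacts [ih.ivar x hx.1, ih.iarr x hx.1, ih.rvar x hx.1, ih.rarr x hx.1]
  | iteFalse _ _ ih =>
    constructor <;> simp only [Prog.iv, Prog.ia, Prog.rv, Prog.ra, List.mem_append, not_or] <;>
      intro x hx
    exacts [ih.ivar x hx.2, ih.iarr x hx.2, ih.rvar x hx.2, ih.rarr x hx.2]
  | loopDone => constructor <;> simp
  | loopStep _ _ _ ih₁ ih₂ =>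
    constructor <;> intro x hx
    · rw [ih₂.ivar x hx, ih₁.ivar x hx]
    · rw [ih₂.iarr x hx, ih₁.iarr x hx]
    · rw [ih₂.rvar x hx, ih₁.rvar x hx]
    · rw [ih₂.rarr x hx, ih₁.rarr x hx]

theorem Ends.frame {W : ℕ} {p : Prog} {m : Memory} {T : ℕ} {Q : Memory → Prop}
    (h : Ends W p m T Q) : Ends W p m T fun m' => Q m' ∧ p.Frame m m' := by
  obtain ⟨t, m', hr, ht, hq⟩ := h
  exact ⟨t, m', hr, ht, hq, hr.frame⟩

/-- A loop whose body runs at most `k` times, where `Inv k` is the invariant when `k` more rounds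
are allowed. -/
theorem Ends.loop {W : ℕ} {b : BExpr} {p : Prog} {T : ℕ} {Q : Memory → Prop}
    (Inv : ℕ → Memory → Prop)
    (hstep : ∀ k m, Inv k m → b.Ok W m ∧
      (b.Holds m → ∃ k', k = k' + 1 ∧ Ends W p m T (Inv k')) ∧ (¬ b.Holds m → Q m)) :
    ∀ k m, Inv k m → Ends W (.loop b p) m (k * (b.cost + 1 + T) + (b.cost + 1)) Q := by
  intro k
  induction k with
  | zero =>
    intro m hm
    obtain ⟨hok, h1, h2⟩ := hstep 0 m hm
    have hb : ¬ b.Holds m := fun hb => by obtain ⟨k', hk', -⟩ := h1 hb; omega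
    exact ⟨_, m, .loopDone (BExpr.eval_false hok hb), by omega, h2 hb⟩
  | succ k ih =>
    intro m hm
    obtain ⟨hok, h1, h2⟩ := hstep _ m hm
    by_cases hb : b.Holds m
    · obtain ⟨k', hk', s, m', hr, hs, hI⟩ := h1 hb
      obtain rfl : k = k' := by omega
      obtain ⟨t, m'', hr', ht, hQ⟩ := ih m' hI
      exact ⟨_, m'', .loopStep (BExpr.eval_true hok hb) hr hr', by rw [Nat.add_mul]; omega, hQ⟩
    · exact ⟨_, m, .loopDone (BExpr.eval_false hok hb), by omega, h2 hb⟩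

/-- The weakest precondition of a program without loops. -/
def Prog.wp (W : ℕ) : Prog → (Memory → Prop) → Memory → Prop
  | skip, Q, m => Q m
  | isetVar x e, Q, m => e.Ok W m ∧ Q (m.setIVar x (e.val m))
  | isetArr a i e, Q, m => i.Ok W m ∧ 0 ≤ i.val m ∧ e.Ok W m ∧
      Q (m.setIArr a (i.val m).toNat (e.val m))
  | rsetVar x e, Q, m => e.Ok W m ∧ Q (m.setRVar x (e.val m))
  | rsetArr a i e, Q, m => i.Ok W m ∧ 0 ≤ i.val m ∧ e.Ok W m ∧
      Q (m.setRArr a (i.val m).toNat (e.val m))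
  | floorTo x e, Q, m => e.Ok W m ∧ |⌊e.val m⌋| ≤ (W : ℤ) ∧ Q (m.setIVar x ⌊e.val m⌋)
  | seq p q, Q, m => p.wp W (q.wp W Q) m
  | ite b p q, Q, m => b.Ok W m ∧ (b.Holds m → p.wp W Q m) ∧ (¬ b.Holds m → q.wp W Q m)
  | loop _ _, _, _ => False

/-- A bound for the number of steps of a program without loops. -/
def Prog.steps : Prog → ℕ
  | skip => 1
  | isetVar _ e => e.cost + 1
  | isetArr _ i e => i.cost + e.cost + 1
  | rsetVar _ e => e.cost + 1
  | rsetArr _ i e => i.cost + e.cost + 1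
  | floorTo _ e => e.cost + 1
  | seq p q => p.steps + q.steps
  | ite b p q => b.cost + 1 + (p.steps + q.steps)
  | loop _ _ => 0

/-- Loops have the precondition `False`, so the value 0 in `Prog.steps` is harmless. For a
conditional the costs of both branches are added, which avoids a maximum. -/
theorem Ends.of_wp {W : ℕ} : ∀ {p : Prog} {m : Memory} {Q : Memory → Prop},
    p.wp W Q m → Ends W p m p.steps Q
  | .skip, m, _, h => ⟨_, m, .skip m, le_rfl, h⟩
  | .isetVar _ _, _, _, h => ⟨_, _, .isetVar (IExpr.eval_eq h.1), le_rfl, h.2⟩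
  | .isetArr _ _ _, _, _, h =>
    ⟨_, _, .isetArr (IExpr.eval_eq h.1) (index_eq h.2.1) (IExpr.eval_eq h.2.2.1), le_rfl, h.2.2.2⟩
  | .rsetVar _ _, _, _, h => ⟨_, _, .rsetVar (RExpr.eval_eq h.1), le_rfl, h.2⟩
  | .rsetArr _ _ _, _, _, h =>
    ⟨_, _, .rsetArr (IExpr.eval_eq h.1) (index_eq h.2.1) (RExpr.eval_eq h.2.2.1), le_rfl, h.2.2.2⟩
  | .floorTo _ _, _, _, h => ⟨_, _, .floorTo (RExpr.eval_eq h.1) (word_eq h.2.1), le_rfl, h.2.2⟩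
  | .seq _ _, _, _, h => Ends.seq (of_wp (p := _) h) fun _ h' => of_wp h'
  | .ite b p q, m, _, h => by
    by_cases hb : b.Holds m
    · obtain ⟨t, m', hr, ht, hq⟩ := of_wp (h.2.1 hb)
      exact ⟨_, m', .iteTrue (BExpr.eval_true h.1 hb) hr, by simp only [Prog.steps]; omega, hq⟩
    · obtain ⟨t, m', hr, ht, hq⟩ := of_wp (h.2.2 hb)
      exact ⟨_, m', .iteFalse (BExpr.eval_false h.1 hb) hr, by simp only [Prog.steps]; omega, hq⟩
  | .loop _ _, _, _, h => h.elim

/-! ### Merge sort -/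

/-- The values of `g` at `0, …, n - 1`. -/
def values (g : ℕ → ℝ) (n : ℕ) : Multiset ℝ := (Multiset.range n).map g

theorem values_succ (g : ℕ → ℝ) (n : ℕ) : values g (n + 1) = g n ::ₘ values g n := by
  simp [values, Multiset.range_succ]

theorem values_congr {g g' : ℕ → ℝ} {n : ℕ} (h : ∀ x < n, g x = g' x) : values g n = values g' n :=
  Multiset.map_congr rfl fun x hx => h x (Multiset.mem_range.1 hx)

/-- The blocks of length `w` of `g` are sorted up to `n`. -/
def SortedBlocks (g : ℕ → ℝ) (w n : ℕ) : Prop := ∀ x y, x < y → y < n → x / w = y / w → g x ≤ g y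

/-- The state of a merge of the blocks `[lo, mid)` and `[mid, hi)` of `g` into `d`: the first `k`
cells of `d` have been written, and `i` and `j` are the next cells of the two blocks. The values of
the second block that have been written are `g mid, …, g (j - 1)`. -/
structure Merging (g d : ℕ → ℝ) (w n lo k i mid j hi : ℕ) : Prop where
  dvd : 2 * w ∣ lo
  lo_le : lo ≤ i
  i_le : i ≤ mid
  mid_le : mid ≤ j
  j_le : j ≤ hi
  mid_eq : mid = min (lo + w) n
  hi_eq : hi = min (lo + 2 * w) n
  lo_lt : lo < n
  k_eq : k + mid = i + j
  sorted : SortedBlocks d (2 * w) k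
  le : ∀ x, lo ≤ x → x < k → ∀ y, (i ≤ y ∧ y < mid) ∨ (j ≤ y ∧ y < hi) → d x ≤ g y
  perm : values d k = values g i + (values (fun x => g (mid + x)) (j - mid))

theorem Merging.start {g d : ℕ → ℝ} {w n k : ℕ} (hk : 2 * w ∣ k) (hn : k < n)
    (hs : SortedBlocks d (2 * w) k) (hp : values d k = values g k) :
    Merging g d w n k k k (min (k + w) n) (min (k + w) n) (min (k + 2 * w) n) where
  dvd := hk
  lo_le := le_rfl
  i_le := by omega
  mid_le := le_rfl
  j_le := by omega
  mid_eq := rfl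
  hi_eq := rfl
  lo_lt := hn
  k_eq := rfl
  sorted := hs
  le := fun x hx hx' => by omega
  perm := by rw [hp]; simp [values]

theorem div_eq_of_dvd {w lo x : ℕ} (hw : 0 < w) (h : w ∣ lo) (h1 : lo ≤ x) (h2 : x < lo + w) :
    x / w = lo / w := by
  obtain ⟨q, rfl⟩ := h
  rw [Nat.mul_div_cancel_left _ hw]
  exact Nat.div_eq_of_lt_le (by nlinarith) (by nlinarith)

section

variable {g d d' : ℕ → ℝ} {w n lo k i mid j hi : ℕ}

theorem Merging.block_left (h : Merging g d w n lo k i mid j hi) (hw : 0 < w)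
    (hg : SortedBlocks g w n) {x y : ℕ} (hx : lo ≤ x) (hxy : x ≤ y) (hy : y < mid) : g x ≤ g y := by
  rcases hxy.eq_or_lt with rfl | hxy
  · exact le_rfl
  have := h.mid_eq
  have hd : w ∣ lo := (Dvd.intro_left 2 rfl).trans h.dvd
  exact hg x y hxy (by omega) ((div_eq_of_dvd hw hd hx (by omega)).trans
    (div_eq_of_dvd hw hd (by omega) (by omega)).symm)

theorem Merging.block_right (h : Merging g d w n lo k i mid j hi) (hw : 0 < w)
    (hg : SortedBlocks g w n) {x y : ℕ} (hx : mid ≤ x) (hxy : x ≤ y) (hy : y < hi) : g x ≤ g y := by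
  rcases hxy.eq_or_lt with rfl | hxy
  · exact le_rfl
  have h1 := h.mid_eq
  have h2 := h.hi_eq
  have hd : w ∣ lo + w := ((Dvd.intro_left 2 rfl).trans h.dvd).add (dvd_refl w)
  exact hg x y hxy (by omega) ((div_eq_of_dvd hw hd (by omega) (by omega)).trans
    (div_eq_of_dvd hw hd (by omega) (by omega)).symm)

/-- The new cell has to be compared only with earlier cells of its own output block. Blocks are told
apart by `x / (2 * w)`, and `lo` is a multiple of `2 * w`, so these cells start at `lo`. -/
theorem Merging.sorted_step (h : Merging g d w n lo k i mid j hi) (hw : 0 < w) (hk : k < hi)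
    (hd : ∀ x < k, d' x = d x) {v : ℝ} (hv : d' k = v)
    (hle : ∀ x, lo ≤ x → x < k → d x ≤ v) : SortedBlocks d' (2 * w) (k + 1) := by
  intro x y hxy hy hb
  rcases Nat.lt_succ_iff_lt_or_eq.1 hy with hy | rfl
  · rw [hd x (by omega), hd y hy]
    exact h.sorted x y hxy hy hb
  · rw [hv, hd x hxy]
    refine hle x ?_ hxy
    have hlo : lo ≤ y := by have := h.k_eq; have := h.lo_le; have := h.mid_le; omega
    by_contra hc
    rw [div_eq_of_dvd (by omega) h.dvd hlo (by have := h.hi_eq; omega)] at hb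
    obtain ⟨q, hq⟩ := h.dvd
    rw [hq, Nat.mul_div_cancel_left _ (by omega)] at hb
    have := Nat.div_mul_le_self x (2 * w)
    rw [hb] at this
    have : q * (2 * w) = 2 * w * q := mul_comm _ _
    omega

theorem Merging.left (h : Merging g d w n lo k i mid j hi) (hw : 0 < w)
    (hg : SortedBlocks g w n) (hk : k < hi) (hi' : i < mid) (hij : j < hi → g i ≤ g j)
    (hd : ∀ x < k, d' x = d x) (hv : d' k = g i) :
    Merging g d' w n lo (k + 1) (i + 1) mid j hi where
  dvd := h.dvd
  lo_le := h.lo_le.trans (Nat.le_succ i)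
  i_le := hi'
  mid_le := h.mid_le
  j_le := h.j_le
  mid_eq := h.mid_eq
  hi_eq := h.hi_eq
  lo_lt := h.lo_lt
  k_eq := by have := h.k_eq; omega
  sorted := h.sorted_step hw hk hd hv fun x hx hx' => h.le x hx hx' i (.inl ⟨le_rfl, hi'⟩)
  le := by
    intro x hx hxk y hy
    rcases Nat.lt_succ_iff_lt_or_eq.1 hxk with hxk | rfl
    · rw [hd x hxk]
      exact h.le x hx hxk y (by omega)
    · rw [hv]
      rcases hy with hy | hy
      · exact h.block_left hw hg h.lo_le (by omega) hy.2
      · exact (hij (by omega)).trans (h.block_right hw hg h.mid_le hy.1 hy.2)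
  perm := by
    rw [values_succ, values_succ, hv, values_congr hd, h.perm, Multiset.cons_add]

theorem Merging.right (h : Merging g d w n lo k i mid j hi) (hw : 0 < w)
    (hg : SortedBlocks g w n) (hk : k < hi) (hij : i < mid → j < hi ∧ g j < g i)
    (hd : ∀ x < k, d' x = d x) (hv : d' k = g j) :
    Merging g d' w n lo (k + 1) i mid (j + 1) hi := by
  have hj : j < hi := by
    have h1 := h.k_eq
    have h2 := h.i_le
    by_contra hc
    exact hc (hij (by omega)).1
  exact {
    dvd := h.dvd
    lo_le := h.lo_le
    i_le := h.i_le
    mid_le := h.mid_le.trans (Nat.le_succ j)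
    j_le := hj
    mid_eq := h.mid_eq
    hi_eq := h.hi_eq
    lo_lt := h.lo_lt
    k_eq := by have := h.k_eq; omega
    sorted := h.sorted_step hw hk hd hv fun x hx hx' => h.le x hx hx' j (.inr ⟨le_rfl, hj⟩)
    le := by
      intro x hx hxk y hy
      rcases Nat.lt_succ_iff_lt_or_eq.1 hxk with hxk | rfl
      · rw [hd x hxk]
        exact h.le x hx hxk y (by omega)
      · rw [hv]
        rcases hy with hy | hy
        · exact (hij (by omega)).2.le.trans (h.block_left hw hg h.lo_le hy.1 hy.2)
        · exact h.block_right hw hg h.mid_le (by omega) hy.2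
    perm := by
      have : j + 1 - mid = j - mid + 1 := by have := h.mid_le; omega
      rw [values_succ, this, values_succ, hv, values_congr hd, h.perm, Multiset.add_cons,
        Nat.add_sub_cancel' h.mid_le] }

theorem values_add (g : ℕ → ℝ) (a b : ℕ) :
    values g a + values (fun x => g (a + x)) b = values g (a + b) := by
  induction b with
  | zero => simp [values]
  | succ b ih => rw [values_succ, Multiset.add_cons, ih, ← add_assoc, values_succ]

/-- When the output reaches `hi`, both blocks are exhausted, and the two multisets in `perm` join to
one initial segment of `g`. -/
theorem Merging.finish (h : Merging g d w n lo k i mid j hi) (hk : k = hi) :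
    (k = n ∨ 2 * w ∣ k) ∧ SortedBlocks d (2 * w) k ∧ values d k = values g k := by
  have h1 := h.k_eq
  have h2 := h.i_le
  have h3 := h.j_le
  have h4 := h.mid_le
  have h5 := h.hi_eq
  refine ⟨?_, h.sorted, ?_⟩
  · by_cases hn : k = n
    · exact .inl hn
    · right
      have : k = lo + 2 * w := by omega
      rw [this]
      exact h.dvd.add (dvd_refl _)
  · obtain rfl : i = mid := by omega
    rw [h.perm, values_add]
    congr 1
    omega

end

open IExpr in
/-- When a block is finished, start the next one. Word variables `10` to `15` are the block length,
the output index, the next cell and the end of the first block, and the next cell and the end of the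
second block. -/
def mergeReset : Prog :=
  .ite (.ilt (var 11) (var 15)) .skip
    (.seq (.isetVar 12 (var 11))
    (.seq (.isetVar 13 (add (var 11) (var 10)))
    (.seq (.ite (.ilt (var 0) (var 13)) (.isetVar 13 (var 0)) .skip)
    (.seq (.isetVar 14 (var 13))
    (.seq (.isetVar 15 (add (var 11) (add (var 10) (var 10))))
    (.ite (.ilt (var 0) (var 15)) (.isetVar 15 (var 0)) .skip))))))

open IExpr in
/-- Write the next cell of the output. -/
def mergeMove : Prog :=
  .seq (.ite (.conj (.ilt (var 12) (var 13))
      (.neg (.conj (.ilt (var 14) (var 15)) (.rlt (.get 2 (var 14)) (.get 2 (var 12))))))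
    (.seq (.rsetArr 3 (var 11) (.get 2 (var 12))) (.isetVar 12 (add (var 12) (lit 1))))
    (.seq (.rsetArr 3 (var 11) (.get 2 (var 14))) (.isetVar 14 (add (var 14) (lit 1)))))
  (.isetVar 11 (add (var 11) (lit 1)))

/-- The merge invariant on memories. -/
def MergeInv (g : ℕ → ℝ) (w n : ℕ) (k : ℕ) (m : Memory) : Prop :=
  m.ivar 0 = n ∧ m.ivar 10 = w ∧ m.ivar 11 = k ∧ (∀ x, m.rarr 2 x = g x) ∧
  ((m.ivar 15 = k ∧ (k = n ∨ 2 * w ∣ k) ∧ k ≤ n ∧ SortedBlocks (m.rarr 3) (2 * w) k ∧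
      values (m.rarr 3) k = values g k) ∨
    ∃ lo i mid j hi : ℕ, Merging g (m.rarr 3) w n lo k i mid j hi ∧ k < hi ∧ m.ivar 12 = i ∧
      m.ivar 13 = mid ∧ m.ivar 14 = j ∧ m.ivar 15 = hi)

theorem mergeInv_of_merging {g : ℕ → ℝ} {w n k lo i mid j hi : ℕ} {m : Memory} (h0 : m.ivar 0 = n)
    (h10 : m.ivar 10 = w) (h11 : m.ivar 11 = k) (hg : ∀ x, m.rarr 2 x = g x)
    (h : Merging g (m.rarr 3) w n lo k i mid j hi) (h12 : m.ivar 12 = i) (h13 : m.ivar 13 = mid)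
    (h14 : m.ivar 14 = j) (h15 : m.ivar 15 = hi) : MergeInv g w n k m := by
  refine ⟨h0, h10, h11, hg, ?_⟩
  have h1 := h.k_eq
  have h2 := h.i_le
  have h3 := h.j_le
  have h5 := h.hi_eq
  by_cases hk : k = hi
  · have := h.finish hk
    exact .inl ⟨by rw [h15, hk], this.1, by omega, this.2⟩
  · exact .inr ⟨lo, i, mid, j, hi, h, by omega, h12, h13, h14, h15⟩

/-- The invariant of a merge that is not finished. -/
def MergeMid (g : ℕ → ℝ) (w n : ℕ) (k : ℕ) (m : Memory) : Prop :=
  m.ivar 0 = n ∧ m.ivar 10 = w ∧ m.ivar 11 = k ∧ (∀ x, m.rarr 2 x = g x) ∧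
    ∃ lo i mid j hi : ℕ, Merging g (m.rarr 3) w n lo k i mid j hi ∧ k < hi ∧ m.ivar 12 = i ∧
      m.ivar 13 = mid ∧ m.ivar 14 = j ∧ m.ivar 15 = hi

theorem mergeMove_spec {W : ℕ} {g : ℕ → ℝ} {w n k : ℕ} {m : Memory}
    (hW : 4 * (n + 2) ≤ W) (hw : 0 < w) (hgs : SortedBlocks g w n)
    (h : MergeMid g w n k m) : mergeMove.wp W (MergeInv g w n (k + 1)) m := by
  obtain ⟨h0, h10, h11, hg, lo, i, mid, j, hi, h, hk, h12, h13, h14, h15⟩ := h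
  have h1 := h.k_eq
  have h2 := h.i_le
  have h3 := h.j_le
  have h4 := h.hi_eq
  have h6 := h.mid_le
  simp only [mergeMove, Prog.wp, BExpr.Ok, BExpr.Holds, IExpr.Ok, RExpr.Ok, IExpr.val, RExpr.val,
    h12, h13, h14, h15, h11, Memory.ivar_setRArr, Memory.ivar_setIVar, hg, Int.toNat_natCast, abs_le,
    Nat.reduceEqDiff, reduceIte]
  refine ⟨by omega, fun hc => ⟨by omega, by omega, by omega, by omega, by omega, ?_⟩,
    fun hc => ⟨by omega, by omega, by omega, by omega, by omega, ?_⟩⟩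
  · refine mergeInv_of_merging (lo := lo) (i := i + 1) (mid := mid) (j := j) (hi := hi)
      (by simp [h0]) (by simp [h10]) (by simp) (by simp [hg])
      (h.left hw hgs hk (by omega) (fun hj => ?_) ?_ ?_) (by simp) (by simp [h13])
      (by simp [h14]) (by simp [h15])
    · exact not_lt.1 fun hlt => hc.2 ⟨by omega, hlt⟩
    · intro x hx
      simp; omega
    · simp
  · refine mergeInv_of_merging (lo := lo) (i := i) (mid := mid) (j := j + 1) (hi := hi)
      (by simp [h0]) (by simp [h10]) (by simp) (by simp [hg])
      (h.right hw hgs hk (fun hj => ?_) ?_ ?_) (by simp [h12]) (by simp [h13])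
      (by simp) (by simp [h15])
    · by_contra hcc
      exact hc ⟨by omega, fun hh => hcc ⟨by omega, hh.2⟩⟩
    · intro x hx
      simp; omega
    · simp

theorem mergeReset_spec {W : ℕ} {g : ℕ → ℝ} {w n k : ℕ} {m : Memory} (hW : 4 * (n + 2) ≤ W)
    (hw : 0 < w) (hwn : w < n) (hk : k < n) (h : MergeInv g w n k m) :
    mergeReset.wp W (MergeMid g w n k) m := by
  obtain ⟨h0, h10, h11, hg, h | h⟩ := h
  · obtain ⟨h15, hd, -, hs, hp⟩ := h
    have hM := Merging.start (hd.resolve_left hk.ne) hk hs hp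
    simp only [mergeReset, Prog.wp, BExpr.Ok, BExpr.Holds, IExpr.Ok, IExpr.val, h0, h10, h11, h15,
      Memory.ivar_setIVar, abs_le, Nat.reduceEqDiff, reduceIte, OfNat.zero_ne_ofNat]
    have hkn : k < min (k + 2 * w) n := by omega
    refine ⟨by omega, by omega, fun _ => ⟨by omega, by omega, by omega, fun h1 => ⟨by omega,
      by omega, by omega, by omega, fun h2 => ⟨by omega, ?_⟩, fun h2 => ?_⟩, fun h1 => ⟨by omega,
      by omega, by omega, fun h2 => ⟨by omega, ?_⟩, fun h2 => ?_⟩⟩⟩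
    all_goals
      refine ⟨by simp [h0], by simp [h10], by simp [h11], by simp [hg], _, _, _, _, _, hM, hkn, ?_⟩
      simp
      omega
  · have h' := h
    obtain ⟨lo, i, mid, j, hi, h, hkh, h12, h13, h14, h15⟩ := h
    have := h.hi_eq
    simp only [mergeReset, Prog.wp.eq_8, Prog.wp.eq_1, BExpr.Ok, BExpr.Holds, IExpr.Ok, IExpr.val,
      h11, h15, abs_le]
    exact ⟨by omega, fun _ => ⟨h0, h10, h11, hg, h'⟩, fun hc => by omega⟩

open IExpr in
/-- Merge all pairs of blocks from real array `2` to real array `3`. -/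
def mergeAll : Prog :=
  .seq (.seq (.isetVar 11 (lit 0)) (.isetVar 15 (lit 0)))
    (.loop (.ilt (var 11) (var 0)) (.seq mergeReset mergeMove))

theorem mergeAll_spec {W : ℕ} {g : ℕ → ℝ} {w n : ℕ} {m : Memory} (hW : 4 * (n + 2) ≤ W)
    (hw : 0 < w) (hwn : w < n) (hgs : SortedBlocks g w n) (h0 : m.ivar 0 = n) (h10 : m.ivar 10 = w)
    (hg : ∀ x, m.rarr 2 x = g x) :
    Ends W mergeAll m (100 * n + 100) fun m' =>
      SortedBlocks (m'.rarr 3) (2 * w) n ∧ values (m'.rarr 3) n = values g n := by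
  refine Ends.mono (Ends.seq (Q := MergeInv g w n 0) (Ends.of_wp ?_) fun m' hm' =>
    Ends.loop (T := mergeReset.steps + mergeMove.steps)
      (fun k m => ∃ k', k' + k = n ∧ MergeInv g w n k' m) ?_ n m' ⟨0, by omega, hm'⟩)
    (T := _) ?_ fun m' hm' => hm'
  · simp only [Prog.wp, IExpr.Ok, IExpr.val, abs_le]
    refine ⟨by omega, by omega, by simp [h0], by simp [h10], by simp, by simp [hg], .inl ?_⟩
    simp [SortedBlocks, values]
  · rintro k m ⟨k', hk, h⟩
    have h' := h
    obtain ⟨h0, h10, h11, hg, h⟩ := h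
    simp only [BExpr.Ok, BExpr.Holds, IExpr.Ok, IExpr.val, h0, h11, abs_le]
    refine ⟨by omega, fun hlt => ⟨k - 1, by omega, ?_⟩, fun hlt => ?_⟩
    · exact Ends.seq (Ends.of_wp (mergeReset_spec hW hw hwn (by omega) h')) fun m' hm' =>
        (Ends.of_wp (mergeMove_spec hW hw hgs hm')).mono le_rfl fun m'' hm'' =>
          ⟨k' + 1, by omega, hm''⟩
    · obtain rfl : k' = n := by omega
      rcases h with h | ⟨lo, i, mid, j, hi, h, hlt, -⟩
      · exact h.2.2.2
      · have := h.hi_eq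
        omega
  · simp only [mergeReset, mergeMove, Prog.steps, BExpr.cost, IExpr.cost, RExpr.cost]
    omega

open IExpr in
/-- Copy real array `3` to real array `2`. -/
def copyBack : Prog :=
  .seq (.isetVar 11 (lit 0))
    (.loop (.ilt (var 11) (var 0))
      (.seq (.rsetArr 2 (var 11) (.get 3 (var 11))) (.isetVar 11 (add (var 11) (lit 1)))))

theorem copyBack_spec {W n : ℕ} {m : Memory} (hW : 4 * (n + 2) ≤ W) (h0 : m.ivar 0 = n) :
    Ends W copyBack m (20 * n + 20) fun m' => ∀ x < n, m'.rarr 2 x = m.rarr 3 x := by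
  refine Ends.mono (Ends.seq (Q := fun m' => m'.ivar 0 = n ∧ m'.ivar 11 = 0 ∧ m'.rarr 3 = m.rarr 3)
    (Ends.of_wp ?_) fun m' hm' =>
    Ends.loop (T := 10) (fun k m' => ∃ k' : ℕ, k' + k = n ∧ m'.ivar 0 = n ∧ m'.ivar 11 = k' ∧
      m'.rarr 3 = m.rarr 3 ∧ ∀ x < k', m'.rarr 2 x = m.rarr 3 x) ?_ n m'
      ⟨0, by omega, by simp [hm']⟩)
    (T := _) ?_ fun m' hm' => hm'
  · simp only [Prog.wp, IExpr.Ok, IExpr.val, abs_le]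
    refine ⟨by omega, by simp [h0]⟩
  · rintro k m ⟨k', hk, h0, h11, h3, h2⟩
    simp only [BExpr.Ok, BExpr.Holds, IExpr.Ok, IExpr.val, h0, h11, abs_le]
    refine ⟨by omega, fun hlt => ⟨k - 1, by omega, Ends.mono (Ends.of_wp ?_) ?_ fun m' hm' => hm'⟩,
      fun hlt x hx => h2 x (by omega)⟩
    · simp only [Prog.wp, IExpr.Ok, RExpr.Ok, IExpr.val, RExpr.val, Memory.ivar_setRArr, h11,
        Int.toNat_natCast, abs_le]
      refine ⟨by omega, by omega, by omega, by omega, k' + 1, by omega, by simp [h0], by simp, ?_, ?_⟩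
      · rw [← h3]; funext x; simp
      · intro x hx
        by_cases hxk : x = k'
        · simp [hxk, h3]
        · simp [hxk, h2 x (by omega)]
    · simp [Prog.steps, IExpr.cost, RExpr.cost]
  · simp only [Prog.steps, BExpr.cost, IExpr.cost]
    omega

open IExpr in
/-- Sort real array `2`. -/
def sortProg : Prog :=
  .seq (.isetVar 10 (lit 1))
    (.loop (.ilt (var 10) (var 0))
      (.seq mergeAll (.seq copyBack (.isetVar 10 (add (var 10) (var 10))))))

/-- The block length doubles in each round; `n ≤ w * 2 ^ k` bounds the remaining rounds, and `w ≤ 2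
* n` keeps the length within a word. -/
theorem sortProg_spec {W n : ℕ} {m : Memory} (hW : 4 * (n + 2) ≤ W) (hn : 0 < n)
    (h0 : m.ivar 0 = n) :
    Ends W sortProg m (200 * ((n + 1) * (Nat.log 2 n + 1)) + 200) fun m' =>
      (∀ x y, x ≤ y → y < n → m'.rarr 2 x ≤ m'.rarr 2 y) ∧
        values (m'.rarr 2) n = values (m.rarr 2) n := by
  set L := Nat.log 2 n with hL
  have hnL : n < 2 ^ (L + 1) := Nat.lt_pow_succ_log_self (by norm_num) n
  refine Ends.mono (Ends.seq (Q := fun m' => m'.ivar 0 = n ∧ m'.ivar 10 = 1 ∧ m'.rarr 2 = m.rarr 2)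
    (Ends.of_wp ?_) fun m' hm' =>
    Ends.loop (T := 120 * n + 130) (fun k m' => ∃ w : ℕ, 0 < w ∧ w ≤ 2 * n ∧ n ≤ w * 2 ^ k ∧
      m'.ivar 0 = n ∧ m'.ivar 10 = w ∧ SortedBlocks (m'.rarr 2) w n ∧
      values (m'.rarr 2) n = values (m.rarr 2) n) ?_ (L + 1) m'
      ⟨1, by omega, by omega, by omega, hm'.1, by simp [hm'], ?_, by simp [hm']⟩)
    (T := _) ?_ fun m' hm' => hm'
  · simp only [Prog.wp, IExpr.Ok, IExpr.val, abs_le]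
    refine ⟨by omega, by simp [h0]⟩
  · rintro k m₁ ⟨w, hw, hw2, hk, h0, h10, hs, hp⟩
    simp only [BExpr.Ok, BExpr.Holds, IExpr.Ok, IExpr.val, h0, h10, abs_le]
    refine ⟨by omega, fun hlt => ?_, fun hlt => ⟨fun x y hxy hy => ?_, hp⟩⟩
    · rcases k with - | k
      · simp at hk; omega
      refine ⟨k, rfl, Ends.mono (Ends.seq (mergeAll_spec hW hw (by omega) hs h0 h10
        fun _ => rfl).frame fun m₂ hm₂ => Ends.seq (copyBack_spec (n := n) hW ?_).frame
        fun m₃ hm₃ => Ends.of_wp ?_) ?_ fun m' hm' => hm'⟩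
      · rw [hm₂.2.ivar 0 (by decide), h0]
      · have h10' : m₃.ivar 10 = w := by
          rw [hm₃.2.ivar 10 (by decide), hm₂.2.ivar 10 (by decide), h10]
        have h0' : m₃.ivar 0 = n := by
          rw [hm₃.2.ivar 0 (by decide), hm₂.2.ivar 0 (by decide), h0]
        simp only [Prog.wp, IExpr.Ok, IExpr.val, h10', abs_le]
        refine ⟨by omega, 2 * w, by omega, by omega, by rw [pow_succ] at hk; linarith,
          by simp [h0'], by simp; ring, fun x y hxy hy hb => ?_, ?_⟩
        · simp only [Memory.rarr_setIVar]
          rw [hm₃.1 x (by omega), hm₃.1 y hy]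
          exact hm₂.1.1 x y hxy hy hb
        · simp only [Memory.rarr_setIVar]
          rw [values_congr hm₃.1, hm₂.1.2, hp]
      · simp [Prog.steps, IExpr.cost]; omega
    · rcases hxy.eq_or_lt with rfl | hxy
      · exact le_rfl
      · exact hs x y hxy hy (by rw [Nat.div_eq_of_lt (by omega), Nat.div_eq_of_lt (by omega)])
  · intro x y hxy _ hb
    simp at hb; omega
  · simp only [Prog.steps, BExpr.cost, IExpr.cost]
    nlinarith [Nat.zero_le (n * L)]

/-! ### Height paths

Items `0, 1, …` are processed in order, and some of them are kept. A path records a height that does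
not decrease; keeping item `i` forces the height to be congruent to `f i` modulo `1` afterwards, and
to grow strictly if `st i`. Item `i` can be kept only if `0 ≤ p i`, and together with an earlier item
`s` only if `s < p i`. -/

/-- The keys, strictness flags and predecessor bounds of the items. -/
structure Items where
  f : ℕ → ℝ
  st : ℕ → Prop
  p : ℕ → ℤ

namespace Items

/-- The heights `H` form a path on the first `n` items that keeps the items in `S`. -/
structure IsPath (J : Items) (n : ℕ) (S : Finset ℕ) (H : ℕ → ℝ) : Prop where
  lt : ∀ i ∈ S, i < n
  mono : ∀ i < n, H i ≤ H (i + 1)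
  congr : ∀ i ∈ S, ∃ k : ℤ, H (i + 1) = J.f i + k
  strict : ∀ i ∈ S, J.st i → H i < H (i + 1)
  nonneg : ∀ i ∈ S, 0 ≤ J.p i
  compat : ∀ i ∈ S, ∀ s ∈ S, s < i → (s : ℤ) < J.p i

/-- Some path on the first `n` items keeps `h` items, starts at height `w` and ends at most at height
`D`. -/
def Reach (J : Items) (n h : ℕ) (w D : ℝ) : Prop :=
  ∃ S H, J.IsPath n S H ∧ S.card = h ∧ H 0 = w ∧ H n ≤ D

variable {J : Items} {n h : ℕ} {w D : ℝ}

theorem IsPath.le {S : Finset ℕ} {H : ℕ → ℝ} (hp : J.IsPath n S H) {i j : ℕ} (hij : i ≤ j)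
    (hj : j ≤ n) : H i ≤ H j := by
  induction j, hij using Nat.le_induction with
  | base => exact le_rfl
  | succ j hij ih => exact (ih (by omega)).trans (hp.mono j (by omega))

theorem IsPath.subset {S S' : Finset ℕ} {H : ℕ → ℝ} (hp : J.IsPath n S H) (h : S' ⊆ S) :
    J.IsPath n S' H where
  lt i hi := hp.lt i (h hi)
  mono := hp.mono
  congr i hi := hp.congr i (h hi)
  strict i hi := hp.strict i (h hi)
  nonneg i hi := hp.nonneg i (h hi)
  compat i hi s hs := hp.compat i (h hi) s (h hs)

theorem Reach.of_le {h' : ℕ} (hr : J.Reach n h w D) (hh : h' ≤ h) : J.Reach n h' w D := by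
  obtain ⟨S, H, hp, hc, hw, hD⟩ := hr
  obtain ⟨S', hS, hc'⟩ := Finset.exists_subset_card_eq (hc ▸ hh : h' ≤ S.card)
  exact ⟨S', H, hp.subset hS, hc', hw, hD⟩

theorem Reach.card_le (hr : J.Reach n h w D) : h ≤ n := by
  obtain ⟨S, H, hp, rfl, -, -⟩ := hr
  simpa using Finset.card_le_card fun i hi => Finset.mem_range.2 (hp.lt i hi)

theorem reach_zero (hD : w ≤ D) : J.Reach n 0 w D :=
  ⟨∅, fun _ => w, ⟨by simp, by simp, by simp, by simp, by simp, by simp⟩, by simp, rfl, hD⟩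

theorem Reach.mono {D' : ℝ} (hr : J.Reach n h w D) (hD : D ≤ D') : J.Reach n h w D' := by
  obtain ⟨S, H, hp, hc, hw, hD'⟩ := hr
  exact ⟨S, H, hp, hc, hw, hD'.trans hD⟩

theorem Reach.le (hr : J.Reach n h w D) : w ≤ D := by
  obtain ⟨S, H, hp, -, rfl, hD⟩ := hr
  exact (hp.le (Nat.zero_le n) le_rfl).trans hD

/-! ### Concavity -/

/-- The items compatible with all others, for which the predecessor bounds say nothing. -/
def Free (J : Items) : Prop := ∀ i, J.p i = i

/-- Follow the path `H` up to item `k`, then the path `H'`. -/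
theorem IsPath.splice {S S' : Finset ℕ} {H H' : ℕ → ℝ} (hJ : J.Free) (hp : J.IsPath n S H)
    (hp' : J.IsPath n S' H') {k : ℕ} (hk : H k ≤ H' (k + 1))
    (hst : k ∈ S' → J.st k → H k < H' (k + 1)) :
    J.IsPath n (S.filter (· < k) ∪ S'.filter (k ≤ ·)) fun i => if i ≤ k then H i else H' i where
  lt i hi := by
    simp only [Finset.mem_union, Finset.mem_filter] at hi
    rcases hi with hi | hi
    exacts [hp.lt i hi.1, hp'.lt i hi.1]
  mono i hi := by
    rcases lt_trichotomy i k with h | rfl | h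
    · simpa [h.le, Nat.succ_le_of_lt h] using hp.mono i hi
    · simpa using hk
    · simpa [h.not_ge, (Nat.lt_succ_of_lt h).not_ge] using hp'.mono i hi
  congr i hi := by
    simp only [Finset.mem_union, Finset.mem_filter] at hi
    rcases hi with hi | hi
    · simpa [Nat.succ_le_of_lt hi.2] using hp.congr i hi.1
    · simpa [(Nat.lt_succ_of_le hi.2).not_ge] using hp'.congr i hi.1
  strict i hi := by
    simp only [Finset.mem_union, Finset.mem_filter] at hi
    rcases hi with hi | hi
    · simpa [Nat.succ_le_of_lt hi.2, hi.2.le] using hp.strict i hi.1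
    · rcases hi.2.eq_or_lt with rfl | h
      · simpa using hst hi.1
      · simpa [h.not_ge, (Nat.lt_succ_of_lt h).not_ge] using hp'.strict i hi.1
  nonneg i _ := by rw [hJ i]; omega
  compat i _ s _ h := by rw [hJ i]; omega

/-- The congruences see heights only modulo 1. This shift lets two paths be compared in the exchange
argument. -/
theorem IsPath.add_int {S : Finset ℕ} {H : ℕ → ℝ} (hp : J.IsPath n S H) (c : ℤ) :
    J.IsPath n S fun i => H i + c where
  lt := hp.lt
  mono i hi := by simpa using hp.mono i hi
  congr i hi := by
    obtain ⟨k, hk⟩ := hp.congr i hi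
    exact ⟨k + c, by simp only [hk]; push_cast; ring⟩
  strict i hi hs := by simpa using hp.strict i hi hs
  nonneg := hp.nonneg
  compat := hp.compat

theorem card_splice (S S' : Finset ℕ) (k : ℕ) :
    (S.filter (· < k) ∪ S'.filter (k ≤ ·)).card + (S'.filter (· < k) ∪ S.filter (k ≤ ·)).card =
      S.card + S'.card := by
  have hd : ∀ A B : Finset ℕ, Disjoint (A.filter (· < k)) (B.filter (k ≤ ·)) := fun A B =>
    Finset.disjoint_left.2 fun x hx hx' => by simp at hx hx'; omega
  rw [Finset.card_union_of_disjoint (hd _ _), Finset.card_union_of_disjoint (hd _ _)]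
  have h : ∀ A : Finset ℕ, (A.filter (· < k)).card + (A.filter (k ≤ ·)).card = A.card := fun A => by
    rw [← Finset.card_filter_add_card_filter_not (s := A) (· < k)]
    simp
  have := h S
  have := h S'
  omega

/-- Two paths whose end heights are two apart can be exchanged for two paths in the middle. -/
theorem Reach.exchange {a b : ℕ} (hJ : J.Free) (ha : J.Reach n a w (D - 1))
    (hb : J.Reach n b w (D + 1)) :
    ∃ a' b', J.Reach n a' w D ∧ J.Reach n b' w D ∧ a' + b' = a + b := by
  have ha' := ha
  have hb' := hb
  obtain ⟨S, H, hp, hc, h0, hn⟩ := ha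
  obtain ⟨S', H', hp', hc', h0', hn'⟩ := hb
  by_cases hD : H' n ≤ D
  · exact ⟨a, b, ha'.mono (by linarith), ⟨S', H', hp', hc', h0', hD⟩, rfl⟩
  have hq := hp.add_int 1
  -- The raised path `H + 1` starts above `H'` and ends below it. The crossing is taken at the first
  -- index where `H'` is strictly higher.
  have hex : ∃ k, H k + 1 < H' k := ⟨n, by linarith⟩
  classical
  obtain ⟨k, hk⟩ : ∃ k, Nat.find hex = k + 1 := by
    refine Nat.exists_eq_succ_of_ne_zero fun h => ?_
    have := Nat.find_spec hex
    rw [h] at this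
    linarith
  have hk1 : H (k + 1) + 1 < H' (k + 1) := hk ▸ Nat.find_spec hex
  have hk0 : H' k ≤ H k + 1 := not_lt.1 (Nat.find_min hex (by omega))
  have hkn : k < n := by
    have := Nat.find_min' hex (m := n) (by linarith)
    omega
  have hm := hp.mono k hkn
  -- Raised path first, then `H'`: it runs from `w + 1` to at most `D + 1`, and lowering it by 1
  -- gives the required ends. The opposite splice `r2` already runs from `w` to at most `D`.
  have r1 := (hq.splice hJ hp' (k := k) (by push_cast; linarith)
    (fun _ _ => by push_cast; linarith)).add_int (-1)
  have r2 := hp'.splice hJ hq (k := k) (by push_cast; linarith) fun hs hst => by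
    have := hp.strict k hs hst
    push_cast
    linarith
  have hkn' : ¬ n ≤ k := by omega
  exact ⟨_, _, ⟨_, _, r1, rfl, by simp [h0], by simp [hkn']; linarith⟩,
    ⟨_, _, r2, rfl, by simp [h0'], by simp [hkn']; linarith⟩,
    by rw [card_splice, hc, hc']⟩

/-- The maximum number of kept items. -/
noncomputable def best (J : Items) (n : ℕ) (w D : ℝ) : ℕ := sSup {h | J.Reach n h w D}

theorem bddAbove_reach : BddAbove {h | J.Reach n h w D} := ⟨n, fun _ hr => hr.card_le⟩

theorem Reach.le_best (hr : J.Reach n h w D) : h ≤ J.best n w D := le_csSup bddAbove_reach hr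

theorem reach_best (hD : w ≤ D) : J.Reach n (J.best n w D) w D :=
  Nat.sSup_mem ⟨0, reach_zero hD⟩ bddAbove_reach

theorem best_le (hD : w ≤ D) : J.best n w D ≤ n := (reach_best hD).card_le

theorem best_mono {D' : ℝ} (hD : w ≤ D) (h : D ≤ D') : J.best n w D ≤ J.best n w D' :=
  ((reach_best hD).mono h).le_best

/-- The maximum number of kept items is concave in the end height. -/
theorem best_concave (hJ : J.Free) (hD : w ≤ D - 1) :
    J.best n w (D - 1) + J.best n w (D + 1) ≤ 2 * J.best n w D := by
  obtain ⟨a, b, ha, hb, h⟩ := (reach_best (J := J) (n := n) hD).exchange hJ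
    (reach_best (by linarith : w ≤ D + 1))
  have := ha.le_best
  have := hb.le_best
  omega

/-! ### Dynamic programming -/

open Classical in
/-- The least height after keeping item `i` from height `x`. -/
noncomputable def lift (J : Items) (i : ℕ) (x : ℝ) : ℝ :=
  if J.st i then J.f i + ⌊x - J.f i⌋ + 1 else J.f i - ⌊J.f i - x⌋

theorem le_lift (i : ℕ) (x : ℝ) : x ≤ J.lift i x := by
  unfold lift
  split_ifs
  · linarith [Int.lt_floor_add_one (x - J.f i)]
  · linarith [Int.floor_le (J.f i - x)]

theorem lift_lt (i : ℕ) (x : ℝ) : J.lift i x ≤ x + 1 := by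
  unfold lift
  split_ifs
  · linarith [Int.floor_le (x - J.f i)]
  · linarith [Int.lt_floor_add_one (J.f i - x)]

theorem lt_lift {i : ℕ} (h : J.st i) (x : ℝ) : x < J.lift i x := by
  rw [lift, if_pos h]
  linarith [Int.lt_floor_add_one (x - J.f i)]

theorem lift_congr (i : ℕ) (x : ℝ) : ∃ k : ℤ, J.lift i x = J.f i + k := by
  unfold lift
  split_ifs
  · exact ⟨⌊x - J.f i⌋ + 1, by push_cast; ring⟩
  · exact ⟨-⌊J.f i - x⌋, by push_cast; ring⟩

/-- With `le_lift`, `lt_lift` and `lift_congr` this characterizes the lift as the least admissible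
height; the optimality of greedy paths and of the recursion rests on it. -/
theorem lift_le {i : ℕ} {x y : ℝ} (hxy : x ≤ y) (hst : J.st i → x < y)
    (hc : ∃ k : ℤ, y = J.f i + k) : J.lift i x ≤ y := by
  obtain ⟨k, rfl⟩ := hc
  unfold lift
  split_ifs with h
  · have : ⌊x - J.f i⌋ < k := Int.floor_lt.2 (by linarith [hst h])
    have : ((⌊x - J.f i⌋ + 1 : ℤ) : ℝ) ≤ k := by exact_mod_cast this
    push_cast at this
    linarith
  · have : -k ≤ ⌊J.f i - x⌋ := Int.le_floor.2 (by push_cast; linarith)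
    have : ((-k : ℤ) : ℝ) ≤ ⌊J.f i - x⌋ := by exact_mod_cast this
    push_cast at this
    linarith

/-- The least end height of a path on the first `i` items that keeps `h` of them, starting from
height `0`, or `top` if there is none below `top`. -/
noncomputable def minHeight (J : Items) (top : ℝ) (i h : ℕ) : ℝ :=
  match i, h with
  | _, 0 => 0
  | 0, _ + 1 => top
  | i + 1, h + 1 =>
    if hp : 0 ≤ J.p i ∧ J.p i ≤ i then
      min (minHeight J top i (h + 1)) (J.lift i (minHeight J top (J.p i).toNat h))
    else minHeight J top i (h + 1)
termination_by i
decreasing_by all_goals omega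

theorem minHeight_zero (top : ℝ) (i : ℕ) : J.minHeight top i 0 = 0 := by
  unfold minHeight; rfl

theorem minHeight_le (top : ℝ) (ht : 0 ≤ top) (i h : ℕ) : J.minHeight top i h ≤ top := by
  induction i with
  | zero => rcases h with - | h <;> simp [minHeight, ht]
  | succ i ih =>
    rcases h with - | h
    · simp [minHeight, ht]
    · rw [minHeight]
      split_ifs
      exacts [(min_le_left _ _).trans ih, ih]

theorem minHeight_nonneg (top : ℝ) (ht : 0 ≤ top) (i h : ℕ) : 0 ≤ J.minHeight top i h := by
  induction i using Nat.strong_induction_on generalizing h with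
  | _ i ih =>
    rcases i with - | i <;> rcases h with - | h
    · simp [minHeight]
    · simp [minHeight, ht]
    · simp [minHeight]
    · rw [minHeight]
      split_ifs with hp
      · exact le_min (ih i (by omega) _) ((ih _ (by omega) _).trans (le_lift i _))
      · exact ih i (by omega) _

/-- Such cells are never stored in the table; the program substitutes the bound `top` for them. -/
theorem minHeight_of_lt (top : ℝ) {i h : ℕ} (hi : i < h) : J.minHeight top i h = top := by
  induction i using Nat.strong_induction_on generalizing h with
  | _ i ih =>
    obtain ⟨h, rfl⟩ : ∃ h', h = h' + 1 := ⟨h - 1, by omega⟩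
    rcases i with - | i
    · simp [minHeight]
    · rw [minHeight]
      split_ifs with hp
      · rw [ih i (by omega) (by omega), ih _ (by omega) (by omega)]
        exact min_eq_left (le_lift i _)
      · exact ih i (by omega) (by omega)

/-- Unfolding the recursion builds a path. The hypothesis `D < top` excludes the default value, and
it passes to the predecessor because lifting never lowers a height. -/
theorem reach_of_minHeight_le {top : ℝ} {i h : ℕ} {D : ℝ} (ht : D < top)
    (hD : J.minHeight top i h ≤ D) : J.Reach i h 0 D := by
  induction i using Nat.strong_induction_on generalizing h D with
  | _ i ih =>
    rcases i with - | i <;> rcases h with - | h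
    · rw [minHeight_zero] at hD; exact reach_zero hD
    · simp only [minHeight] at hD; linarith
    · rw [minHeight_zero] at hD; exact reach_zero hD
    -- Item `i` is not kept: the path is continued at constant height.
    have key : J.minHeight top i (h + 1) ≤ D → J.Reach (i + 1) (h + 1) 0 D := fun hD' => by
      obtain ⟨S, H, hp, hc, h0, hn⟩ := ih i (by omega) ht hD'
      have hS : ∀ j ∈ S, j ≠ i ∧ j < i := fun j hj => ⟨(hp.lt j hj).ne, hp.lt j hj⟩
      refine ⟨S, fun j => if j = i + 1 then H i else H j, ?_, hc, by simp [h0], by simp [hn]⟩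
      refine ⟨fun j hj => (hp.lt j hj).trans (Nat.lt_succ_self i), fun j hj => ?_, fun j hj => ?_,
        fun j hj => ?_, hp.nonneg, hp.compat⟩
      · rcases Nat.lt_succ_iff_lt_or_eq.1 hj with hj | rfl
        · simpa [hj.ne, show j ≠ i + 1 by omega] using hp.mono j hj
        · simp
      · simpa [(hS j hj).1] using hp.congr j hj
      · have := (hS j hj).2
        simpa [(hS j hj).1, show j ≠ i + 1 by omega] using hp.strict j hj
    rw [minHeight] at hD
    split_ifs at hD with hpi
    · rcases min_le_iff.1 hD with hD | hD
      · exact key hD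
      obtain ⟨q, hq⟩ : ∃ q, q = (J.p i).toNat := ⟨_, rfl⟩
      rw [← hq] at hD
      have hqi : q ≤ i := by omega
      obtain ⟨S, H, hp, hc, h0, hn⟩ := ih q (by omega) (h := h) (D := J.minHeight top q h)
        (((le_lift i _).trans hD).trans_lt ht) le_rfl
      have hS : i ∉ S := fun hi => absurd (hp.lt i hi) (by omega)
      obtain ⟨y, hy⟩ : ∃ y, y = J.lift i (J.minHeight top q h) := ⟨_, rfl⟩
      rw [← hy] at hD
      have hny : H q ≤ y := hy ▸ hn.trans (le_lift i _)
      -- Item `i` is kept: the path for the first `q = p i` items stays flat until `i` and then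
      -- jumps to the lifted height. All previously kept items are below `q`, hence compatible with
      -- `i`.
      refine ⟨insert i S, fun j => if j ≤ q then H j else if j ≤ i then H q else y, ?_,
        by rw [Finset.card_insert_of_notMem hS, hc], by simp [h0], ?_⟩
      · refine ⟨fun j hj => ?_, fun j hj => ?_, fun j hj => ?_, fun j hj hs => ?_, fun j hj => ?_,
          fun j hj s hs hsj => ?_⟩
        · rcases Finset.mem_insert.1 hj with rfl | hj
          · omega
          · have := hp.lt j hj; omega
        · by_cases h1 : j + 1 ≤ q
          · simpa [h1, show j ≤ q by omega] using hp.mono j h1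
          · by_cases h2 : j + 1 ≤ i
            · by_cases h3 : j ≤ q
              · obtain rfl : j = q := by omega
                simp [h2]
              · simp [h1, h2, h3, show j ≤ i by omega]
            · obtain rfl : j = i := by omega
              by_cases h3 : j ≤ q
              · obtain rfl : j = q := by omega
                simpa using hny
              · simpa [h1, h3] using hny
        · rcases Finset.mem_insert.1 hj with rfl | hj
          · simpa [show ¬ j + 1 ≤ q by omega, hy] using lift_congr j _
          · have := hp.lt j hj
            simpa [show j + 1 ≤ q by omega] using hp.congr j hj
        · rcases Finset.mem_insert.1 hj with rfl | hj
          · have : H q < y := hy ▸ hn.trans_lt (lt_lift hs _)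
            by_cases h3 : j ≤ q
            · obtain rfl : j = q := by omega
              simpa using this
            · simpa [show ¬ j + 1 ≤ q by omega, h3] using this
          · have := hp.lt j hj
            simpa [show j + 1 ≤ q by omega, show j ≤ q by omega] using hp.strict j hj hs
        · rcases Finset.mem_insert.1 hj with rfl | hj
          exacts [hpi.1, hp.nonneg j hj]
        · rcases Finset.mem_insert.1 hj with hji | hj'
          · rcases Finset.mem_insert.1 hs with hsi | hs'
            · omega
            · have := hp.lt s hs'
              rw [hji]; omega
          · rcases Finset.mem_insert.1 hs with hsi | hs'
            · have := hp.lt j hj'; omega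
            · exact hp.compat j hj' s hs' hsj
      · simpa [show ¬ i + 1 ≤ q by omega] using hD
    · exact key hD

/-- If the last item is kept, all other kept items lie below its predecessor bound, so a truncated
path is covered by the induction hypothesis; minimality of the lift does the rest. -/
theorem minHeight_le_of_reach {top : ℝ} (hJ : ∀ i, J.p i ≤ i) {i h : ℕ} {D : ℝ}
    (hr : J.Reach i h 0 D) : J.minHeight top i h ≤ D := by
  induction i using Nat.strong_induction_on generalizing h D with
  | _ i ih =>
    rcases h with - | h
    · rw [minHeight_zero]; exact hr.le
    rcases i with - | i
    · exact absurd hr.card_le (by omega)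
    obtain ⟨S, H, hp, hc, h0, hn⟩ := hr
    have hmi := hp.mono i (by omega)
    have trunc : ∀ q ≤ i + 1, ∀ S' ⊆ S, (∀ j ∈ S', j < q) → J.IsPath q S' H := fun q hq S' hS' hlt =>
      ⟨hlt, fun j hj => hp.mono j (by omega), fun j hj => hp.congr j (hS' hj),
        fun j hj => hp.strict j (hS' hj), fun j hj => hp.nonneg j (hS' hj),
        fun j hj s hs => hp.compat j (hS' hj) s (hS' hs)⟩
    by_cases hi : i ∈ S
    · have hpi : 0 ≤ J.p i ∧ J.p i ≤ i := ⟨hp.nonneg i hi, hJ i⟩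
      rw [minHeight, dif_pos hpi]
      refine min_le_iff.2 (.inr ?_)
      set q := (J.p i).toNat
      have hb : J.minHeight top q h ≤ H q := by
        refine ih q (by omega) ⟨S.erase i, H, trunc q (by omega) _ (Finset.erase_subset _ _) ?_,
          by rw [Finset.card_erase_of_mem hi, hc]; rfl, h0, le_rfl⟩
        intro j hj
        have hj' := Finset.mem_erase.1 hj
        have := hp.compat i hi j hj'.2 (by have := hp.lt j hj'.2; omega)
        omega
      have hqi : H q ≤ H i := hp.le (by omega) (by omega)
      exact (lift_le (hb.trans (hqi.trans hmi)) (fun hs => (hb.trans hqi).trans_lt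
        (hp.strict i hi hs)) (hp.congr i hi)).trans hn
    · have key : J.minHeight top i (h + 1) ≤ D := by
        refine ih i (by omega) ⟨S, H, trunc i (by omega) S subset_rfl ?_, hc, h0, hmi.trans hn⟩
        intro j hj
        have := hp.lt j hj
        have : j ≠ i := fun h => hi (h ▸ hj)
        omega
      rw [minHeight]
      split_ifs
      exacts [(min_le_left _ _).trans key, key]

theorem minHeight_le_iff {top : ℝ} (hJ : ∀ i, J.p i ≤ i) {i h : ℕ} {D : ℝ}
    (hD : D < top) : J.minHeight top i h ≤ D ↔ J.Reach i h 0 D :=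
  ⟨reach_of_minHeight_le hD, minHeight_le_of_reach hJ⟩

end Items

/-! ### Drops of a permutation -/

section Drops

variable {n : ℕ} (π : Equiv.Perm (Fin (n + 2)))

/-- The value of a permutation, scaled to `[0, 1)`. -/
noncomputable def permKey (x : Fin (n + 2)) : ℝ := ((π x : ℕ) : ℝ) / (n + 2)

theorem permKey_nonneg (x : Fin (n + 2)) : 0 ≤ permKey π x := by unfold permKey; positivity

theorem permKey_lt_one (x : Fin (n + 2)) : permKey π x < 1 := by
  unfold permKey
  rw [div_lt_one (by positivity)]
  exact_mod_cast (π x).isLt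

theorem permKey_lt {x y : Fin (n + 2)} : permKey π x < permKey π y ↔ π x < π y := by
  unfold permKey
  rw [div_lt_div_iff_of_pos_right (by positivity), Nat.cast_lt, Fin.val_fin_lt]

theorem permKey_le {x y : Fin (n + 2)} : permKey π x ≤ permKey π y ↔ π x ≤ π y := by
  rw [← not_lt, permKey_lt, not_lt]

/-- The interior indices as items; item `i` is index `i + 1`. -/
noncomputable def permItems : Items where
  f i := if h : i + 1 < n + 2 then permKey π ⟨i + 1, h⟩ else 0
  st _ := False
  p i := i

/-- The height at a chosen index is the number of drops so far plus its key. Keys lie in `[0, 1)`,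
so the unit added at a drop outweighs the fall of the key. -/
theorem reach_of_drops {h d : ℕ} (s : Fin (h + 2) → Fin (n + 2)) (hs : StrictMono s) (h0 : s 0 = 0)
    (hl : s (Fin.last (h + 1)) = Fin.last (n + 1)) (hd : drops π s ≤ d) :
    (permItems π).Reach n h (permKey π 0) (d + permKey π (Fin.last (n + 1))) := by
  set c : Fin (h + 2) → ℕ := fun k =>
    (Finset.univ.filter fun j : Fin (h + 1) => j.castSucc < k ∧ π (s j.succ) < π (s j.castSucc)).card
    with hc
  have hc1 : ∀ j : Fin (h + 1), π (s j.succ) < π (s j.castSucc) → c j.castSucc + 1 ≤ c j.succ := by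
    intro j hj
    rw [Nat.succ_le_iff]
    refine Finset.card_lt_card ⟨fun x hx => ?_, fun hsub => ?_⟩
    · simp only [Finset.mem_filter, Finset.mem_univ, true_and] at hx ⊢
      exact ⟨hx.1.trans Fin.castSucc_lt_succ, hx.2⟩
    · have := hsub (x := j) (by simp [hj])
      simp at this
  have hc2 : ∀ j : Fin (h + 1), c j.castSucc ≤ c j.succ := by
    intro j
    refine Finset.card_le_card fun x hx => ?_
    simp only [Finset.mem_filter, Finset.mem_univ, true_and] at hx ⊢
    exact ⟨hx.1.trans Fin.castSucc_lt_succ, hx.2⟩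
  set V : Fin (h + 2) → ℝ := fun k => c k + permKey π (s k) with hV
  have hVm : Monotone V := by
    refine Fin.monotone_iff_le_succ.2 fun j => ?_
    simp only [hV]
    by_cases hj : π (s j.succ) < π (s j.castSucc)
    · have h1 : ((c j.castSucc + 1 : ℕ) : ℝ) ≤ c j.succ := by exact_mod_cast hc1 j hj
      push_cast at h1
      linarith [permKey_lt_one π (s j.castSucc), permKey_nonneg π (s j.succ)]
    · have h1 : ((c j.castSucc : ℕ) : ℝ) ≤ c j.succ := by exact_mod_cast hc2 j
      linarith [(permKey_le π).2 (not_lt.1 hj)]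
  have hsinj := hs.injective
  set pos : Fin (h + 2) → ℕ := fun k => (s k : ℕ) with hpos
  have hposm : StrictMono pos := fun a b hab => hs hab
  -- The heights are known only at the chosen indices; any monotone extension to the other indices
  -- serves.
  obtain ⟨g, hg, hgV⟩ : ∃ g : ℕ → ℝ, Monotone g ∧ ∀ k, g (pos k) = V k := by
    have hmo : MonotoneOn (fun x : ℕ => V (Function.invFun pos x)) (Set.range pos) := by
      rintro _ ⟨a, rfl⟩ _ ⟨b, rfl⟩ hab
      simp only [Function.leftInverse_invFun hposm.injective _]
      exact hVm (hposm.le_iff_le.1 hab)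
    have hfin : (Set.image (fun x : ℕ => V (Function.invFun pos x)) (Set.range pos)).Finite :=
      (Set.finite_range pos).image _
    obtain ⟨g, hg, he⟩ := hmo.exists_monotone_extension hfin.bddBelow hfin.bddAbove
    refine ⟨g, hg, fun k => ?_⟩
    rw [← he ⟨k, rfl⟩]
    simp only [Function.leftInverse_invFun hposm.injective _]
  have hmem : ∀ k : Fin h, pos k.castSucc.succ - 1 + 1 = pos k.castSucc.succ := fun k => by
    have := hposm (Fin.succ_pos k.castSucc)
    omega
  -- The two end indices are not items, and item `i` stands for index `i + 1`.
  refine ⟨Finset.univ.image fun k : Fin h => pos k.castSucc.succ - 1, g, ⟨fun i hi => ?_,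
    fun i _ => hg (Nat.le_succ i), fun i hi => ?_, fun i _ hst => hst.elim, fun i _ => ?_,
    fun i _ s _ hsi => ?_⟩, ?_, ?_, ?_⟩
  · obtain ⟨k, -, rfl⟩ := Finset.mem_image.1 hi
    have h1 : pos k.castSucc.succ < pos (Fin.last (h + 1)) :=
      hposm (by rw [Fin.succ_castSucc]; exact Fin.castSucc_lt_last _)
    have h2 : pos (Fin.last (h + 1)) = n + 1 := by simp [hpos, hl]
    have := hmem k
    omega
  · obtain ⟨k, -, rfl⟩ := Finset.mem_image.1 hi
    refine ⟨c k.castSucc.succ, ?_⟩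
    rw [hmem k, hgV]
    have : pos k.castSucc.succ < n + 2 := (s k.castSucc.succ).isLt
    simp only [permItems, hmem k, this, dif_pos, hV]
    push_cast
    exact add_comm _ _
  · simp [permItems]
  · simpa [permItems] using hsi
  · rw [Finset.card_image_of_injective, Finset.card_univ, Fintype.card_fin]
    intro a b hab
    have hab : pos a.castSucc.succ - 1 = pos b.castSucc.succ - 1 := hab
    have : pos a.castSucc.succ = pos b.castSucc.succ := by rw [← hmem a, ← hmem b, hab]
    simpa using hposm.injective this
  · have : pos 0 = 0 := by simp [hpos, h0]
    rw [← this, hgV]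
    simp [hV, hc, h0]
  · have h2 : pos (Fin.last (h + 1)) = n + 1 := by simp [hpos, hl]
    refine (hg (Nat.le_succ n)).trans ?_
    have h3 := hgV (Fin.last (h + 1))
    rw [h2] at h3
    rw [Nat.succ_eq_add_one, h3]
    simp only [hV, hl]
    have : c (Fin.last (h + 1)) ≤ d := by
      refine le_trans (le_of_eq ?_) hd
      simp [hc, drops, Fin.castSucc_lt_last]
    have : (c (Fin.last (h + 1)) : ℝ) ≤ d := by exact_mod_cast this
    linarith

/-- The fractional part of the height at a chosen index is its key. Hence the floor does not fall
from one chosen index to the next and rises by at least 1 at a drop; telescoping from floor 0 to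
floor `d` bounds the number of drops. -/
theorem drops_of_reach {h d : ℕ}
    (hr : (permItems π).Reach n h (permKey π 0) (d + permKey π (Fin.last (n + 1)))) :
    ∃ s : Fin (h + 2) → Fin (n + 2), StrictMono s ∧ s 0 = 0 ∧
      s (Fin.last (h + 1)) = Fin.last (n + 1) ∧ drops π s ≤ d := by
  obtain ⟨S, H, hp, hc, h0, hn⟩ := hr
  -- The path ends at index `n`. The last index `n + 1` gets the bound itself as height, which has
  -- the right fractional part.
  set G : ℕ → ℝ := fun x => if x ≤ n then H x else d + permKey π (Fin.last (n + 1)) with hG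
  have hGm : ∀ x y, x ≤ y → y ≤ n + 1 → G x ≤ G y := by
    intro x y hxy hy
    by_cases h1 : y ≤ n
    · simpa [hG, h1, hxy.trans h1] using hp.le hxy h1
    · by_cases h2 : x ≤ n
      · simpa [hG, h1, h2] using (hp.le h2 le_rfl).trans hn
      · simp [hG, h1, h2]
  set T : Finset (Fin (n + 2)) := Finset.univ.filter fun x =>
    x = 0 ∨ x = Fin.last (n + 1) ∨ ∃ i ∈ S, (x : ℕ) = i + 1 with hT
  have hTG : ∀ x ∈ T, ∃ k : ℤ, G x = k + permKey π x := by
    intro x hx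
    simp only [hT, Finset.mem_filter, Finset.mem_univ, true_and] at hx
    rcases hx with rfl | rfl | ⟨i, hi, hx⟩
    · exact ⟨0, by simp [hG, h0]⟩
    · exact ⟨d, by simp [hG]⟩
    · obtain ⟨k, hk⟩ := hp.congr i hi
      have hin := hp.lt i hi
      refine ⟨k, ?_⟩
      have hx' : (⟨i + 1, by omega⟩ : Fin (n + 2)) = x := Fin.ext hx.symm
      simp only [hG, hx, show i + 1 ≤ n by omega, if_true, hk, permItems,
        show i + 1 < n + 2 by omega, dif_pos, hx']
      ring
  have hTc : T.card = h + 2 := by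
    have hT' : T = insert 0 (insert (Fin.last (n + 1)) (S.attach.image fun i : S =>
        (⟨i.1 + 1, by have := hp.lt i.1 i.2; omega⟩ : Fin (n + 2)))) := by
      ext x
      simp only [hT, Finset.mem_filter, Finset.mem_univ, true_and, Finset.mem_insert,
        Finset.mem_image, Finset.mem_attach, Subtype.exists, Fin.ext_iff]
      refine or_congr Iff.rfl (or_congr Iff.rfl ⟨?_, ?_⟩)
      · rintro ⟨i, hi, hx⟩; exact ⟨i, hi, hx.symm⟩
      · rintro ⟨i, hi, hx⟩; exact ⟨i, hi, hx.symm⟩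
    rw [hT', Finset.card_insert_of_notMem, Finset.card_insert_of_notMem,
      Finset.card_image_of_injective, Finset.card_attach, hc]
    · intro a b hab
      have h1 : a.1 + 1 = b.1 + 1 := congrArg Fin.val hab
      exact Subtype.ext (by omega)
    · intro hm
      obtain ⟨i, -, hi⟩ := Finset.mem_image.1 hm
      have h1 : i.1 + 1 = n + 1 := congrArg Fin.val hi
      have := hp.lt i.1 i.2
      omega
    · intro hm
      rcases Finset.mem_insert.1 hm with h1 | h1
      · exact absurd (congrArg Fin.val h1) (by simp)
      · obtain ⟨i, -, hi⟩ := Finset.mem_image.1 h1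
        have h1 : i.1 + 1 = 0 := congrArg Fin.val hi
        omega
  set s := T.orderEmbOfFin hTc with hs
  have hmem : ∀ k, s k ∈ T := fun k => T.orderEmbOfFin_mem hTc k
  have hs0 : s 0 = 0 := by
    have : (0 : Fin (n + 2)) ∈ T := by simp [hT]
    have h1 := Finset.orderEmbOfFin_zero hTc (by omega)
    have h2 : s 0 ≤ 0 := by
      rw [show (0 : Fin (h + 2)) = ⟨0, by omega⟩ from rfl, hs, h1]
      exact Finset.min'_le _ _ this
    exact le_antisymm h2 (Fin.zero_le _)
  have hsl : s (Fin.last (h + 1)) = Fin.last (n + 1) := by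
    have : Fin.last (n + 1) ∈ T := by simp [hT]
    have h1 := Finset.orderEmbOfFin_last hTc (by omega)
    have h2 : Fin.last (n + 1) ≤ s (Fin.last (h + 1)) := by
      rw [show Fin.last (h + 1) = ⟨h + 2 - 1, by omega⟩ from rfl, hs, h1]
      exact Finset.le_max' _ _ this
    exact le_antisymm (Fin.le_last _) h2
  refine ⟨s, s.strictMono, hs0, hsl, ?_⟩
  set L : ℕ → ℤ := fun k => if hk : k < h + 2 then ⌊G (s ⟨k, hk⟩)⌋ else 0 with hL
  have hfl : ∀ x ∈ T, ∃ k : ℤ, G x = k + permKey π x ∧ ⌊G x⌋ = k := fun x hx => by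
    obtain ⟨k, hk⟩ := hTG x hx
    refine ⟨k, hk, Int.floor_eq_iff.2 ⟨?_, ?_⟩⟩ <;> rw [hk]
    · linarith [permKey_nonneg π x]
    · linarith [permKey_lt_one π x]
  have hstep : ∀ j : Fin (h + 1), (if π (s j.succ) < π (s j.castSucc) then 1 else 0 : ℤ) ≤
      L (j + 1) - L j := by
    intro j
    have h1 : L (j + 1) = ⌊G (s j.succ)⌋ := by simp [hL, j.isLt]; rfl
    have h2 : L j = ⌊G (s j.castSucc)⌋ := by simp [hL, show (j : ℕ) < h + 2 by omega]; rfl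
    rw [h1, h2]
    obtain ⟨a, ha, ha'⟩ := hfl _ (hmem j.succ)
    obtain ⟨b, hb, hb'⟩ := hfl _ (hmem j.castSucc)
    have hle : G (s j.castSucc) ≤ G (s j.succ) :=
      hGm _ _ (s.strictMono.monotone Fin.castSucc_lt_succ.le) (by omega)
    rw [ha', hb']
    rw [ha, hb] at hle
    split_ifs with hlt
    · have := (permKey_lt π).2 hlt
      have : (b : ℝ) < a := by linarith
      have : b < a := by exact_mod_cast this
      omega
    · have : (b : ℝ) < a + 1 := by
        linarith [permKey_nonneg π (s j.castSucc), permKey_lt_one π (s j.succ)]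
      have : b < a + 1 := by exact_mod_cast this
      omega
  have hsum : (drops π s : ℤ) ≤ L (h + 1) - L 0 := by
    rw [← Finset.sum_range_sub, ← Fin.sum_univ_eq_sum_range (fun k => L (k + 1) - L k)]
    refine le_trans (le_of_eq ?_) (Finset.sum_le_sum fun j _ => hstep j)
    simp [drops]
  have hLl : L (h + 1) = d := by
    have : L (h + 1) = ⌊G (s (Fin.last (h + 1)))⌋ := by simp [hL]; rfl
    rw [this, hsl]
    obtain ⟨k, hk, hk'⟩ := hfl (Fin.last (n + 1)) (by simp [hT])
    rw [hk']
    simp only [hG, Fin.val_last, show ¬ n + 1 ≤ n by omega, if_false] at hk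
    have : (k : ℝ) = d := by linarith
    exact_mod_cast this
  have hL0 : L 0 = 0 := by
    have : L 0 = ⌊G (s 0)⌋ := by simp [hL]
    rw [this, hs0]
    simp only [hG, Fin.val_zero, Nat.zero_le, if_true, h0]
    exact Int.floor_eq_zero_iff.2 ⟨permKey_nonneg π 0, permKey_lt_one π 0⟩
  omega

theorem maxKept_eq_best (d : ℕ) : maxKept π d =
    (permItems π).best n (permKey π 0) (d + permKey π (Fin.last (n + 1))) := by
  unfold maxKept Items.best
  congr 1
  ext h
  constructor
  · rintro ⟨s, hs, h0, hl, hd⟩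
    exact reach_of_drops π s hs h0 hl hd
  · exact drops_of_reach π

/-- One more drop raises the end height by exactly 1, so this is `Items.best_concave`. The
assumption on `d` makes even the smallest of the three end heights at least 1, above the start
height, which is a key. -/
theorem maxKept_concave {d : ℕ} (hd : 1 < d) :
    (maxKept π (d + 1) : ℤ) - maxKept π d ≤ (maxKept π d : ℤ) - maxKept π (d - 1) := by
  obtain ⟨d, rfl⟩ : ∃ e, d = e + 1 := ⟨d - 1, by omega⟩
  have hd1 : (1 : ℝ) ≤ d := by exact_mod_cast (by omega : 1 ≤ d)
  have h := Items.best_concave (J := permItems π) (n := n) (w := permKey π 0)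
    (D := (d + 1 : ℕ) + permKey π (Fin.last (n + 1))) (fun _ => rfl)
    (by push_cast; linarith [permKey_lt_one π 0, permKey_nonneg π (Fin.last (n + 1))])
  rw [maxKept_eq_best, maxKept_eq_best, maxKept_eq_best, Nat.add_sub_cancel]
  rw [show ((d + 1 : ℕ) : ℝ) + permKey π (Fin.last (n + 1)) - 1 = d + permKey π (Fin.last (n + 1)) by
    push_cast; ring, show ((d + 1 : ℕ) : ℝ) + permKey π (Fin.last (n + 1)) + 1 =
      (d + 1 + 1 : ℕ) + permKey π (Fin.last (n + 1)) by push_cast; ring] at h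
  omega

end Drops

/-! ### Monotone step functions -/

/-- The maximum of `0` and the values of `f` on `A`. -/
noncomputable def maxOn {ι : Type*} (A : Finset ι) (f : ι → ℝ) : ℝ :=
  (insert 0 (A.image f)).max' (Finset.insert_nonempty _ _)

section MaxOn

variable {ι : Type*} {A B : Finset ι} {f : ι → ℝ}

theorem maxOn_nonneg : 0 ≤ maxOn A f := Finset.le_max' _ _ (Finset.mem_insert_self _ _)

theorem le_maxOn {i : ι} (hi : i ∈ A) : f i ≤ maxOn A f :=
  Finset.le_max' _ _ (Finset.mem_insert_of_mem (Finset.mem_image_of_mem f hi))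

theorem maxOn_le {D : ℝ} (h0 : 0 ≤ D) (h : ∀ i ∈ A, f i ≤ D) : maxOn A f ≤ D := by
  refine Finset.max'_le _ _ _ fun y hy => ?_
  rcases Finset.mem_insert.1 hy with rfl | hy
  · exact h0
  · obtain ⟨i, hi, rfl⟩ := Finset.mem_image.1 hy
    exact h i hi

theorem maxOn_lt {D : ℝ} (h0 : 0 < D) (h : ∀ i ∈ A, f i < D) : maxOn A f < D := by
  refine (Finset.max'_lt_iff _ _).2 fun y hy => ?_
  rcases Finset.mem_insert.1 hy with rfl | hy
  · exact h0
  · obtain ⟨i, hi, rfl⟩ := Finset.mem_image.1 hy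
    exact h i hi

theorem maxOn_subset (h : A ⊆ B) : maxOn A f ≤ maxOn B f :=
  maxOn_le maxOn_nonneg fun _ hi => le_maxOn (h hi)

end MaxOn

/-- Heights of kept items give a path. -/
theorem Items.reach_of_heights {J : Items} {n : ℕ} {D : ℝ} (S : Finset ℕ) (V : ℕ → ℝ)
    (hlt : ∀ i ∈ S, i < n) (hD : 0 ≤ D) (h0 : ∀ i ∈ S, 0 ≤ V i)
    (h0s : ∀ i ∈ S, J.st i → 0 < V i) (hc : ∀ i ∈ S, ∃ k : ℤ, V i = J.f i + k)
    (hm : ∀ i ∈ S, ∀ s ∈ S, s < i → V s ≤ V i)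
    (hms : ∀ i ∈ S, J.st i → ∀ s ∈ S, s < i → V s < V i) (hp : ∀ i ∈ S, 0 ≤ J.p i)
    (hps : ∀ i ∈ S, ∀ s ∈ S, s < i → (s : ℤ) < J.p i) (hVD : ∀ i ∈ S, V i ≤ D) :
    J.Reach n S.card 0 D := by
  have key : ∀ i ∈ S, maxOn (S.filter (· < i + 1)) V = V i := fun i hi => by
    refine le_antisymm (maxOn_le (h0 i hi) fun s hs => ?_) (le_maxOn (by simp [hi]))
    obtain ⟨hs, hlt⟩ := Finset.mem_filter.1 hs
    rcases (Nat.lt_succ_iff.1 hlt).eq_or_lt with rfl | hlt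
    exacts [le_rfl, hm i hi s hs hlt]
  -- The path is the running maximum of the given heights, starting from 0.
  refine ⟨S, fun x => maxOn (S.filter (· < x)) V, ⟨hlt, fun i _ => maxOn_subset ?_, fun i hi => ?_,
    fun i hi hst => ?_, hp, hps⟩, rfl, ?_, maxOn_le hD fun i hi => hVD i (Finset.mem_filter.1 hi).1⟩
  · exact Finset.monotone_filter_right _ fun s _ h => Nat.lt_succ_of_lt h
  · simpa only [key i hi] using hc i hi
  · simp only [key i hi]
    exact maxOn_lt (h0s i hi hst) fun s hs =>
      hms i hi hst s (Finset.mem_filter.1 hs).1 (Finset.mem_filter.1 hs).2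
  · exact le_antisymm (maxOn_le le_rfl (by simp)) maxOn_nonneg

/-! ### Least heights -/

namespace Items

variable {J : Items} {n : ℕ}

open Classical in
/-- The least heights of a path that keeps the items in `S`. -/
noncomputable def greedy (J : Items) (S : Finset ℕ) : ℕ → ℝ
  | 0 => 0
  | i + 1 => if i ∈ S then J.lift i (greedy J S i) else greedy J S i

theorem greedy_succ_of_mem {S : Finset ℕ} {i : ℕ} (h : i ∈ S) :
    J.greedy S (i + 1) = J.lift i (J.greedy S i) := by simp [greedy, h]

theorem greedy_succ_of_notMem {S : Finset ℕ} {i : ℕ} (h : i ∉ S) :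
    J.greedy S (i + 1) = J.greedy S i := by simp [greedy, h]

theorem isPath_greedy {S : Finset ℕ} (hlt : ∀ i ∈ S, i < n) (hp : ∀ i ∈ S, 0 ≤ J.p i)
    (hps : ∀ i ∈ S, ∀ s ∈ S, s < i → (s : ℤ) < J.p i) : J.IsPath n S (J.greedy S) where
  lt := hlt
  mono i _ := by
    by_cases h : i ∈ S
    · rw [greedy_succ_of_mem h]; exact le_lift _ _
    · rw [greedy_succ_of_notMem h]
  congr i h := by rw [greedy_succ_of_mem h]; exact lift_congr _ _
  strict i h hst := by rw [greedy_succ_of_mem h]; exact lt_lift hst _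
  nonneg := hp
  compat := hps

/-- Lifting is monotone and minimal, so the greedy heights stay below every path with the same kept
items and start height 0. -/
theorem IsPath.greedy_le {S : Finset ℕ} {H : ℕ → ℝ} (hp : J.IsPath n S H) (h0 : H 0 = 0) {i : ℕ}
    (hi : i ≤ n) : J.greedy S i ≤ H i := by
  induction i with
  | zero => simp [greedy, h0]
  | succ i ih =>
    have ih := ih (by omega)
    have hm := hp.mono i hi
    by_cases h : i ∈ S
    · rw [greedy_succ_of_mem h]
      exact lift_le (ih.trans hm) (fun hs => ih.trans_lt (hp.strict i h hs)) (hp.congr i h)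
    · rw [greedy_succ_of_notMem h]; exact ih.trans hm

theorem greedy_le_nat (S : Finset ℕ) (i : ℕ) : J.greedy S i ≤ i := by
  induction i with
  | zero => simp [greedy]
  | succ i ih =>
    push_cast
    by_cases h : i ∈ S
    · rw [greedy_succ_of_mem h]; linarith [lift_lt (J := J) i (J.greedy S i)]
    · rw [greedy_succ_of_notMem h]; linarith

/-- The greedy height changes only at kept items: before `x` it is the height just after the last
kept item `t`, if there is one. -/
theorem greedy_eq (S : Finset ℕ) (x : ℕ) : (∀ s ∈ S, x ≤ s) ∨
    ∃ t ∈ S, t < x ∧ J.greedy S x = J.greedy S (t + 1) ∧ ∀ s ∈ S, s < x → s ≤ t := by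
  induction x with
  | zero => exact .inl fun _ _ => Nat.zero_le _
  | succ x ih =>
    by_cases h : x ∈ S
    · exact .inr ⟨x, h, by omega, rfl, fun s _ hs => by omega⟩
    · have hne : ∀ s ∈ S, s ≠ x := fun s hs e => h (e ▸ hs)
      rcases ih with ih | ⟨t, ht, htx, he, hmax⟩
      · exact .inl fun s hs => by have := ih s hs; have := hne s hs; omega
      · exact .inr ⟨t, ht, by omega, by rw [greedy_succ_of_notMem h, he], fun s hs hsx =>
          hmax s hs (by have := hne s hs; omega)⟩

theorem lift_lt_add_one {i : ℕ} (h : ¬ J.st i) (x : ℝ) : J.lift i x < x + 1 := by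
  rw [lift, if_neg h]
  linarith [Int.lt_floor_add_one (J.f i - x)]

end Items

/-! ### Counting unit intervals -/

/-- The unit intervals with left endpoints `z` are pairwise disjoint and lie in `[0, N)`. -/
def UnitPack {n : ℕ} (N : ℝ) (z : Fin n → ℝ) : Prop :=
  (∀ i j, i ≠ j → z i + 1 ≤ z j ∨ z j + 1 ≤ z i) ∧ ∀ i, 0 ≤ z i ∧ z i + 1 ≤ N

/-- The unit intervals with left endpoints `z` cover `[0, N)`. -/
def UnitCover {n : ℕ} (N : ℝ) (z : Fin n → ℝ) : Prop :=
  ∀ y, 0 ≤ y → y < N → ∃ i, z i ≤ y ∧ y < z i + 1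

/-- Induction on the rightmost interval: removing it leaves separated intervals in `[x, z a]`, one
unit shorter at least. -/
theorem card_le_of_separated {ι : Type*} [DecidableEq ι] (z : ι → ℝ) (A : Finset ι) {x y : ℝ}
    (hxy : x ≤ y) (hs : ∀ i ∈ A, ∀ j ∈ A, i ≠ j → z i + 1 ≤ z j ∨ z j + 1 ≤ z i)
    (hx : ∀ i ∈ A, x ≤ z i) (hy : ∀ i ∈ A, z i + 1 ≤ y) : (A.card : ℝ) ≤ y - x := by
  induction A using Finset.induction_on_max_value z generalizing y with
  | empty => simpa using hxy
  | insert a A ha hmax ih =>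
    rw [Finset.card_insert_of_notMem ha]
    have h1 := ih (y := z a) (hx a (Finset.mem_insert_self _ _))
      (fun i hi j hj => hs i (Finset.mem_insert_of_mem hi) j (Finset.mem_insert_of_mem hj))
      (fun i hi => hx i (Finset.mem_insert_of_mem hi)) (fun i hi => by
        have h2 := hmax i hi
        rcases hs i (Finset.mem_insert_of_mem hi) a (Finset.mem_insert_self _ _)
          (fun h => ha (h ▸ hi)) with h | h <;> linarith)
    have h2 := hy a (Finset.mem_insert_self _ _)
    push_cast
    linarith

/-- Subadditivity of Lebesgue measure. -/
theorem le_card_of_covered {ι : Type*} (z : ι → ℝ) (A : Finset ι) {x y : ℝ}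
    (h : ∀ t, x ≤ t → t < y → ∃ i ∈ A, z i ≤ t ∧ t < z i + 1) : y - x ≤ A.card := by
  have hsub : Set.Ico x y ⊆ ⋃ i ∈ A, Set.Ico (z i) (z i + 1) := fun t ht => by
    obtain ⟨i, hi, hz⟩ := h t ht.1 ht.2
    exact Set.mem_biUnion hi hz
  have h1 := (MeasureTheory.measure_mono (μ := MeasureTheory.volume) hsub).trans
    (MeasureTheory.measure_biUnion_finset_le A _)
  simp only [Real.volume_Ico, add_sub_cancel_left, ENNReal.ofReal_one, Finset.sum_const,
    nsmul_eq_mul, mul_one] at h1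
  rw [← ENNReal.ofReal_natCast] at h1
  exact (ENNReal.ofReal_le_ofReal_iff (by positivity)).1 h1

/-! ### Packing -/

section Pack

variable {n : ℕ} {N : ℝ} {b : ℕ → ℝ} {J : Items}

/-- The items describe the packing problem for the sorted positions `b`. -/
structure IsPackItems (J : Items) (n : ℕ) (N : ℝ) (b : ℕ → ℝ) : Prop where
  sorted : ∀ x y, x ≤ y → y < n → b x ≤ b y
  st : ∀ i, ¬ J.st i
  nonneg : ∀ i < n, 0 ≤ J.p i ↔ 0 ≤ b i ∧ b i + 1 ≤ N
  lt : ∀ i < n, 0 ≤ J.p i → ∀ s < i, (s : ℤ) < J.p i ↔ b s + 1 ≤ b i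

/-- The height of a kept interval is the free space to its left: its position minus the number of
intervals there. It is nonnegative, nondecreasing and at most `N - n`, because the intervals left
of, between and right of kept ones fit into the room available. -/
theorem IsPackItems.reach_of_pack (hJ : IsPackItems J n N b)
    (hf : ∀ i < n, 0 ≤ J.p i → ∃ k : ℤ, J.f i = b i + k) (hN : n ≤ N) (K : Finset (Fin n))
    (z : Fin n → ℝ) (hz : ∀ i ∈ K, z i = b i) (hg : UnitPack N z) :
    J.Reach n K.card 0 (N - n) := by
  obtain ⟨hsep, hbox⟩ := hg
  have hcard : (K.image Fin.val).card = K.card := Finset.card_image_of_injective _ Fin.val_injective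
  have hp : ∀ i ∈ K, 0 ≤ J.p i := fun i hi => (hJ.nonneg i i.2).2 (by rw [← hz i hi]; exact hbox i)
  have hlt : ∀ i ∈ K, ∀ s ∈ K, s < i → z s + 1 ≤ z i := fun i hi s hs hsi => by
    have h1 := hJ.sorted s i hsi.le i.2
    rw [← hz i hi, ← hz s hs] at h1
    rcases hsep s i hsi.ne with h | h <;> linarith
  set A : ℝ → Finset (Fin n) := fun x => Finset.univ.filter fun j => z j < x with hA
  have hmem : ∀ {x j}, j ∈ A x ↔ z j < x := fun {x j} => by simp [hA]
  have hbd : ∀ i ∈ K, ((A (b i)).card : ℝ) ≤ b i := fun i hi => by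
    have h := card_le_of_separated z (A (b i)) (x := 0) (y := b i)
      (by rw [← hz i hi]; exact (hbox i).1) (fun j _ k _ => hsep j k) (fun j _ => (hbox j).1)
      fun j hj => by
        have hj := hmem.1 hj
        rw [← hz i hi] at hj ⊢
        rcases hsep j i (fun h => by rw [h] at hj; exact lt_irrefl _ hj) with h | h <;> linarith
    linarith
  rw [← hcard]
  refine Items.reach_of_heights _ (fun i => b i - (A (b i)).card) ?_ (by linarith) ?_ ?_ ?_ ?_ ?_ ?_
    ?_ ?_
  all_goals simp only [Finset.forall_mem_image]
  · exact fun i _ => i.2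
  · exact fun i hi => by linarith [hbd i hi]
  · exact fun i _ h => absurd h (hJ.st i)
  · intro i hi
    obtain ⟨k, hk⟩ := hf i i.2 (hp i hi)
    exact ⟨-k - (A (b i)).card, by rw [hk]; push_cast; ring⟩
  · intro i hi s hs hsi
    have hsi := hlt i hi s hs hsi
    have hsub : A (b s) ⊆ A (b i) := fun j hj => hmem.2 ((hmem.1 hj).trans (by
      rw [← hz i hi, ← hz s hs]; linarith))
    have h := card_le_of_separated z (A (b i) \ A (b s)) (x := b s) (y := b i)
      (by rw [← hz i hi, ← hz s hs]; linarith) (fun j _ k _ => hsep j k)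
      (fun j hj => not_lt.1 fun h => (Finset.mem_sdiff.1 hj).2 (hmem.2 h))
      fun j hj => by
        have hj := hmem.1 (Finset.mem_sdiff.1 hj).1
        rw [← hz i hi] at hj ⊢
        rcases hsep j i (fun h => by rw [h] at hj; exact lt_irrefl _ hj) with h | h <;> linarith
    rw [Finset.cast_card_sdiff hsub] at h
    linarith
  · exact fun i _ h => absurd h (hJ.st i)
  · exact hp
  · intro i hi s hs hsi
    refine (hJ.lt i i.2 (hp i hi) s hsi).2 ?_
    rw [← hz i hi, ← hz s hs]
    exact hlt i hi s hs hsi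
  · intro i hi
    have h := card_le_of_separated z (A (b i))ᶜ (x := b i) (y := N)
      (by rw [← hz i hi]; linarith [hbox i]) (fun j _ k _ => hsep j k)
      (fun j hj => not_lt.1 fun h => (Finset.mem_compl.1 hj) (hmem.2 h)) fun j _ => (hbox j).2
    rw [Finset.card_compl, Nat.cast_sub (Finset.card_le_univ _), Fintype.card_fin] at h
    linarith

/-- Position minus height gives each kept interval an integer rank. An interval of rank `k` is
placed at `k + w k` with a nondecreasing `w` that agrees with the heights at the kept ranks, so
different ranks give disjoint intervals. -/
theorem IsPackItems.pack_of_reach (hJ : IsPackItems J n N b)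
    (hf : ∀ i < n, 0 ≤ J.p i → ∃ k : ℤ, J.f i = b i + k) {s : ℕ}
    (hr : J.Reach n s 0 (N - n)) :
    ∃ (K : Finset (Fin n)) (z : Fin n → ℝ), K.card = s ∧ (∀ i ∈ K, z i = b i) ∧ UnitPack N z := by
  obtain ⟨S, H₀, hp₀, hc, h0₀, hn₀⟩ := hr
  -- An arbitrary path may jump by 1 or more, and then two disjoint kept intervals could receive the
  -- same rank. Greedy steps without strictness are shorter than 1, which makes the ranks strictly
  -- increasing.
  have hp : J.IsPath n S (J.greedy S) := Items.isPath_greedy hp₀.lt hp₀.nonneg hp₀.compat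
  have hn := (hp₀.greedy_le h0₀ le_rfl).trans hn₀
  have h0 : J.greedy S 0 = 0 := rfl
  set H := J.greedy S with hH
  have hcong : ∀ i, ∃ c : ℤ, i ∈ S → b i = c + H (i + 1) := fun i => by
    by_cases hi : i ∈ S
    · obtain ⟨k, hk⟩ := hp.congr i hi
      obtain ⟨k', hk'⟩ := hf i (hp.lt i hi) (hp.nonneg i hi)
      exact ⟨-k - k', fun _ => by rw [hk, hk']; push_cast; ring⟩
    · exact ⟨0, fun h => absurd h hi⟩
  choose c hc' using hcong
  have hsep : ∀ i ∈ S, ∀ s ∈ S, s < i → b s + 1 ≤ b i := fun i hi s hs hsi =>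
    (hJ.lt i (hp.lt i hi) (hp.nonneg i hi) s hsi).1 (hp.compat i hi s hs hsi)
  have hw0 : ∀ i ∈ S, H (i + 1) ≤ N - n := fun i hi => (hp.le (hp.lt i hi) le_rfl).trans hn
  have hpos : ∀ i ∈ S, 0 ≤ H (i + 1) := fun i hi => h0 ▸ hp.le (Nat.zero_le _) (hp.lt i hi)
  have hD : 0 ≤ N - n := (h0 ▸ hp.le (Nat.zero_le n) le_rfl).trans hn
  have hclt : ∀ i, i ∈ S → ∀ s ∈ S, s < i → c s < c i := by
    intro i
    induction i using Nat.strong_induction_on with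
    | _ i ih =>
      intro hi s hs hsi
      rcases Items.greedy_eq (J := J) S i with h | ⟨t, ht, hti, he, hmax⟩
      · exact absurd (h s hs) (by omega)
      · have h1 := hsep i hi t ht hti
        have h2 : H (i + 1) < H i + 1 := by
          rw [hH, Items.greedy_succ_of_mem hi]
          exact Items.lift_lt_add_one (hJ.st i) _
        have he : H i = H (t + 1) := he
        rw [hc' i hi, hc' t ht] at h1
        have h3 : (c t : ℝ) < c i := by linarith
        have h4 : c t < c i := by exact_mod_cast h3
        rcases (hmax s hs hsi).eq_or_lt with rfl | hst
        exacts [h4, (ih t hti ht s hs hst).trans h4]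
  have hcle : ∀ i ∈ S, ∀ s ∈ S, c s ≤ c i → s ≤ i := fun i hi s hs h => by
    by_contra hlt
    exact absurd (hclt s hs i hi (by omega)) (by omega)
  set w : ℤ → ℝ := fun k => maxOn (S.filter (c · ≤ k)) fun i => H (i + 1) with hw
  have hwm : Monotone w := fun k l hkl =>
    maxOn_subset (Finset.monotone_filter_right _ fun _ _ h => h.trans hkl)
  have hwD : ∀ k, w k ≤ N - n := fun k =>
    maxOn_le hD fun i hi => hw0 i (Finset.mem_filter.1 hi).1
  have hwc : ∀ i ∈ S, w (c i) = H (i + 1) := fun i hi => by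
    refine le_antisymm (maxOn_le (hpos i hi) fun s hs => ?_)
      (le_maxOn (f := fun i => H (i + 1)) (Finset.mem_filter.2 ⟨hi, le_rfl⟩))
    obtain ⟨hs, hsc⟩ := Finset.mem_filter.1 hs
    have := hcle i hi s hs hsc
    exact hp.le (by omega) (hp.lt i hi)
  -- Kept ranks may be `n` or larger, because greedy heights are minimal. Kept ranks fit into the
  -- box by assumption, and the ranks `0, …, n - 1` because `w ≤ N - n`; any `n` ranks from this set
  -- that include the kept ones will do.
  set U : Finset ℤ := S.image c ∪ (Finset.range n).image (Nat.cast : ℕ → ℤ) with hU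
  have hUbox : ∀ k ∈ U, 0 ≤ k + w k ∧ k + w k + 1 ≤ N := by
    intro k hk
    rcases Finset.mem_union.1 hk with hk | hk
    · obtain ⟨i, hi, rfl⟩ := Finset.mem_image.1 hk
      rw [hwc i hi, ← hc' i hi]
      exact (hJ.nonneg i (hp.lt i hi)).1 (hp.nonneg i hi)
    · obtain ⟨i, hi, rfl⟩ := Finset.mem_image.1 hk
      have hi' : ((i + 1 : ℕ) : ℝ) ≤ n := by exact_mod_cast Finset.mem_range.1 hi
      push_cast at hi' ⊢
      exact ⟨add_nonneg (Nat.cast_nonneg i) maxOn_nonneg, by linarith [hwD i]⟩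
  have hUsep : ∀ k l : ℤ, k < l → k + w k + 1 ≤ l + w l := fun k l hkl => by
    have h1 : ((k + 1 : ℤ) : ℝ) ≤ l := by exact_mod_cast hkl
    push_cast at h1
    linarith [hwm hkl.le]
  set K : Finset (Fin n) := Finset.univ.filter fun i => (i : ℕ) ∈ S with hK
  have hKm : ∀ {i}, i ∈ K ↔ (i : ℕ) ∈ S := fun {i} => by simp [hK]
  have hKimg : K.image Fin.val = S := by
    ext x
    simp only [Finset.mem_image, hKm]
    exact ⟨fun ⟨i, hi, h⟩ => h ▸ hi, fun hx => ⟨⟨x, hp.lt x hx⟩, hx, rfl⟩⟩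
  have hKc : K.card = s := by
    rw [← hc, ← hKimg, Finset.card_image_of_injective _ Fin.val_injective]
  have hinj : Set.InjOn (fun i : Fin n => c i) K := by
    intro i hi j hj hij
    have hij : c i = c j := hij
    have hi := hKm.1 hi
    have hj := hKm.1 hj
    exact Fin.ext (le_antisymm (hcle j hj i hi hij.le) (hcle i hi j hj hij.ge))
  have hsubU : K.image (fun i : Fin n => c i) ⊆ U := by
    intro k hk
    obtain ⟨i, hi, rfl⟩ := Finset.mem_image.1 hk
    exact Finset.mem_union_left _ (Finset.mem_image_of_mem c (hKm.1 hi))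
  have hUn : n ≤ U.card := by
    refine le_trans (le_of_eq ?_) (Finset.card_le_card (Finset.subset_union_right (s₁ := S.image c)))
    rw [Finset.card_image_of_injective _ Nat.cast_injective, Finset.card_range]
  obtain ⟨T, hKT, hTU, hTn⟩ := Finset.exists_subsuperset_card_eq hsubU (n := n)
    (Finset.card_image_le.trans (by simpa using Finset.card_le_univ K)) hUn
  obtain ⟨g, hg⟩ := Finset.exists_equiv_extend_of_card_eq (by rw [hTn, Fintype.card_fin]) hKT hinj
  refine ⟨K, fun i => (g i : ℤ) + w (g i), hKc, fun i hi => ?_, fun i j hij => ?_, fun i =>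
    hUbox _ (hTU (g i).2)⟩
  · simp only [hg i hi]
    rw [hwc i (hKm.1 hi), ← hc' i (hKm.1 hi)]
  · have hne : (g i : ℤ) ≠ g j := fun h => hij (g.injective (Subtype.ext h))
    rcases lt_or_gt_of_ne hne with h | h
    exacts [.inl (hUsep _ _ h), .inr (hUsep _ _ h)]

/-- In a large box, only the distances between the kept intervals matter. -/
theorem IsPackItems.reach_iff_of_large (hJ : IsPackItems J n N b) (hN : 2 * n ≤ N) {s : ℕ}
    (J' : Items) (hp : J'.p = J.p) (hf : ∀ i, J.f i = 0) :
    J.Reach n s 0 0 ↔ J'.Reach n s 0 (N - n) := by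
  constructor
  · rintro ⟨S, H, hH, hc, -, -⟩
    -- Each kept item costs at most 1, so the greedy path ends at height at most `n ≤ N - n`,
    -- whatever the keys are.
    exact ⟨S, J'.greedy S, Items.isPath_greedy hH.lt (hp ▸ hH.nonneg) (hp ▸ hH.compat), hc, rfl,
      (Items.greedy_le_nat S n).trans (by linarith)⟩
  · rintro ⟨S, H, hH, hc, -, -⟩
    exact ⟨S, fun _ => 0, ⟨hH.lt, fun _ _ => le_rfl, fun i _ => ⟨0, by simp [hf]⟩,
      fun i _ h => absurd h (hJ.st i), hp ▸ hH.nonneg, hp ▸ hH.compat⟩, hc, rfl, le_rfl⟩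

end Pack

/-! ### Covering -/

section Cover

variable {n : ℕ} {N : ℝ} {b : ℕ → ℝ} {J : Items}

/-- The items describe the covering problem for the sorted positions `b` in `[-1, N)`. An item is
strict if its position is that of the item before it, where `-1` counts as the position before the
first item. -/
structure IsCoverItems (J : Items) (n : ℕ) (N : ℝ) (b : ℕ → ℝ) : Prop where
  sorted : ∀ x y, x ≤ y → y < n → b x ≤ b y
  mem : ∀ i < n, -1 ≤ b i ∧ b i < N
  st_zero : 0 < n → (J.st 0 ↔ b 0 = -1)
  st_succ : ∀ i, i + 1 < n → (J.st (i + 1) ↔ b (i + 1) = b i)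
  f : ∀ i < n, ∃ k : ℤ, J.f i = -b i + k
  p : ∀ i, J.p i = i

/-- The height of a kept interval is its rank minus its position. The intervals before it cover `[0,
b i)`, the others cover `[b i, N)`, and those ranked between two kept ones cover the gap between
their positions; counting gives the bounds and monotonicity. -/
theorem IsCoverItems.reach_of_cover (hJ : IsCoverItems J n N b) (hN : N ≤ n) (K : Finset (Fin n))
    (hK : ∀ k l : Fin n, k < l → b k = b l → l ∈ K → k ∈ K)
    (z : Fin n → ℝ) (hz : ∀ i ∈ K, z i = b i) (hg : UnitCover N z) :
    J.Reach n K.card 0 (n - N) := by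
  have hcard : (K.image Fin.val).card = K.card := Finset.card_image_of_injective _ Fin.val_injective
  -- Kept intervals at the same position are ranked by index, so that each of them adds to the rank
  -- of the next.
  set A : ℕ → Finset (Fin n) := fun i =>
    Finset.univ.filter fun j => z j < b i ∨ (j ∈ K ∧ (j : ℕ) < i ∧ b j = b i) with hA
  have hmem : ∀ {i j}, j ∈ A i ↔ z j < b i ∨ (j ∈ K ∧ (j : ℕ) < i ∧ b j = b i) :=
    fun {i j} => by simp [hA]
  set V : ℕ → ℝ := fun i => (A i).card - b i with hV
  have hV0 : ∀ i ∈ K, 0 ≤ V i := by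
    intro i hi
    have hb := hJ.mem i i.2
    by_cases h0 : b i ≤ 0
    · exact sub_nonneg.2 (h0.trans (Nat.cast_nonneg _))
    · have h := le_card_of_covered z (A i) (x := 0) (y := b i) fun t ht0 ht => by
        obtain ⟨j, hj, hj'⟩ := hg t ht0 (ht.trans hb.2)
        exact ⟨j, hmem.2 (.inl (hj.trans_lt ht)), hj, hj'⟩
      simp only [hV]
      linarith
  have heq : ∀ i ∈ K, ∀ s ∈ K, s < i → b s = b i → V s < V i := by
    intro i hi s hs hsi he
    have hlt : (A s).card < (A i).card := by
      refine Finset.card_lt_card ⟨fun j hj => ?_, fun hsub => ?_⟩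
      · rcases hmem.1 hj with h | ⟨h1, h2, h3⟩
        · exact hmem.2 (.inl (he ▸ h))
        · exact hmem.2 (.inr ⟨h1, h2.trans hsi, h3.trans he⟩)
      · rcases hmem.1 (hsub (hmem.2 (.inr ⟨hs, hsi, he⟩))) with h | h
        · rw [hz s hs] at h; exact lt_irrefl _ h
        · exact lt_irrefl _ h.2.1
    have hlt : ((A s).card : ℝ) < (A i).card := by exact_mod_cast hlt
    simp only [hV]
    linarith
  have hle : ∀ i ∈ K, ∀ s ∈ K, s < i → V s ≤ V i := by
    intro i hi s hs hsi
    rcases (hJ.sorted s i hsi.le i.2).eq_or_lt with he | hlt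
    · exact (heq i hi s hs hsi he).le
    have hsub : A s ⊆ A i := by
      intro j hj
      rcases hmem.1 hj with h | ⟨h1, h2, h3⟩
      · exact hmem.2 (.inl (h.trans hlt))
      · exact hmem.2 (.inl (by rw [hz j h1, h3]; exact hlt))
    have h := le_card_of_covered z (A i \ A s) (x := b s) (y := b i) fun t hts hti => by
      by_cases ht : t < b s + 1
      · refine ⟨s, Finset.mem_sdiff.2 ⟨hmem.2 (.inl (by rw [hz s hs]; exact hlt)), fun h => ?_⟩,
          by rw [hz s hs]; exact hts, by rw [hz s hs]; exact ht⟩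
        rcases hmem.1 h with h | h
        · rw [hz s hs] at h; exact lt_irrefl _ h
        · exact lt_irrefl _ h.2.1
      · have hs1 := (hJ.mem s s.2).1
        obtain ⟨j, hj, hj'⟩ := hg t (by linarith) (hti.trans (hJ.mem i i.2).2)
        refine ⟨j, Finset.mem_sdiff.2 ⟨hmem.2 (.inl (hj.trans_lt hti)), fun h => ?_⟩, hj, hj'⟩
        rcases hmem.1 h with h | ⟨h1, h2, h3⟩
        · linarith
        · rw [hz j h1] at hj'; linarith
    rw [Finset.cast_card_sdiff hsub] at h
    simp only [hV]
    linarith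
  -- The flag refers to the preceding item, kept or not. By `hK` kept items come first among equal
  -- positions, so that the preceding item is itself kept.
  have hst : ∀ i ∈ K, J.st i → 0 < V i ∧ ∀ s ∈ K, s < i → V s < V i := by
    intro i hi hs
    rcases Nat.eq_zero_or_pos (i : ℕ) with h0 | h0
    · rw [h0] at hs
      have hb := (hJ.st_zero (by have := i.2; omega)).1 hs
      refine ⟨?_, fun s _ hsi => absurd hsi (by have := Fin.lt_def.1 hsi; omega)⟩
      simp only [hV, h0, hb]
      have : (0 : ℝ) ≤ (A 0).card := Nat.cast_nonneg _
      linarith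
    · obtain ⟨j, hj⟩ : ∃ j, (i : ℕ) = j + 1 := ⟨i - 1, by omega⟩
      have hjn : j < n := by have := i.2; omega
      rw [hj] at hs
      have hb := (hJ.st_succ j (by have := i.2; omega)).1 hs
      have hji : (⟨j, hjn⟩ : Fin n) < i := by rw [Fin.lt_def, hj]; exact Nat.lt_succ_self j
      have hbj : b (⟨j, hjn⟩ : Fin n) = b i := by rw [hj]; exact hb.symm
      have hjK := hK _ i hji hbj hi
      have h1 := heq i hi _ hjK hji hbj
      refine ⟨(hV0 _ hjK).trans_lt h1, fun s hs hsi => ?_⟩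
      rcases eq_or_ne s ⟨j, hjn⟩ with rfl | hne
      · exact h1
      · refine (hle _ hjK s hs ?_).trans_lt h1
        have h2 := Fin.lt_def.1 hsi
        have h3 : (s : ℕ) ≠ j := fun h => hne (Fin.ext h)
        rw [Fin.lt_def]
        show (s : ℕ) < j
        omega
  rw [← hcard]
  refine Items.reach_of_heights _ V ?_ (by linarith) ?_ ?_ ?_ ?_ ?_ ?_ ?_ ?_
  all_goals simp only [Finset.forall_mem_image]
  · exact fun i _ => i.2
  · exact hV0
  · exact fun i hi h => (hst i hi h).1
  · intro i hi
    obtain ⟨k, hk⟩ := hJ.f i i.2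
    exact ⟨(A i).card - k, by rw [hk]; push_cast; simp only [hV]; ring⟩
  · exact fun i hi s hs h => hle i hi s hs h
  · exact fun i hi hi' s hs h => (hst i hi hi').2 s hs h
  · exact fun i _ => by rw [hJ.p]; omega
  · exact fun i _ s _ h => by rw [hJ.p]; omega
  · intro i hi
    have hb := hJ.mem i i.2
    have h := le_card_of_covered z (A i)ᶜ (x := b i) (y := N) fun t hti htN => by
      by_cases ht : t < b i + 1
      · refine ⟨i, Finset.mem_compl.2 fun h => ?_,
          by rw [hz i hi]; exact hti, by rw [hz i hi]; exact ht⟩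
        rcases hmem.1 h with h | h
        · rw [hz i hi] at h; exact lt_irrefl _ h
        · exact lt_irrefl _ h.2.1
      · obtain ⟨j, hj, hj'⟩ := hg t (by linarith) htN
        refine ⟨j, Finset.mem_compl.2 fun h => ?_, hj, hj'⟩
        rcases hmem.1 h with h | ⟨h1, h2, h3⟩
        · linarith
        · rw [hz j h1] at hj'; linarith
    rw [Finset.card_compl, Nat.cast_sub (Finset.card_le_univ _), Fintype.card_fin] at h
    simp only [hV]
    linarith

/-- Position plus height is an integer rank, increasing along kept items. An interval of rank `k` is
placed at `k - w k` with nondecreasing `w`, so consecutive ranks leave no gap. -/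
theorem IsCoverItems.cover_of_reach (hJ : IsCoverItems J n N b) {s : ℕ}
    (hr : J.Reach n s 0 (n - N)) :
    ∃ (K : Finset (Fin n)) (z : Fin n → ℝ), K.card = s ∧ (∀ i ∈ K, z i = b i) ∧ UnitCover N z := by
  obtain ⟨S, H, hp, hc, h0, hn⟩ := hr
  have hpos : ∀ i ≤ n, 0 ≤ H i := fun i hi => h0 ▸ hp.le (Nat.zero_le _) hi
  have hD : 0 ≤ n - N := (hpos n le_rfl).trans hn
  have hw0 : ∀ i ∈ S, H (i + 1) ≤ n - N := fun i hi => (hp.le (hp.lt i hi) le_rfl).trans hn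
  have hcong : ∀ i, ∃ c : ℕ, i ∈ S → b i = c - H (i + 1) ∧ c < n := fun i => by
    by_cases hi : i ∈ S
    · have hin := hp.lt i hi
      obtain ⟨k, hk⟩ := hp.congr i hi
      obtain ⟨k', hk'⟩ := hJ.f i hin
      have hb := hJ.mem i hin
      have he : H (i + 1) + b i = ((k + k' : ℤ) : ℝ) := by rw [hk, hk']; push_cast; ring
      -- Ranks must not be negative. At position `-1` the height has to be positive, and strictness
      -- forces this: sortedness makes every item at `-1` strict.
      have hgt : (-1 : ℝ) < ((k + k' : ℤ) : ℝ) := by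
        rw [← he]
        rcases hb.1.eq_or_lt with h | h
        · have hst : J.st i := by
            rcases i with - | i
            · exact (hJ.st_zero (by omega)).2 h.symm
            · refine (hJ.st_succ i hin).2 ?_
              linarith [(hJ.mem i (by omega)).1, hJ.sorted i (i + 1) (by omega) hin]
          linarith [hp.strict i hi hst, hpos i hin.le]
        · linarith [hpos (i + 1) hin]
      have hge : 0 ≤ k + k' := by
        have : (-1 : ℤ) < k + k' := by exact_mod_cast hgt
        omega
      obtain ⟨c, hc⟩ := Int.eq_ofNat_of_zero_le hge
      rw [hc] at he
      refine ⟨c, fun _ => ⟨by push_cast at he; linarith, ?_⟩⟩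
      have : (c : ℝ) < n := by push_cast at he; linarith [hw0 i hi]
      exact_mod_cast this
    · exact ⟨0, fun h => absurd h hi⟩
  choose c hc' using hcong
  have hclt : ∀ i ∈ S, ∀ s ∈ S, s < i → c s < c i := by
    intro i hi s hs hsi
    have hin := hp.lt i hi
    have h1 : H (s + 1) ≤ H i := hp.le hsi hin.le
    have h2 := hp.mono i hin
    have hlt : (c s : ℝ) < c i := by
      rcases (hJ.sorted s i hsi.le hin).eq_or_lt with h | h
      · obtain ⟨j, rfl⟩ : ∃ j, i = j + 1 := ⟨i - 1, by omega⟩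
        have h3 := hp.strict _ hi ((hJ.st_succ j hin).2 (by
          linarith [hJ.sorted s j (by omega) (by omega), hJ.sorted j (j + 1) (by omega) hin]))
        linarith [(hc' _ hi).1, (hc' s hs).1]
      · linarith [(hc' i hi).1, (hc' s hs).1]
    exact_mod_cast hlt
  have hcle : ∀ i ∈ S, ∀ s ∈ S, c s ≤ c i → s ≤ i := fun i hi s hs h => by
    by_contra hlt
    exact absurd (hclt s hs i hi (by omega)) (by omega)
  set w : ℕ → ℝ := fun k => maxOn (S.filter (c · ≤ k)) fun i => H (i + 1) with hw
  have hwm : Monotone w := fun k l hkl =>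
    maxOn_subset (Finset.monotone_filter_right _ fun _ _ h => h.trans hkl)
  have hwD : ∀ k, w k ≤ n - N := fun k =>
    maxOn_le hD fun i hi => hw0 i (Finset.mem_filter.1 hi).1
  have hwc : ∀ i ∈ S, w (c i) = H (i + 1) := fun i hi => by
    refine le_antisymm (maxOn_le (hpos _ (hp.lt i hi)) fun s hs => ?_)
      (le_maxOn (f := fun i => H (i + 1)) (Finset.mem_filter.2 ⟨hi, le_rfl⟩))
    obtain ⟨hs, hsc⟩ := Finset.mem_filter.1 hs
    have := hcle i hi s hs hsc
    exact hp.le (by omega) (hp.lt i hi)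
  set K : Finset (Fin n) := Finset.univ.filter fun i => (i : ℕ) ∈ S with hK
  have hKm : ∀ {i}, i ∈ K ↔ (i : ℕ) ∈ S := fun {i} => by simp [hK]
  have hKimg : K.image Fin.val = S := by
    ext x
    simp only [Finset.mem_image, hKm]
    exact ⟨fun ⟨i, hi, h⟩ => h ▸ hi, fun hx => ⟨⟨x, hp.lt x hx⟩, hx, rfl⟩⟩
  have hKc : K.card = s := by
    rw [← hc, ← hKimg, Finset.card_image_of_injective _ Fin.val_injective]
  have hinj : Set.InjOn (fun i : Fin n => c i) K := by
    intro i hi j hj hij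
    have hij : c i = c j := hij
    have hi := hKm.1 hi
    have hj := hKm.1 hj
    exact Fin.ext (le_antisymm (hcle j hj i hi hij.le) (hcle i hi j hj hij.ge))
  have hsub : K.image (fun i : Fin n => c i) ⊆ Finset.range n := by
    intro k hk
    obtain ⟨i, hi, rfl⟩ := Finset.mem_image.1 hk
    exact Finset.mem_range.2 (hc' i (hKm.1 hi)).2
  obtain ⟨g, hg⟩ := Finset.exists_equiv_extend_of_card_eq (by simp) hsub hinj
  refine ⟨K, fun i => (g i : ℕ) - w (g i), hKc, fun i hi => ?_, fun y hy0 hyN => ?_⟩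
  · simp only [hg i hi]
    rw [hwc i (hKm.1 hi), ← (hc' i (hKm.1 hi)).1]
  · have hn0 : 0 < n := by
      have : (0 : ℝ) < n := by linarith
      exact_mod_cast this
    set P : ℕ → Prop := fun k => (k : ℝ) - w k ≤ y
    classical
    have hP0 : P 0 := by
      have : (0 : ℝ) ≤ w 0 := maxOn_nonneg
      show ((0 : ℕ) : ℝ) - w 0 ≤ y
      push_cast
      linarith
    -- The last rank that starts at or before `y` contains `y`: either the next one starts after
    -- `y`, or this is rank `n - 1`, which reaches to `N` because `w ≤ n - N`.
    set k := Nat.findGreatest P (n - 1) with hk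
    have hPk : P k := Nat.findGreatest_spec (Nat.zero_le _) hP0
    have hkn : k ≤ n - 1 := Nat.findGreatest_le _
    have hlt : y < k - w k + 1 := by
      rcases hkn.eq_or_lt with h | h
      · have h2 : (k : ℝ) + 1 = n := by exact_mod_cast (by omega : k + 1 = n)
        linarith [hwD k]
      · have h2 : ¬ P (k + 1) := Nat.findGreatest_is_greatest (Nat.lt_succ_self k) h
        have h3 : y < ((k + 1 : ℕ) : ℝ) - w (k + 1) := not_le.1 h2
        push_cast at h3
        linarith [hwm (Nat.le_succ k)]
    refine ⟨g.symm ⟨k, Finset.mem_range.2 (by omega)⟩, ?_⟩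
    simp only [Equiv.apply_symm_apply]
    exact ⟨hPk, hlt⟩

end Cover

/-! ### Reduction to sorted and clamped positions -/

theorem values_eq_map (g : ℕ → ℝ) (n : ℕ) :
    values g n = (Finset.univ : Finset (Fin n)).val.map fun i : Fin n => g i := by
  rw [Fin.univ_val_map]
  induction n with
  | zero => simp [values]
  | succ n ih =>
    rw [values_succ, ih, List.ofFn_succ', List.concat_eq_append, ← Multiset.coe_add, add_comm]
    simp

/-- A sorting permutation that puts the members of `K` first among equal values. -/
theorem exists_sorting {n : ℕ} (a : Fin n → ℝ) (b : ℕ → ℝ)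
    (hb : ∀ x y, x ≤ y → y < n → b x ≤ b y) (hv : values b n = Finset.univ.val.map a)
    (K : Finset (Fin n)) : ∃ e : Equiv.Perm (Fin n), (∀ k : Fin n, b k = a (e k)) ∧
      ∀ k l : Fin n, k < l → b k = b l → e l ∈ K → e k ∈ K := by
  -- Ties are broken by `false < true`, which puts the members of `K` first.
  set key : Fin n → ℝ ×ₗ Bool := fun i => toLex (a i, decide (i ∉ K)) with hkey
  set e := Tuple.sort key
  have hm : Monotone (key ∘ e) := Tuple.monotone_sort key
  have hma : Monotone (a ∘ e) := fun i j hij => by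
    rcases Prod.Lex.toLex_le_toLex.1 (hm hij) with h | h
    exacts [h.le, h.1.le]
  have heq : (fun k : Fin n => b k) = a ∘ e := by
    refine List.ofFn_injective ?_
    have hbm : Monotone fun k : Fin n => b k := fun i j hij => hb i j hij j.2
    refine (List.Perm.trans ?_ (e.ofFn_comp_perm a).symm).eq_of_pairwise'
      hbm.sortedLE_ofFn.pairwise hma.sortedLE_ofFn.pairwise
    rw [values_eq_map, Fin.univ_val_map, Fin.univ_val_map] at hv
    exact Multiset.coe_eq_coe.1 hv
  refine ⟨e, fun k => congrFun heq k, fun k l hkl hbe hl => ?_⟩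
  have h1 : a (e k) = a (e l) := by
    rw [← Function.comp_apply (f := a), ← Function.comp_apply (f := a), ← heq]; exact hbe
  rcases Prod.Lex.toLex_le_toLex.1 (hm hkl.le) with h | h
  · exact absurd h1 h.ne
  · by_contra hk
    have h2 : decide (e k ∉ K) ≤ decide (e l ∉ K) := h.2
    simp only [hk, hl, not_true_eq_false, not_false_eq_true, decide_true, decide_false] at h2
    exact absurd h2 (by decide)

/-- Some `s` unit intervals can keep the positions `a` in a good configuration. -/
def Keeps {n : ℕ} (a : Fin n → ℝ) (Good : (Fin n → ℝ) → Prop) (s : ℕ) : Prop :=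
  ∃ (K : Finset (Fin n)) (z : Fin n → ℝ), K.card = s ∧ (∀ i ∈ K, z i = a i) ∧ Good z

theorem Keeps.congr {n : ℕ} {a b : Fin n → ℝ} {Good : (Fin n → ℝ) → Prop} {s : ℕ}
    (e : Equiv.Perm (Fin n)) (h : ∀ k, b k = a (e k)) (hG : ∀ z, Good z → Good (z ∘ e.symm))
    (hk : Keeps b Good s) : Keeps a Good s := by
  obtain ⟨K, z, hc, hz, hg⟩ := hk
  refine ⟨K.map e.toEmbedding, z ∘ e.symm, by rw [Finset.card_map, hc], fun i hi => ?_, hG z hg⟩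
  obtain ⟨j, hj, rfl⟩ := Finset.mem_map.1 hi
  simp [hz j hj, h j]

theorem UnitPack.comp {n : ℕ} {N : ℝ} {z : Fin n → ℝ} (h : UnitPack N z) (e : Equiv.Perm (Fin n)) :
    UnitPack N (z ∘ e) :=
  ⟨fun _ _ hij => h.1 _ _ fun h' => hij (e.injective h'), fun _ => h.2 _⟩

theorem UnitCover.comp {n : ℕ} {N : ℝ} {z : Fin n → ℝ} (h : UnitCover N z)
    (e : Equiv.Perm (Fin n)) : UnitCover N (z ∘ e) := fun y hy hy' => by
  obtain ⟨i, hi⟩ := h y hy hy'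
  exact ⟨e.symm i, by simpa using hi⟩

theorem IsPackItems.keeps_iff {n : ℕ} {N : ℝ} {b : ℕ → ℝ} {J : Items} (hJ : IsPackItems J n N b)
    (hf : ∀ i < n, 0 ≤ J.p i → ∃ k : ℤ, J.f i = b i + k) (hN : n ≤ N) {a : Fin n → ℝ}
    (hv : values b n = Finset.univ.val.map a) (s : ℕ) :
    Keeps a (UnitPack N) s ↔ J.Reach n s 0 (N - n) := by
  constructor
  · rintro ⟨K, z, rfl, hz, hg⟩
    obtain ⟨e, he, -⟩ := exists_sorting a b hJ.sorted hv K
    have := hJ.reach_of_pack hf hN (K.map e.symm.toEmbedding) (z ∘ e) (fun i hi => by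
      obtain ⟨j, hj, rfl⟩ := Finset.mem_map.1 hi
      simp [hz j hj, he]) (hg.comp e)
    rwa [Finset.card_map] at this
  · intro hr
    obtain ⟨e, he, -⟩ := exists_sorting a b hJ.sorted hv ∅
    exact Keeps.congr e he (fun z hz => hz.comp _) (hJ.pack_of_reach hf hr)

/-- A position outside the box is moved just before it. -/
noncomputable def clamp (N x : ℝ) : ℝ := if -1 < x ∧ x < N then x else -1

theorem clamp_mem {N : ℝ} (hN : 0 < N) (x : ℝ) : -1 ≤ clamp N x ∧ clamp N x < N := by
  unfold clamp
  split_ifs with h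
  · exact ⟨h.1.le, h.2⟩
  · exact ⟨le_rfl, by linarith⟩

theorem clamp_eq {N x y : ℝ} (h0 : 0 ≤ y) (hN : y < N) :
    (clamp N x ≤ y ∧ y < clamp N x + 1) ↔ (x ≤ y ∧ y < x + 1) := by
  unfold clamp
  split_ifs with h
  · rfl
  · constructor
    · rintro ⟨-, h2⟩; linarith
    · rintro ⟨h1, h2⟩; exact absurd ⟨by linarith, by linarith⟩ h

theorem unitCover_clamp {n : ℕ} {N : ℝ} {z : Fin n → ℝ} :
    UnitCover N (fun i => clamp N (z i)) ↔ UnitCover N z :=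
  forall_congr' fun _ => forall_congr' fun h0 => forall_congr' fun hN =>
    exists_congr fun _ => clamp_eq h0 hN

/-- An interval that misses the box does not help to cover it wherever it is. Moving all of these to
`-1` bounds the positions without affecting which sets can be kept. -/
theorem keeps_clamp {n : ℕ} {N : ℝ} {a : Fin n → ℝ} {s : ℕ} :
    Keeps (fun i => clamp N (a i)) (UnitCover N) s ↔ Keeps a (UnitCover N) s := by
  classical
  constructor
  · rintro ⟨K, z, hc, hz, hg⟩
    refine ⟨K, fun i => if i ∈ K then a i else z i, hc, fun i hi => by simp [hi], ?_⟩
    rw [← unitCover_clamp] at hg ⊢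
    convert hg using 2 with i
    by_cases hi : i ∈ K
    · simp only [hi, if_true, hz i hi]
      unfold clamp
      split_ifs <;> rfl
    · simp [hi]
  · rintro ⟨K, z, hc, hz, hg⟩
    exact ⟨K, fun i => clamp N (z i), hc, fun i hi => by simp only [hz i hi], unitCover_clamp.2 hg⟩

theorem IsCoverItems.keeps_iff {n : ℕ} {N : ℝ} {b : ℕ → ℝ} {J : Items} (hJ : IsCoverItems J n N b)
    (hN : N ≤ n) {a : Fin n → ℝ}
    (hv : values b n = Finset.univ.val.map fun i => clamp N (a i)) (s : ℕ) :
    Keeps a (UnitCover N) s ↔ J.Reach n s 0 (n - N) := by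
  rw [← keeps_clamp]
  constructor
  · rintro ⟨K, z, rfl, hz, hg⟩
    obtain ⟨e, he, hpre⟩ := exists_sorting _ b hJ.sorted hv K
    have := hJ.reach_of_cover hN (K.map e.symm.toEmbedding) (fun k l hkl hb hl => by
        simpa using hpre k l hkl hb (by simpa using hl)) (z ∘ e) (fun i hi => by
      obtain ⟨j, hj, rfl⟩ := Finset.mem_map.1 hi
      simp [hz j hj, he]) (hg.comp e)
    rwa [Finset.card_map] at this
  · intro hr
    obtain ⟨e, he, -⟩ := exists_sorting _ b hJ.sorted hv ∅
    exact Keeps.congr e he (fun z hz => hz.comp _) (hJ.cover_of_reach hr)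

/-! ### Families with one length -/

namespace Family

variable {n : ℕ} {I : Family n}

theorem exists_len (h : I.kappa = 1) : 0 < n ∧ ∃ L, 0 < L ∧ ∀ i, I.len i = L := by
  obtain ⟨L, hL⟩ := Finset.card_eq_one.1 h
  have hlen : ∀ i, I.len i = L := fun i => by
    have : I.len i ∈ Finset.univ.image I.len := Finset.mem_image_of_mem _ (Finset.mem_univ i)
    rwa [hL, Finset.mem_singleton] at this
  have hmem : L ∈ Finset.univ.image I.len := by rw [hL]; simp
  obtain ⟨i, -, -⟩ := Finset.mem_image.1 hmem
  exact ⟨i.pos, L, by rw [← hlen i]; exact sub_pos.2 (I.left_lt_right i), hlen⟩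

variable {L : ℝ}

theorem totalLen_eq (hlen : ∀ i, I.len i = L) : I.totalLen = n * L := by
  simp [totalLen, hlen]

/-- The position relative to the box in units of `L`. -/
noncomputable def rel (I : Family n) (L : ℝ) (x : ℝ) : ℝ := (x - I.boxLeft) / L

theorem rel_le (hL : 0 < L) {x y : ℝ} : I.rel L x ≤ I.rel L y ↔ x ≤ y := by
  unfold rel; rw [div_le_div_iff_of_pos_right hL, sub_le_sub_iff_right]

theorem rel_lt (hL : 0 < L) {x y : ℝ} : I.rel L x < I.rel L y ↔ x < y := by
  rw [← not_le, rel_le hL, not_le]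

theorem rel_boxLeft : I.rel L I.boxLeft = 0 := by simp [rel]

theorem rel_boxRight : I.rel L I.boxRight = I.boxLen / L := rfl

theorem rel_add_one (hL : 0 < L) (x : ℝ) : I.rel L x + 1 = I.rel L (x + L) := by
  unfold rel; field_simp; ring

theorem rel_surj (hL : 0 < L) (y : ℝ) : ∃ x, I.rel L x = y :=
  ⟨y * L + I.boxLeft, by unfold rel; field_simp; ring⟩

theorem isPacked_iff (hL : 0 < L) (hlen : ∀ i, I.len i = L) (z : Fin n → ℝ) :
    I.IsPacked z ↔ UnitPack (I.boxLen / L) fun i => I.rel L (z i) := by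
  unfold IsPacked UnitPack
  refine and_congr (forall_congr' fun i => forall_congr' fun j => forall_congr' fun _ => ?_)
    (forall_congr' fun i => ?_)
  · rw [placed, placed, Set.Ico_disjoint_Ico, hlen, hlen, rel_add_one hL, rel_add_one hL, rel_le hL,
      rel_le hL, min_le_iff, le_max_iff, le_max_iff]
    constructor
    · rintro ((h | h) | (h | h)) <;> first | (left; linarith) | (right; linarith)
    · rintro (h | h)
      exacts [.inl (.inr h), .inr (.inl h)]
  · rw [placed, box, hlen, Set.Ico_subset_Ico_iff (by linarith), ← rel_boxRight, ← rel_boxLeft (I := I)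
      (L := L), rel_add_one hL, rel_le hL, rel_le hL]

theorem isCovered_iff (hL : 0 < L) (hlen : ∀ i, I.len i = L) (z : Fin n → ℝ) :
    I.IsCovered z ↔ UnitCover (I.boxLen / L) fun i => I.rel L (z i) := by
  unfold IsCovered UnitCover
  constructor
  · intro h y hy hy'
    obtain ⟨x, rfl⟩ := rel_surj (I := I) hL y
    rw [← rel_boxLeft (I := I) (L := L), rel_le hL] at hy
    rw [← rel_boxRight, rel_lt hL] at hy'
    obtain ⟨i, hi⟩ := Set.mem_iUnion.1 (h ⟨hy, hy'⟩)
    rw [placed, hlen] at hi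
    exact ⟨i, (rel_le hL).2 hi.1, by rw [rel_add_one hL, rel_lt hL]; exact hi.2⟩
  · rintro h x ⟨hx, hx'⟩
    obtain ⟨i, hi, hi'⟩ := h (I.rel L x) (by rwa [← rel_boxLeft (I := I) (L := L), rel_le hL])
      (by rwa [← rel_boxRight, rel_lt hL])
    rw [rel_add_one hL, rel_lt hL] at hi'
    exact Set.mem_iUnion.2 ⟨i, by rw [placed, hlen]; exact ⟨(rel_le hL).1 hi, hi'⟩⟩

/-- Scaling is a bijection of positions, and the kept set is the complement of the moved one. -/
theorem achievable_iff (hL : 0 < L) {Good Good' : (Fin n → ℝ) → Prop}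
    (hG : ∀ z, Good z ↔ Good' fun i => I.rel L (z i)) (s : ℕ) :
    (∃ t, I.Achievable Good t s) ↔ Keeps (fun i => I.rel L (I.left i)) Good' s := by
  constructor
  · rintro ⟨t, M, -, hs, z, hz, hg⟩
    exact ⟨Mᶜ, _, hs, fun i hi => by rw [hz i (Finset.mem_compl.1 hi)], (hG z).1 hg⟩
  · rintro ⟨K, z, hs, hz, hg⟩
    choose z' hz' using fun i => rel_surj (I := I) hL (z i)
    refine ⟨_, Kᶜ, rfl, by rw [compl_compl, hs], z', fun i hi => ?_, (hG z').2 (by simpa [hz'])⟩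
    have := hz i (by simpa using hi)
    rw [← hz' i] at this
    exact le_antisymm ((rel_le hL).1 this.le) ((rel_le hL).1 this.ge)

/-- Moved and kept intervals always add up to `n`, so one configuration is optimal for both. -/
theorem isOptimal_of_isGreatest {Good : (Fin n → ℝ) → Prop} {R : ℕ → Prop} {σ : ℕ}
    (h : ∀ s, (∃ t, I.Achievable Good t s) ↔ R s) (hσ : IsGreatest {s | R s} σ) :
    IsOptimal (I.Achievable Good) (n - σ) σ ∧ σ ≤ n := by
  have hsum : ∀ {t s}, I.Achievable Good t s → t + s = n := by
    rintro t s ⟨M, rfl, rfl, -⟩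
    rw [Finset.card_add_card_compl, Fintype.card_fin]
  obtain ⟨t, ht⟩ := (h σ).2 hσ.1
  have ht' := hsum ht
  obtain rfl : t = n - σ := by omega
  refine ⟨⟨⟨⟨σ, ht⟩, ?_⟩, ⟨⟨_, ht⟩, ?_⟩⟩, by omega⟩
  · rintro t ⟨s, hs⟩
    have := hσ.2 ((h s).1 ⟨t, hs⟩)
    have := hsum hs
    omega
  · rintro s ⟨t, hs⟩
    exact hσ.2 ((h s).1 ⟨t, hs⟩)

end Family

/-! ### Counted loops -/

open IExpr in
/-- Run `body` with word variable `2` from `0` to `n - 1`. -/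
def forLoop (body : Prog) : Prog :=
  .seq (.isetVar 2 (lit 0))
    (.loop (.ilt (var 2) (var 0)) (.seq body (.isetVar 2 (add (var 2) (lit 1)))))

/-- The invariant is asserted after the counter has been updated, so it may also speak about word
variable `2`. -/
theorem forLoop_spec {W n T : ℕ} {body : Prog} {m : Memory} (Inv : ℕ → Memory → Prop)
    (h0 : 0 ∉ body.iv) (h2 : 2 ∉ body.iv) (hW : n + 2 ≤ W) (hn : m.ivar 0 = n)
    (hI : Inv 0 (m.setIVar 2 0))
    (hbody : ∀ i < n, ∀ m : Memory, m.ivar 0 = n → m.ivar 2 = i → Inv i m →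
      Ends W body m T fun m' => Inv (i + 1) (m'.setIVar 2 (i + 1))) :
    Ends W (forLoop body) m ((T + 20) * n + 20) (Inv n) := by
  refine Ends.mono (Ends.seq (Q := fun m' => m'.ivar 0 = n ∧ m'.ivar 2 = 0 ∧ Inv 0 m')
    (Ends.of_wp ?_) fun m' hm' =>
    Ends.loop (T := T + 4) (fun k m' => ∃ i : ℕ, i + k = n ∧ m'.ivar 0 = n ∧ m'.ivar 2 = i ∧
      Inv i m') ?_ n m' ⟨0, by omega, hm'⟩) (T := _) ?_ fun m' hm' => hm'
  · simp only [Prog.wp, IExpr.Ok, IExpr.val, abs_le]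
    exact ⟨by omega, by simp [hn], by simp, hI⟩
  · rintro k m₁ ⟨i, hk, hn, hi, hI⟩
    simp only [BExpr.Ok, BExpr.Holds, IExpr.Ok, IExpr.val, hn, hi, abs_le]
    refine ⟨by omega, fun hlt => ⟨k - 1, by omega, ?_⟩, fun hlt => ?_⟩
    · refine Ends.seq (hbody i (by omega) m₁ hn hi hI).frame fun m₂ hm₂ => Ends.of_wp ?_
      have hi' : m₂.ivar 2 = i := by rw [hm₂.2.ivar 2 h2, hi]
      have hn' : m₂.ivar 0 = n := by rw [hm₂.2.ivar 0 h0, hn]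
      simp only [Prog.wp, IExpr.Ok, IExpr.val, hi', abs_le]
      exact ⟨by omega, i + 1, by omega, by simp [hn'], by simp, hm₂.1⟩
    · obtain rfl : i = n := by omega
      exact hI
  · simp only [Prog.steps, BExpr.cost, IExpr.cost]
    nlinarith

/-! ### The table of least heights -/

/-- The arrays of the memory hold the keys, strictness flags and predecessor bounds of the items. -/
structure HoldsItems (J : Items) (n : ℕ) (m : Memory) : Prop where
  f : ∀ i < n, m.rarr 4 i = J.f i
  st : ∀ i < n, m.iarr 0 i = 0 ∧ ¬ J.st i ∨ m.iarr 0 i = 1 ∧ J.st i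
  p : ∀ i < n, m.iarr 1 i = J.p i
  f_mem : ∀ i < n, 0 ≤ J.f i ∧ J.f i < 1
  p_mem : ∀ i < n, -1 ≤ J.p i ∧ J.p i ≤ i

/-- The cell of the table for the first `j` items with `k` of them kept. -/
def cell (n k j : ℕ) : ℕ := k * (n + 1) + j

theorem cell_inj {n k j k' j' : ℕ} (hj : j ≤ n) (hj' : j' ≤ n) (h : cell n k j = cell n k' j') :
    k = k' ∧ j = j' := by
  unfold cell at h
  have h1 : (k * (n + 1) + j) / (n + 1) = k := by
    rw [mul_comm, Nat.mul_add_div (by omega), Nat.div_eq_of_lt (by omega), add_zero]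
  have h2 : (k' * (n + 1) + j') / (n + 1) = k' := by
    rw [mul_comm, Nat.mul_add_div (by omega), Nat.div_eq_of_lt (by omega), add_zero]
  have h3 : k = k' := by rw [← h1, ← h2, h]
  subst h3
  exact ⟨rfl, by omega⟩

theorem cell_le {n k j W : ℕ} (hW : (n + 2) * (n + 2) ≤ W) (hk : k ≤ n) (hj : j ≤ n) :
    k * (n + 1) + j ≤ W := by nlinarith

open IExpr in
/-- The index `e * (n + 1) + f` of a table cell. -/
def cellExpr (e f : IExpr) : IExpr := add (mul e (add (var 0) (lit 1))) f

theorem cellExpr_val {m : Memory} {n k j : ℕ} {e f : IExpr} (h0 : m.ivar 0 = n)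
    (he : e.val m = k) (hf : f.val m = j) : (cellExpr e f).val m = (cell n k j : ℕ) := by
  simp [cellExpr, IExpr.val, h0, he, hf, cell]

theorem cellExpr_ok {W : ℕ} {m : Memory} {n k j : ℕ} {e f : IExpr} (h0 : m.ivar 0 = n)
    (hW : (n + 2) * (n + 2) ≤ W) (hk : k ≤ n) (hj : j ≤ n)
    (he : e.val m = k) (hf : f.val m = j) (heo : e.Ok W m) (hfo : f.Ok W m) :
    (cellExpr e f).Ok W m := by
  have h1 := cell_le hW hk hj
  have h2 : n + 2 ≤ W := by nlinarith
  have h3 : ((k * (n + 1) + j : ℕ) : ℤ) ≤ W := by exact_mod_cast h1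
  push_cast at h3
  have h4 : (0 : ℤ) ≤ k * (n + 1) := by positivity
  simp only [cellExpr, IExpr.Ok, IExpr.val, h0, he, hf, heo, hfo, true_and, abs_le]
  exact ⟨by omega, by omega, by omega⟩

open IExpr in
/-- Load into real variable `x` the least height for the first `j` items with `k` of them kept, where
real variable `5` holds the bound `top`. -/
def loadCell (x : ℕ) (k j : IExpr) : Prog :=
  .ite (.ilt k (lit 1)) (.rsetVar x (.ofWord (lit 0)))
    (.ite (.ilt j k) (.rsetVar x (.var 5)) (.rsetVar x (.get 5 (cellExpr k j))))

/-- Only cells with `1 ≤ k ≤ j` are read from the array; the other values are boundary cases of the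
recursion. Hence the table needs no initialization. -/
theorem loadCell_wp {W : ℕ} {m : Memory} {n k j x : ℕ} {J : Items} {top : ℝ} {e f : IExpr}
    {Q : Memory → Prop} (h0 : m.ivar 0 = n)
    (hW : (n + 2) * (n + 2) ≤ W) (hk : k ≤ n) (hj : j ≤ n)
    (he : e.val m = k) (hf : f.val m = j) (heo : e.Ok W m) (hfo : f.Ok W m) (htop : m.rvar 5 = top)
    (hT : 1 ≤ k → k ≤ j → m.rarr 5 (cell n k j) = J.minHeight top j k)
    (hQ : Q (m.setRVar x (J.minHeight top j k))) : (loadCell x e f).wp W Q m := by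
  have h2 : n + 2 ≤ W := by nlinarith
  simp only [loadCell, Prog.wp, BExpr.Ok, BExpr.Holds, RExpr.Ok, RExpr.val, he, hf, heo, hfo,
    true_and, cellExpr_ok h0 hW hk hj he hf heo hfo, cellExpr_val h0 he hf, Int.toNat_natCast]
  simp only [IExpr.Ok, IExpr.val, abs_le, htop]
  refine ⟨by omega, fun h => ⟨by omega, ?_⟩, fun h => ⟨fun h' => ?_, fun h' => ⟨by omega, ?_⟩⟩⟩
  · obtain rfl : k = 0 := by omega
    simpa [Items.minHeight_zero] using hQ
  · rwa [Items.minHeight_of_lt top (by omega)] at hQ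
  · rwa [hT (by omega) (by omega)]

open IExpr in
/-- Lift the height in real variable `7` by item `i` in word variable `2`. -/
def liftProg : Prog :=
  .ite (.ilt (lit 0) (get 0 (var 2)))
    (.seq (.floorTo 4 (.sub (.var 7) (.get 4 (var 2))))
      (.rsetVar 7 (.add (.add (.get 4 (var 2)) (.ofWord (var 4))) (.ofWord (lit 1)))))
    (.seq (.floorTo 4 (.sub (.get 4 (var 2)) (.var 7)))
      (.rsetVar 7 (.sub (.get 4 (var 2)) (.ofWord (var 4)))))

theorem liftProg_wp {W n i : ℕ} {m : Memory} {J : Items} {x : ℝ} {Q : Memory → Prop}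
    (hW : n + 10 ≤ W) (hJ : HoldsItems J n m) (hi : m.ivar 2 = i) (hin : i < n)
    (hx : m.rvar 7 = x) (hx0 : 0 ≤ x) (hxn : x ≤ n + 5)
    (hQ : ∀ k, Q ((m.setIVar 4 k).setRVar 7 (J.lift i x))) : liftProg.wp W Q m := by
  have hf := hJ.f_mem i hin
  -- Heights are at most `n + 5` and keys lie in `[0, 1)`, so both floors fit in a word.
  have hb : ∀ y : ℝ, -(n + 6) ≤ y → y ≤ n + 6 → (-(W : ℤ) ≤ ⌊y⌋ ∧ ⌊y⌋ ≤ W) := fun y h1 h2 => by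
    have h3 : ((-(n + 6 : ℕ) : ℤ)) ≤ ⌊y⌋ := Int.le_floor.2 (by push_cast; linarith)
    have h4 : ⌊y⌋ < ((n + 7 : ℕ) : ℤ) := Int.floor_lt.2 (by push_cast; linarith)
    omega
  have hb1 := hb (x - J.f i) (by linarith) (by linarith)
  have hb2 := hb (J.f i - x) (by linarith) (by linarith)
  have hst := hJ.st i hin
  simp only [liftProg, Prog.wp, BExpr.Ok, BExpr.Holds, RExpr.Ok, RExpr.val, IExpr.Ok, IExpr.val, hi,
    Int.toNat_natCast, hJ.f i hin, hx, abs_le, Memory.ivar_setIVar, Memory.rarr_setIVar,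
    Nat.reduceEqDiff, reduceIte]
  refine ⟨by omega, fun h => ⟨by simp; omega, hb1, by simp; omega, ?_⟩,
    fun h => ⟨by simp; omega, hb2, by simp; omega, ?_⟩⟩
  · have hs : J.st i := by
      rcases hst with h' | h'
      · omega
      · exact h'.2
    have := hQ ⌊x - J.f i⌋
    rw [Items.lift, if_pos hs] at this
    simpa using this
  · have hs : ¬ J.st i := by
      rcases hst with h' | h'
      · exact h'.2
      · omega
    have := hQ ⌊J.f i - x⌋
    rwa [Items.lift, if_neg hs] at this

open IExpr in
/-- Fill the cell for the first `i + 1` items with `h` of them kept, where word variables `2` and `3`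
hold `i` and `h`. -/
def fillCell : Prog :=
  .ite (.ilt (var 3) (lit 1)) .skip
    (.seq (loadCell 6 (var 3) (var 2))
    (.seq (.ite (.ilt (get 1 (var 2)) (lit 0)) .skip
      (.seq (loadCell 7 (sub (var 3) (lit 1)) (get 1 (var 2)))
      (.seq liftProg
      (.ite (.rlt (.var 7) (.var 6)) (.rsetVar 6 (.var 7)) .skip))))
    (.rsetArr 5 (cellExpr (var 3) (add (var 2) (lit 1))) (.var 6))))

/-- The number `h` is an integer because diagonal `c` asks for `i + 1 - c` kept items, which is not
positive at its start; then nothing is written. `hT` names the two cells that the recursion reads.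
-/
theorem fillCell_wp {W n i : ℕ} {h : ℤ} {m : Memory} {J : Items} {top : ℝ} {Q : Memory → Prop}
    (hW : 4 * (n + 2) * (n + 2) ≤ W) (hJ : HoldsItems J n m) (h0 : m.ivar 0 = n) (hi : m.ivar 2 = i)
    (hin : i < n) (hh : m.ivar 3 = h) (hhn : h ≤ n) (hhn' : -(n : ℤ) ≤ h) (ht : m.rvar 5 = top)
    (ht0 : 0 ≤ top) (htn : top ≤ n + 5)
    (hT : ∀ k j : ℕ, (k : ℤ) = h ∧ j = i ∨ (k : ℤ) = h - 1 ∧ (j : ℤ) = J.p i → 1 ≤ k → k ≤ j →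
      m.rarr 5 (cell n k j) = J.minHeight top j k)
    (hQ : ∀ m' : Memory, (∀ x, (1 ≤ h ∧ x = cell n h.toNat (i + 1) ∧
        m'.rarr 5 x = J.minHeight top (i + 1) h.toNat) ∨
      ((h < 1 ∨ x ≠ cell n h.toNat (i + 1)) ∧ m'.rarr 5 x = m.rarr 5 x)) → Q m') :
    fillCell.wp W Q m := by
  have hW2 : (n + 2) * (n + 2) ≤ W := by nlinarith
  have hW3 : n + 10 ≤ W := by nlinarith
  have hpm := hJ.p_mem i hin
  have hp := hJ.p i hin
  rw [fillCell, Prog.wp.eq_8]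
  refine ⟨by simp only [BExpr.Ok, IExpr.Ok, hh, abs_le]; omega, fun hlt => ?_, fun hlt => ?_⟩
  · simp only [BExpr.Holds, IExpr.val, hh] at hlt
    exact hQ m fun x => .inr ⟨.inl hlt, rfl⟩
  simp only [BExpr.Holds, IExpr.val, hh] at hlt
  obtain ⟨k, rfl⟩ : ∃ k : ℕ, h = (k + 1 : ℕ) := ⟨(h - 1).toNat, by omega⟩
  have hfin : ∀ m₁ : Memory, m₁.ivar 0 = n → m₁.ivar 2 = i → m₁.ivar 3 = (k + 1 : ℕ) →
      m₁.rarr 5 = m.rarr 5 → m₁.rvar 6 = J.minHeight top (i + 1) (k + 1) →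
      (Prog.rsetArr 5 (cellExpr (.var 3) (.add (.var 2) (.lit 1))) (.var 6)).wp W Q m₁ := by
    intro m₁ h0 h2 h3 h5 h6
    have hv3 : (IExpr.var 3).val m₁ = (k + 1 : ℕ) := h3
    have hv2 : (IExpr.add (.var 2) (.lit 1)).val m₁ = (i + 1 : ℕ) := by simp [IExpr.val, h2]
    rw [Prog.wp.eq_5]
    refine ⟨cellExpr_ok h0 hW2 (k := k + 1) (j := i + 1) (by omega) (by omega) hv3 hv2 ?_ ?_, ?_,
      trivial, ?_⟩
    · simp only [IExpr.Ok, h3, abs_le]; omega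
    · simp only [IExpr.Ok, IExpr.val, h2, abs_le]; omega
    · rw [cellExpr_val h0 hv3 hv2]; omega
    · rw [cellExpr_val h0 hv3 hv2]
      refine hQ _ fun x => ?_
      by_cases hx : x = cell n (k + 1) (i + 1)
      · exact .inl ⟨by omega, by simpa using hx, by simp [hx, RExpr.val, h6]⟩
      · exact .inr ⟨.inr (by simpa using hx), by simp [hx, h5]⟩
  rw [Prog.wp.eq_7]
  refine loadCell_wp (k := k + 1) (j := i) (J := J) h0 hW2 (by omega) (by omega) hh hi
    (by simp only [IExpr.Ok, hh, abs_le]; omega) (by simp only [IExpr.Ok, hi, abs_le]; omega) ht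
    (fun h1 h2 => hT _ _ (.inl ⟨rfl, rfl⟩) h1 h2) ?_
  rw [Prog.wp.eq_7, Prog.wp.eq_8]
  refine ⟨?_, fun hneg => ?_, fun hneg => ?_⟩
  · simp only [BExpr.Ok, IExpr.Ok, IExpr.val, Memory.ivar_setRVar, Memory.iarr_setRVar, hi,
      Int.toNat_natCast, hp, abs_le]
    omega
  · simp only [BExpr.Holds, IExpr.val, Memory.ivar_setRVar, Memory.iarr_setRVar, hi,
      Int.toNat_natCast, hp] at hneg
    rw [Prog.wp.eq_1]
    refine hfin _ (by simpa using h0) (by simpa using hi) (by simpa using hh) (by simp) ?_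
    rw [Items.minHeight, dif_neg (by omega)]
    simp
  · simp only [BExpr.Holds, IExpr.val, Memory.ivar_setRVar, Memory.iarr_setRVar, hi,
      Int.toNat_natCast, hp] at hneg
    obtain ⟨q, hq⟩ := Int.eq_ofNat_of_zero_le (not_lt.1 hneg)
    rw [Prog.wp.eq_7]
    refine loadCell_wp (k := k) (j := q) (J := J) (by simpa using h0) hW2 (by omega) (by omega)
      (by simp [IExpr.val, hh]) (by simp [IExpr.val, hi, hp, hq])
      (by simp only [IExpr.Ok, IExpr.val, Memory.ivar_setRVar, hh, abs_le]; omega)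
      (by simp only [IExpr.Ok, IExpr.val, Memory.ivar_setRVar, Memory.iarr_setRVar, hi,
        Int.toNat_natCast, hp, abs_le]; omega)
      (by simpa using ht) (fun h1 h2 => by
        simpa using hT _ _ (.inr ⟨by omega, hq.symm⟩) h1 h2) ?_
    rw [Prog.wp.eq_7]
    refine liftProg_wp (J := J) (i := i) (x := J.minHeight top q k) (n := n) (by omega)
      ⟨by simpa using hJ.f, by simpa using hJ.st, by simpa using hJ.p, hJ.f_mem, hJ.p_mem⟩
      (by simpa using hi) hin (by simp) (Items.minHeight_nonneg top ht0 _ _)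
      ((Items.minHeight_le top ht0 _ _).trans htn) fun l => ?_
    have hV : J.minHeight top (i + 1) (k + 1) =
        min (J.minHeight top i (k + 1)) (J.lift i (J.minHeight top q k)) := by
      rw [Items.minHeight, dif_pos (by omega), hq]; rfl
    rw [Prog.wp.eq_8]
    refine ⟨⟨trivial, trivial⟩, fun hlt => ?_, fun hlt => ?_⟩
    · simp only [BExpr.Holds, RExpr.val, Memory.rvar_setRVar, Memory.rvar_setIVar,
        Nat.reduceEqDiff, reduceIte] at hlt
      rw [Prog.wp.eq_4]
      refine ⟨trivial, hfin _ (by simpa using h0) (by simpa using hi) (by simpa using hh)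
        (by simp) ?_⟩
      rw [hV, min_eq_right hlt.le]
      simp [RExpr.val]
    · simp only [BExpr.Holds, RExpr.val, Memory.rvar_setRVar, Memory.rvar_setIVar,
        Nat.reduceEqDiff, reduceIte] at hlt
      rw [Prog.wp.eq_1]
      refine hfin _ (by simpa using h0) (by simpa using hi) (by simpa using hh) (by simp) ?_
      rw [hV, min_eq_left (not_lt.1 hlt)]
      simp

theorem HoldsItems.congr {J : Items} {n : ℕ} {m m' : Memory} (h : HoldsItems J n m)
    (hf : m'.rarr 4 = m.rarr 4) (hst : m'.iarr 0 = m.iarr 0) (hp : m'.iarr 1 = m.iarr 1) :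
    HoldsItems J n m' :=
  ⟨by rw [hf]; exact h.f, by rw [hst]; exact h.st, by rw [hp]; exact h.p, h.f_mem, h.p_mem⟩

/-- The cells of the table that are known when the rows and diagonals before `c` have been filled,
and row and diagonal `c` up to item `i`. -/
def KnownTable (J : Items) (n : ℕ) (top : ℝ) (c i : ℕ) (T : ℕ → ℝ) : Prop :=
  ∀ k j : ℕ, 1 ≤ k → k ≤ j → j ≤ n → (k < c ∨ j < k + c ∨ (j ≤ i ∧ (k = c ∨ j = k + c))) →
    T (cell n k j) = J.minHeight top j k

/-- The memory while row and diagonal `c` are filled. -/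
structure RowInv (J : Items) (n : ℕ) (top : ℝ) (c i : ℕ) (m : Memory) : Prop where
  items : HoldsItems J n m
  top_eq : m.rvar 5 = top
  c_eq : m.ivar 5 = c
  known : KnownTable J n top c i (m.rarr 5)

open IExpr in
/-- Fill the cells of row and diagonal `c` for one item, where word variable `5` holds `c`. -/
def rowBody : Prog :=
  .seq (.isetVar 3 (var 5)) (.seq fillCell
    (.seq (.isetVar 3 (sub (add (var 2) (lit 1)) (var 5))) fillCell))

section

variable {W n : ℕ} {J : Items} {top : ℝ}

/-- The entry of row `c` needs row `c` one item earlier and row `c - 1`. The entry of diagonal `c`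
needs diagonal `c - 1` one item earlier and, since `p i ≤ i`, a cell on diagonal `c` or an earlier
diagonal. All of these are already known. -/
theorem rowBody_spec {c i : ℕ} {m : Memory} (hW : 4 * (n + 2) * (n + 2) ≤ W)
    (ht0 : 0 ≤ top) (htn : top ≤ n + 5) (hc : c ≤ n) (hin : i < n) (h0 : m.ivar 0 = n)
    (hi : m.ivar 2 = i) (h : RowInv J n top c i m) :
    Ends W rowBody m (2 * fillCell.steps + 10) fun m' =>
      RowInv J n top c (i + 1) (m'.setIVar 2 (i + 1)) := by
  have hW3 : 4 * (n + 2) ≤ W := by nlinarith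
  have hpm := h.items.p_mem i hin
  refine Ends.mono (Ends.seq (Q := fun m₁ => m₁ = m.setIVar 3 c) (Ends.of_wp ?_) fun m₁ hm₁ =>
    Ends.seq (Ends.of_wp (Q := fun m₂ : Memory => ∀ k j : ℕ, 1 ≤ k → k ≤ j → j ≤ n →
      (k < c ∨ j < k + c ∨ (j ≤ i ∧ (k = c ∨ j = k + c)) ∨ (j = i + 1 ∧ k = c)) →
      m₂.rarr 5 (cell n k j) = J.minHeight top j k) ?_).frame fun m₂ hm₂ =>
    Ends.seq (Q := fun m₃ => m₃ = m₂.setIVar 3 ((i : ℤ) + 1 - c)) (Ends.of_wp ?_) fun m₃ hm₃ =>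
    (Ends.of_wp (Q := fun m₄ : Memory => KnownTable J n top c (i + 1) (m₄.rarr 5)) ?_).frame.mono
      (Q' := fun m' => RowInv J n top c (i + 1) (m'.setIVar 2 (i + 1))) le_rfl fun m₄ hm₄ => ?_)
    ?_ fun m₄ hm₄ => hm₄
  · simp only [Prog.wp, IExpr.Ok, IExpr.val, h.c_eq, abs_le]
    exact ⟨by omega, trivial⟩
  · subst hm₁
    refine fillCell_wp (J := J) (i := i) (h := c) (top := top) hW
      (h.items.congr rfl rfl rfl) (by simp [h0]) (by simp [hi]) hin
      (by simp) (by omega) (by omega) (by simp [h.top_eq]) ht0 htn ?_ ?_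
    · rintro k j hkj h1 h2
      refine h.known k j h1 h2 (by omega) (by omega)
    · intro m₂ hm₂ k j h1 h2 h3 h4
      rcases hm₂ (cell n k j) with ⟨h5, h6, h7⟩ | ⟨h5, h6⟩
      · have := cell_inj (by omega) (by omega) h6
        rw [h7, this.1, this.2]
      · rw [h6]
        refine h.known k j h1 h2 h3 ?_
        rcases h4 with h4 | h4 | h4 | ⟨rfl, rfl⟩
        · exact .inl h4
        · exact .inr (.inl h4)
        · exact .inr (.inr h4)
        · rcases h5 with h5 | h5
          · omega
          · exact absurd (by simp) h5
  · have hi2 : m₂.ivar 2 = i := by rw [hm₂.2.ivar 2 (by decide), hm₁]; simp [hi]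
    have hc2 : m₂.ivar 5 = c := by rw [hm₂.2.ivar 5 (by decide), hm₁]; simp [h.c_eq]
    simp only [Prog.wp, IExpr.Ok, IExpr.val, hi2, hc2, abs_le]
    exact ⟨by omega, trivial⟩
  · subst hm₃
    refine fillCell_wp (J := J) (i := i) (h := (i : ℤ) + 1 - c) (top := top) hW
      (h.items.congr ?_ ?_ ?_) ?_ ?_ hin (by simp) (by omega) (by omega) ?_ ht0 htn ?_ ?_
    · simp [hm₂.2.rarr 4 (by decide), hm₁]
    · simp [hm₂.2.iarr 0 (by decide), hm₁]
    · simp [hm₂.2.iarr 1 (by decide), hm₁]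
    · simp [hm₂.2.ivar 0 (by decide), hm₁, h0]
    · simp [hm₂.2.ivar 2 (by decide), hm₁, hi]
    · simp [hm₂.2.rvar 5 (by decide), hm₁, h.top_eq]
    · rintro k j hkj h1 h2
      exact hm₂.1 k j h1 h2 (by omega) (by omega)
    · intro m₄ hm₄ k j h1 h2 h3 h4
      rcases hm₄ (cell n k j) with ⟨h5, h6, h7⟩ | ⟨h5, h6⟩
      · have := cell_inj (by omega) (by omega) h6
        rw [h7, this.1, this.2]
      · rw [h6]
        refine hm₂.1 k j h1 h2 h3 ?_
        by_cases h8 : j = i + 1 ∧ j = k + c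
        · rcases h5 with h5 | h5
          · omega
          · refine absurd ?_ h5
            rw [h8.1]
            congr 1
            omega
        · omega
  · have hv : ∀ x, x ∉ fillCell.iv → x ≠ 3 → m₄.ivar x = m.ivar x := fun x hx hx3 => by
      rw [hm₄.2.ivar x hx, hm₃, Memory.ivar_setIVar, if_neg hx3, hm₂.2.ivar x hx, hm₁,
        Memory.ivar_setIVar, if_neg hx3]
    refine ⟨h.items.congr ?_ ?_ ?_, ?_, ?_, hm₄.1⟩
    · simp [hm₄.2.rarr 4 (by decide), hm₃, hm₂.2.rarr 4 (by decide), hm₁]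
    · simp [hm₄.2.iarr 0 (by decide), hm₃, hm₂.2.iarr 0 (by decide), hm₁]
    · simp [hm₄.2.iarr 1 (by decide), hm₃, hm₂.2.iarr 1 (by decide), hm₁]
    · simp [hm₄.2.rvar 5 (by decide), hm₃, hm₂.2.rvar 5 (by decide), hm₁, h.top_eq]
    · simp [hv 5 (by decide) (by decide), h.c_eq]
  · simp only [Prog.steps, IExpr.cost]
    omega

theorem fillRow_spec {c : ℕ} {m : Memory} (hW : 4 * (n + 2) * (n + 2) ≤ W)
    (ht0 : 0 ≤ top) (htn : top ≤ n + 5) (hc : c ≤ n) (h0 : m.ivar 0 = n)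
    (h : RowInv J n top c 0 m) :
    Ends W (forLoop rowBody) m (330 * n + 20) (RowInv J n top c n) := by
  have hs : fillCell.steps ≤ 150 := by decide
  have hW3 : 4 * (n + 2) ≤ W := by nlinarith
  refine (forLoop_spec (T := 2 * fillCell.steps + 10) (fun i => RowInv J n top c i) (by decide)
    (by decide) (by omega) h0 ?_ fun i hi m h0 h2 hm => ?_).mono
      (Nat.add_le_add_right (Nat.mul_le_mul_right n (by omega)) 20) fun _ h => h
  · exact ⟨h.items.congr rfl rfl rfl, by simp [h.top_eq], by simp [h.c_eq], h.known⟩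
  · exact rowBody_spec hW ht0 htn hc hi h0 h2 hm

open IExpr in
/-- Decide after row and diagonal `c` whether the optimum has been found; if so, put it into word
variable `7` and set word variable `6`. Real variable `4` holds the bound for the end height. -/
def decideRow : Prog :=
  .seq (loadCell 6 (var 5) (var 0))
    (.ite (.rlt (.var 4) (.var 6))
      (.seq (.isetVar 7 (sub (var 5) (lit 1))) (.isetVar 6 (lit 1)))
      (.seq (loadCell 7 (sub (var 0) (var 5)) (var 0))
        (.ite (.rlt (.var 4) (.var 7)) (.isetVar 5 (add (var 5) (lit 1)))
          (.seq (.isetVar 7 (sub (var 0) (var 5))) (.isetVar 6 (lit 1))))))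

/-- Row `c` tells whether `c` items can be kept, diagonal `c` whether `n - c` can. The optimum is `c
- 1` if row `c` is the first to fail, and `n - c` if diagonal `c` is the first to succeed. -/
theorem decideRow_wp {c : ℕ} {D : ℝ} {m : Memory} {Q : Memory → Prop}
    (hW : 4 * (n + 2) * (n + 2) ≤ W) (hc : c ≤ n) (h0 : m.ivar 0 = n)
    (h : RowInv J n top c n m) (hD : m.rvar 4 = D)
    (hQ1 : D < J.minHeight top n c → ∀ m', m'.ivar 6 = 1 → m'.ivar 7 = (c : ℤ) - 1 → Q m')
    (hQ2 : J.minHeight top n c ≤ D → D < J.minHeight top n (n - c) →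
      ∀ m', m'.ivar 6 = m.ivar 6 → RowInv J n top (c + 1) 0 m' → Q m')
    (hQ3 : J.minHeight top n c ≤ D → J.minHeight top n (n - c) ≤ D →
      ∀ m', m'.ivar 6 = 1 → m'.ivar 7 = (n : ℤ) - c → Q m') : decideRow.wp W Q m := by
  have hW2 : (n + 2) * (n + 2) ≤ W := by nlinarith
  have hW3 : n + 10 ≤ W := by nlinarith
  rw [decideRow, Prog.wp.eq_7]
  refine loadCell_wp (k := c) (j := n) (J := J) h0 hW2 hc le_rfl h.c_eq h0
    (by simp only [IExpr.Ok, h.c_eq, abs_le]; omega) (by simp only [IExpr.Ok, h0, abs_le]; omega)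
    h.top_eq (fun h1 h2 => h.known _ _ h1 h2 le_rfl (by omega)) ?_
  rw [Prog.wp.eq_8]
  refine ⟨⟨trivial, trivial⟩, fun hlt => ?_, fun hlt => ?_⟩
  · simp only [BExpr.Holds, RExpr.val, Memory.rvar_setRVar, Nat.reduceEqDiff, reduceIte, hD] at hlt
    simp only [Prog.wp, IExpr.Ok, IExpr.val, Memory.ivar_setRVar, h.c_eq, abs_le]
    exact ⟨by omega, by omega, hQ1 hlt _ (by simp) (by simp)⟩
  simp only [BExpr.Holds, RExpr.val, Memory.rvar_setRVar, Nat.reduceEqDiff, reduceIte, hD] at hlt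
  rw [Prog.wp.eq_7]
  refine loadCell_wp (k := n - c) (j := n) (J := J) (top := top) (by simpa using h0) hW2 (by omega)
    le_rfl (by simp only [IExpr.val, Memory.ivar_setRVar, h0, h.c_eq]; omega)
    (by simpa [IExpr.val] using h0)
    (by simp only [IExpr.Ok, IExpr.val, Memory.ivar_setRVar, h0, h.c_eq, abs_le]; omega)
    (by simp only [IExpr.Ok, Memory.ivar_setRVar, h0, abs_le]; omega)
    (by simpa using h.top_eq)
    (fun h1 h2 => by simpa using h.known _ _ h1 h2 le_rfl (by omega)) ?_
  rw [Prog.wp.eq_8]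
  refine ⟨⟨trivial, trivial⟩, fun hlt' => ?_, fun hlt' => ?_⟩
  · simp only [BExpr.Holds, RExpr.val, Memory.rvar_setRVar, Nat.reduceEqDiff, reduceIte, hD] at hlt'
    simp only [Prog.wp, IExpr.Ok, IExpr.val, Memory.ivar_setRVar, h.c_eq, abs_le]
    refine ⟨by omega, hQ2 (not_lt.1 hlt) hlt' _ (by simp) ⟨h.items.congr (by simp) (by simp)
      (by simp), by simp [h.top_eq], by simp, ?_⟩⟩
    intro k j h1 h2 h3 h4
    simpa using h.known k j h1 h2 h3 (by omega)
  · simp only [BExpr.Holds, RExpr.val, Memory.rvar_setRVar, Nat.reduceEqDiff, reduceIte, hD] at hlt'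
    simp only [Prog.wp, IExpr.Ok, IExpr.val, Memory.ivar_setRVar, h.c_eq, h0, abs_le]
    exact ⟨by omega, by omega, hQ3 (not_lt.1 hlt) (not_lt.1 hlt') _ (by simp) (by simp)⟩

theorem table_time (n : ℕ) {a b : ℕ} (h : a ≤ b + 1) :
    (a + 1) * (330 * n + 174) + 20 ≤ 1000 * (n + 1) * (b + 3) := by
  have : (a + 1) * (330 * n + 174) ≤ (b + 2) * (330 * n + 174) :=
    Nat.mul_le_mul_right _ (by omega)
  nlinarith

open IExpr in
/-- Fill rows and diagonals until the optimum is known, then store it. -/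
def tableProg : Prog :=
  .seq (.seq (.isetVar 5 (lit 0)) (.isetVar 6 (lit 0)))
    (.seq (.loop (.ilt (var 6) (lit 1)) (.seq (forLoop rowBody) decideRow))
      (.seq (.isetVar 1 (sub (var 0) (var 7))) (.isetVar 0 (var 7))))

theorem tableProg_spec {σ : ℕ} {D : ℝ} {m : Memory} (hW : 4 * (n + 2) * (n + 2) ≤ W)
    (ht0 : 0 ≤ top) (htn : top ≤ n + 5) (hDt : D < top) (h0 : m.ivar 0 = n)
    (hJ : HoldsItems J n m) (htop : m.rvar 5 = top) (hD : m.rvar 4 = D) (hp : ∀ i, J.p i ≤ i)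
    (hσ : IsGreatest {s | J.Reach n s 0 D} σ) :
    Ends W tableProg m (1000 * (n + 1) * (min σ (n - σ) + 3)) fun m' =>
      m'.ivar 0 = σ ∧ m'.ivar 1 = (n - σ : ℕ) := by
  have hW3 : n + 10 ≤ W := by nlinarith
  -- Attainable numbers are closed downwards, so each test in a round compares one number with `σ`.
  -- The search therefore ends at `c = min (σ + 1) (n - σ)`.
  have hle : ∀ s, J.minHeight top n s ≤ D ↔ s ≤ σ := fun s => by
    rw [Items.minHeight_le_iff hp hDt]
    exact ⟨fun h => hσ.2 h, fun h => Items.Reach.of_le hσ.1 h⟩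
  have hσn : σ ≤ n := hσ.1.card_le
  have hM := min_le_left (σ + 1) (n - σ)
  have hM' := min_le_right (σ + 1) (n - σ)
  refine Ends.mono (Ends.seq (Q := fun m₁ => m₁.ivar 0 = n ∧ m₁.ivar 6 = 0 ∧ m₁.rvar 4 = D ∧
      RowInv J n top 0 0 m₁) (Ends.of_wp ?_) fun m₁ hm₁ => Ends.seq
    (Q := fun m₂ => m₂.ivar 0 = n ∧ m₂.ivar 7 = σ)
    (Ends.loop (T := 330 * n + 20 + 150) (fun k m' =>
      m'.ivar 0 = n ∧ m'.rvar 4 = D ∧ ((m'.ivar 6 = 1 ∧ m'.ivar 7 = σ) ∨ (m'.ivar 6 = 0 ∧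
        ∃ c : ℕ, c ≤ σ + 1 ∧ c ≤ n - σ ∧ c + k = min (σ + 1) (n - σ) + 1 ∧ RowInv J n top c 0 m')))
      ?_ (min (σ + 1) (n - σ) + 1) m₁ ?_) fun m₂ hm₂ => Ends.of_wp ?_) ?_ fun m' hm' => hm'
  · simp only [Prog.wp, IExpr.Ok, IExpr.val, abs_le]
    exact ⟨by omega, by omega, by simp [h0], by simp, by simp [hD],
      ⟨hJ.congr rfl rfl rfl, by simp [htop], by simp, fun k j h1 h2 h3 h4 => by omega⟩⟩
  · rintro k m' ⟨h0, h4, h⟩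
    have h6 : 0 ≤ m'.ivar 6 ∧ m'.ivar 6 ≤ 1 := by omega
    simp only [BExpr.Ok, BExpr.Holds, IExpr.Ok, IExpr.val, abs_le]
    refine ⟨by omega, fun hlt => ?_, fun hlt => ⟨h0, ?_⟩⟩
    · obtain ⟨h6, c, hc1, hc2, hck, hrow⟩ := h.resolve_left (by omega)
      refine ⟨k - 1, by omega, Ends.seq (fillRow_spec hW ht0 htn (by omega) h0 hrow).frame
        fun m'' hm'' => (Ends.of_wp (Q := fun m₄ => ((m₄.ivar 6 = 1 ∧ m₄.ivar 7 = σ) ∨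
          (m₄.ivar 6 = 0 ∧ ∃ c : ℕ, c ≤ σ + 1 ∧ c ≤ n - σ ∧
            c + (k - 1) = min (σ + 1) (n - σ) + 1 ∧ RowInv J n top c 0 m₄))) ?_).frame.mono (by decide)
              fun m₃ hm₃ => ⟨?_, ?_, hm₃.1⟩⟩
      · have h0' : m''.ivar 0 = n := by rw [hm''.2.ivar 0 (by decide), h0]
        have h4' : m''.rvar 4 = D := by rw [hm''.2.rvar 4 (by decide), h4]
        have h6' : m''.ivar 6 = 0 := by rw [hm''.2.ivar 6 (by decide), h6]
        refine decideRow_wp hW (by omega) h0' hm''.1 h4' (fun h1 m₃ h6 h7 => .inl ⟨h6, ?_⟩)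
          (fun h1 h2 m₃ h6 hr => .inr ⟨h6.trans h6', c + 1, ?_, ?_, ?_, hr⟩)
          (fun h1 h2 m₃ h6 h7 => .inl ⟨h6, ?_⟩)
        · rw [← not_le, hle] at h1
          omega
        · rw [hle] at h1; omega
        · rw [← not_le, hle] at h2; omega
        · omega
        · rw [hle] at h1 h2
          omega
      · rw [hm₃.2.ivar 0 (by decide), hm''.2.ivar 0 (by decide), h0]
      · rw [hm₃.2.rvar 4 (by decide), hm''.2.rvar 4 (by decide), h4]
    · rcases h with h | h
      · exact h.2
      · omega
  · exact ⟨hm₁.1, hm₁.2.2.1, .inr ⟨hm₁.2.1, 0, by omega, by omega, by omega, hm₁.2.2.2⟩⟩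
  · simp [Prog.wp, IExpr.Ok, IExpr.val, hm₂.1, hm₂.2, abs_le]
    omega
  · have hm : min (σ + 1) (n - σ) ≤ min σ (n - σ) + 1 := by omega
    have := table_time n hm
    simp only [Prog.steps, BExpr.cost, IExpr.cost]
    linarith

end

/-! ### Loading and sorting the positions -/

open IExpr in
/-- Put the length of the intervals and the scaled length of the box into real variables `2` and `3`,
fill real array `2` by `body`, and sort it. -/
def loadProg (body : Prog) : Prog :=
  .seq (.seq (.rsetVar 2 (.sub (.get 1 (lit 0)) (.get 0 (lit 0))))
    (.rsetVar 3 (.div (.sub (.var 1) (.var 0)) (.var 2))))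
  (.seq (forLoop body) sortProg)

theorem loadProg_spec {W n : ℕ} {I : Family n} {L : ℝ} {body : Prog} {g : ℝ → ℝ}
    (hW : 4 * (n + 2) ≤ W) (hn : 0 < n) (hL : 0 < L) (hlen : ∀ i, I.len i = L)
    (h0 : 0 ∉ body.iv) (h2 : 2 ∉ body.iv) (hr0 : 0 ∉ body.rv) (hr2 : 2 ∉ body.rv)
    (hr3 : 3 ∉ body.rv) (ha : 0 ∉ body.ra) (hs : body.steps ≤ 60)
    (hbody : ∀ (m : Memory) (i : ℕ), i < n → m.ivar 2 = i → m.rvar 2 = L →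
      m.rvar 3 = I.boxLen / L → body.wp W (fun m' => ∀ x, m'.rarr 2 x =
        if x = i then g ((m.rarr 0 i - m.rvar 0) / L) else m.rarr 2 x) m) :
    Ends W (loadProg body) I.input (300 * ((n + 1) * (Nat.log 2 n + 1)) + 300) fun m =>
      m.rvar 3 = I.boxLen / L ∧ (∀ x y, x ≤ y → y < n → m.rarr 2 x ≤ m.rarr 2 y) ∧
        values (m.rarr 2) n = Finset.univ.val.map fun i => g (I.rel L (I.left i)) := by
  have hL' : (I.right ⟨0, hn⟩ - I.left ⟨0, hn⟩) = L := hlen ⟨0, hn⟩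
  refine Ends.mono (Ends.seq (Q := fun m => m.ivar 0 = n ∧ m.rvar 0 = I.boxLeft ∧ m.rvar 2 = L ∧
      m.rvar 3 = I.boxLen / L ∧ m.rarr 0 = I.input.rarr 0) (Ends.of_wp ?_) fun m₁ hm₁ =>
    Ends.seq (Ends.frame (forLoop_spec (T := body.steps) (n := n)
      (fun i m => m.rvar 0 = I.boxLeft ∧ m.rvar 2 = L ∧
      m.rvar 3 = I.boxLen / L ∧ m.rarr 0 = I.input.rarr 0 ∧
        ∀ x < i, m.rarr 2 x = g ((m.rarr 0 x - I.boxLeft) / L))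
      h0 h2 (by omega) hm₁.1 ?_ ?_)) fun m₂ hm₂ => (sortProg_spec hW hn ?_).frame.mono le_rfl
        fun m₃ hm₃ => (⟨?_, hm₃.1.1, ?_⟩ :
          m₃.rvar 3 = I.boxLen / L ∧ (∀ x y, x ≤ y → y < n → m₃.rarr 2 x ≤ m₃.rarr 2 y) ∧
        values (m₃.rarr 2) n = Finset.univ.val.map fun i => g (I.rel L (I.left i)))) ?_ fun m hm => hm
  · simp only [Prog.wp, RExpr.Ok, RExpr.val, IExpr.Ok, IExpr.val, abs_le, Memory.rvar_setRVar,
      Nat.reduceEqDiff, reduceIte, Int.toNat_zero]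
    have : I.input.rarr 1 0 - I.input.rarr 0 0 = L := by simpa [Family.input, hn] using hL'
    rw [this]
    refine ⟨by omega, by simp [hL.ne'], by simp [Family.input], by simp [Family.input], by simp, ?_,
      by simp⟩
    simp [Family.input, Family.boxLen]
  · simp [hm₁.2]
  · intro i hi m hm0 hm2 hI
    have := Ends.frame (Ends.of_wp (hbody m i hi hm2 hI.2.1 hI.2.2.1))
    refine this.mono le_rfl fun m' hm' => ⟨?_, ?_, ?_, ?_, ?_⟩
    · simp [hm'.2.rvar 0 hr0, hI.1]
    · simp [hm'.2.rvar 2 hr2, hI.2.1]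
    · simp [hm'.2.rvar 3 hr3, hI.2.2.1]
    · simp [hm'.2.rarr 0 ha, hI.2.2.2.1]
    · intro x hx
      simp only [Memory.rarr_setIVar, hm'.1, hm'.2.rarr 0 ha]
      split_ifs with h
      · rw [h, hI.1]
      · exact hI.2.2.2.2 x (by omega)
  · rw [hm₂.2.ivar 0, hm₁.1]
    simp [forLoop, Prog.iv, h0]
  · rw [hm₃.2.rvar 3 (by decide), hm₂.1.2.2.1]
  · rw [hm₃.1.2, values_eq_map]
    refine Multiset.map_congr rfl fun i _ => ?_
    rw [hm₂.1.2.2.2.2 i i.2, hm₂.1.2.2.2.1]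
    simp [Family.input, Family.rel]
  · simp only [Prog.steps, RExpr.cost, IExpr.cost]
    have h1 : n + 1 ≤ (n + 1) * (Nat.log 2 n + 1) := Nat.le_mul_of_pos_right _ (by omega)
    have h2 : (body.steps + 20) * n ≤ 80 * n := Nat.mul_le_mul_right _ (by omega)
    omega

open IExpr in
/-- Load the position of one interval. -/
def packLoad : Prog := .rsetArr 2 (var 2) (.div (.sub (.get 0 (var 2)) (.var 0)) (.var 2))

open IExpr in
/-- Load the clamped position of one interval. -/
def coverLoad : Prog :=
  .seq (.rsetVar 6 (.div (.sub (.get 0 (var 2)) (.var 0)) (.var 2)))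
    (.ite (.conj (.rlt (.ofWord (lit (-1))) (.var 6)) (.rlt (.var 6) (.var 3)))
      (.rsetArr 2 (var 2) (.var 6)) (.rsetArr 2 (var 2) (.ofWord (lit (-1)))))

section

variable {W n : ℕ} {I : Family n} {L : ℝ}

theorem packSort_spec (hW : 4 * (n + 2) ≤ W) (hn : 0 < n) (hL : 0 < L) (hlen : ∀ i, I.len i = L) :
    Ends W (loadProg packLoad) I.input (300 * ((n + 1) * (Nat.log 2 n + 1)) + 300) fun m =>
      m.rvar 3 = I.boxLen / L ∧ (∀ x y, x ≤ y → y < n → m.rarr 2 x ≤ m.rarr 2 y) ∧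
        values (m.rarr 2) n = Finset.univ.val.map fun i => I.rel L (I.left i) := by
  refine loadProg_spec (g := fun x => x) hW hn hL hlen (by decide) (by decide) (by decide)
    (by decide) (by decide) (by decide) (by decide) fun m i hi h2 hr2 hr3 => ?_
  simp only [packLoad, Prog.wp, RExpr.Ok, RExpr.val, IExpr.Ok, IExpr.val, abs_le, h2, hr2,
    Int.toNat_natCast]
  exact ⟨by omega, by omega, ⟨⟨⟨by omega, by omega⟩, trivial⟩, trivial, hL.ne'⟩, by simp⟩

theorem coverSort_spec (hW : 4 * (n + 2) ≤ W) (hn : 0 < n) (hL : 0 < L) (hlen : ∀ i, I.len i = L) :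
    Ends W (loadProg coverLoad) I.input (300 * ((n + 1) * (Nat.log 2 n + 1)) + 300) fun m =>
      m.rvar 3 = I.boxLen / L ∧ (∀ x y, x ≤ y → y < n → m.rarr 2 x ≤ m.rarr 2 y) ∧
        values (m.rarr 2) n =
          Finset.univ.val.map fun i => clamp (I.boxLen / L) (I.rel L (I.left i)) := by
  refine loadProg_spec (g := clamp (I.boxLen / L)) hW hn hL hlen (by decide) (by decide) (by decide)
    (by decide) (by decide) (by decide) (by decide) fun m i hi h2 hr2 hr3 => ?_
  simp only [coverLoad, Prog.wp, BExpr.Ok, BExpr.Holds, RExpr.Ok, RExpr.val, IExpr.Ok, IExpr.val,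
    abs_le, h2, hr2, hr3, Int.toNat_natCast, Memory.rvar_setRVar, Memory.ivar_setRVar,
    Nat.reduceEqDiff, reduceIte]
  refine ⟨⟨⟨⟨by omega, by omega⟩, trivial⟩, trivial, hL.ne'⟩,
    ⟨⟨by omega, trivial⟩, fun _ => ⟨trivial, trivial⟩⟩, fun h => ⟨by omega, by omega, trivial, ?_⟩,
    fun h => ⟨by omega, by omega, by omega, ?_⟩⟩
  · rw [clamp, if_pos (by simpa using h)]; simp
  · rw [clamp, if_neg (by simpa using h)]; simp

end

/-! ### The items of a covering problem -/

/-- The items for covering with the sorted positions `b`. -/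
noncomputable def coverItems (b : ℕ → ℝ) : Items where
  f i := Int.fract (-b i)
  st i := b i = if i = 0 then -1 else b (i - 1)
  p i := i

theorem isCoverItems {n : ℕ} {N : ℝ} {b : ℕ → ℝ} (hs : ∀ x y, x ≤ y → y < n → b x ≤ b y)
    (hm : ∀ i < n, -1 ≤ b i ∧ b i < N) : IsCoverItems (coverItems b) n N b where
  sorted := hs
  mem := hm
  st_zero _ := by simp [coverItems]
  st_succ i _ := by simp [coverItems]
  f i _ := ⟨-⌊-b i⌋, by simp only [coverItems, Int.fract]; push_cast; ring⟩
  p _ := rfl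

open IExpr in
/-- Compute the key and the flag of one item from the positions in real array `2`. -/
def coverKey : Prog :=
  .seq (.floorTo 3 (.sub (.ofWord (lit 0)) (.get 2 (var 2))))
  (.seq (.rsetArr 4 (var 2) (.sub (.sub (.ofWord (lit 0)) (.get 2 (var 2))) (.ofWord (var 3))))
  (.seq (.isetArr 1 (var 2) (var 2))
  (.seq (.ite (.ilt (var 2) (lit 1)) (.rsetVar 6 (.ofWord (lit (-1))))
    (.rsetVar 6 (.get 2 (sub (var 2) (lit 1)))))
  (.ite (.rlt (.var 6) (.get 2 (var 2))) (.isetArr 0 (var 2) (lit 0)) (.isetArr 0 (var 2) (lit 1))))))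

section

variable {W n : ℕ} {N : ℝ} {b : ℕ → ℝ}

/-- The memory holds the first `i` items for the positions `b`. -/
structure CoverInv (b : ℕ → ℝ) (i : ℕ) (m : Memory) : Prop where
  pos : m.rarr 2 = b
  f : ∀ j < i, m.rarr 4 j = Int.fract (-b j)
  st : ∀ j < i, m.iarr 0 j = 0 ∧ ¬ (coverItems b).st j ∨ m.iarr 0 j = 1 ∧ (coverItems b).st j
  p : ∀ j < i, m.iarr 1 j = j

theorem coverKey_wp {i : ℕ} {m : Memory} (hW : 4 * (n + 2) ≤ W) (hN : N ≤ n)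
    (hs : ∀ x y, x ≤ y → y < n → b x ≤ b y) (hm : ∀ i < n, -1 ≤ b i ∧ b i < N) (hi : i < n)
    (h2 : m.ivar 2 = i) (h : CoverInv b i m) :
    coverKey.wp W (fun m' => CoverInv b (i + 1) (m'.setIVar 2 (i + 1))) m := by
  have hbi := hm i hi
  -- Clamped positions lie in `[-1, N)` with `N ≤ n`, so the floor fits in a word.
  have hfl : -(W : ℤ) ≤ ⌊0 - b i⌋ ∧ ⌊0 - b i⌋ ≤ W := by
    have h3 : (-(n : ℤ)) ≤ ⌊0 - b i⌋ := Int.le_floor.2 (by push_cast; linarith)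
    have h4 : ⌊0 - b i⌋ < 2 := Int.floor_lt.2 (by push_cast; linarith)
    omega
  have key : ∀ (k v : ℤ) (r : ℝ), (v = 0 ∧ ¬ (coverItems b).st i ∨ v = 1 ∧ (coverItems b).st i) →
      CoverInv b (i + 1) ((((((m.setIVar 3 k).setRArr 4 i (0 - b i - ⌊0 - b i⌋)).setIArr 1 i i).setRVar
        6 r).setIArr 0 i v).setIVar 2 (i + 1)) := by
    intro k v r hv
    refine ⟨?_, fun j hj => ?_, fun j hj => ?_, fun j hj => ?_⟩
    · funext x; simp [h.pos]
    · by_cases hji : j = i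
      · simp [hji]
      · simpa [hji] using h.f j (by omega)
    · by_cases hji : j = i
      · simpa [hji] using hv
      · simpa [hji] using h.st j (by omega)
    · by_cases hji : j = i
      · simp [hji]
      · simpa [hji] using h.p j (by omega)
  simp only [coverKey, Prog.wp, BExpr.Ok, BExpr.Holds, RExpr.Ok, RExpr.val, IExpr.Ok, IExpr.val, h2,
    h.pos, Int.toNat_natCast, abs_le, Memory.ivar_setIVar, Memory.rarr_setIVar, Memory.ivar_setRArr,
    Memory.ivar_setRVar, Memory.rvar_setRVar, Memory.rarr_setRVar, Memory.ivar_setIArr,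
    Memory.rarr_setIArr, Memory.rarr_setRArr, Nat.reduceEqDiff, reduceIte, false_and, Int.cast_zero]
  refine ⟨by omega, hfl, by omega, by omega, by omega, by omega, by omega, by omega, by omega,
    fun h1 => ⟨by omega, ⟨trivial, by omega, by omega⟩,
      fun h3 => ⟨by omega, by omega, by omega, key _ _ _ ?_⟩,
      fun h3 => ⟨by omega, by omega, by omega, key _ _ _ ?_⟩⟩,
    fun h1 => ⟨by omega, ⟨trivial, by omega, by omega⟩,
      fun h3 => ⟨by omega, by omega, by omega, key _ _ _ ?_⟩,
      fun h3 => ⟨by omega, by omega, by omega, key _ _ _ ?_⟩⟩⟩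
  · obtain rfl : i = 0 := by omega
    refine .inl ⟨rfl, fun h => ?_⟩
    simp only [coverItems, reduceIte] at h
    rw [h] at h3
    norm_num at h3
  · obtain rfl : i = 0 := by omega
    refine .inr ⟨rfl, ?_⟩
    simp only [coverItems, reduceIte]
    refine le_antisymm ?_ hbi.1
    push_cast at h3
    linarith
  · have e : ((i : ℤ) - 1).toNat = i - 1 := by omega
    rw [e] at h3
    refine .inl ⟨rfl, fun h => ?_⟩
    simp only [coverItems, if_neg (show i ≠ 0 by omega)] at h
    linarith
  · have e : ((i : ℤ) - 1).toNat = i - 1 := by omega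
    rw [e] at h3
    refine .inr ⟨rfl, ?_⟩
    simp only [coverItems, if_neg (show i ≠ 0 by omega)]
    exact le_antisymm (not_lt.1 h3) (hs _ _ (by omega) hi)

open IExpr in
/-- Compute the items of the covering problem for the sorted positions in real array `2`, and put the
end height and a larger bound into real variables `4` and `5`. -/
def coverKeys : Prog :=
  .seq (forLoop coverKey)
    (.seq (.rsetVar 4 (.sub (.ofWord (var 0)) (.var 3)))
      (.rsetVar 5 (.ofWord (add (var 0) (lit 5)))))

theorem coverKeys_spec {m : Memory} (hW : 4 * (n + 2) ≤ W) (hN : N ≤ n) (h0 : m.ivar 0 = n)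
    (hs : ∀ x y, x ≤ y → y < n → b x ≤ b y) (hm : ∀ i < n, -1 ≤ b i ∧ b i < N)
    (h3 : m.rvar 3 = N) (hb : m.rarr 2 = b) :
    Ends W coverKeys m (100 * (n + 1)) fun m' => m'.ivar 0 = n ∧ HoldsItems (coverItems b) n m' ∧
      m'.rvar 4 = n - N ∧ m'.rvar 5 = n + 5 := by
  refine Ends.mono (Ends.seq (Ends.frame (forLoop_spec (T := coverKey.steps) (n := n) (CoverInv b)
    (by decide) (by decide) (by omega) h0 ⟨by simp [hb], by simp, by simp, by simp⟩
    fun i hi m _ h2 hI => Ends.of_wp (coverKey_wp hW hN hs hm hi h2 hI)))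
    fun m₁ hm₁ => Ends.of_wp ?_) ?_ fun m' hm' => hm'
  · have h0' : m₁.ivar 0 = n := by rw [hm₁.2.ivar 0 (by decide), h0]
    have h3' : m₁.rvar 3 = N := by rw [hm₁.2.rvar 3 (by decide), h3]
    simp only [Prog.wp, RExpr.Ok, RExpr.val, IExpr.Ok, IExpr.val, h0', abs_le, Memory.ivar_setRVar]
    refine ⟨by simp; omega, by omega, trivial, ⟨hm₁.1.f, hm₁.1.st, hm₁.1.p,
      fun i _ => ⟨Int.fract_nonneg _, Int.fract_lt_one _⟩, fun i _ => ?_⟩, by simp [h3'], by simp⟩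
    simp only [coverItems]
    omega
  · have : coverKey.steps ≤ 60 := by decide
    have : (coverKey.steps + 20) * n ≤ 80 * n := Nat.mul_le_mul_right _ (by omega)
    simp only [Prog.steps, RExpr.cost, IExpr.cost]
    omega

end

/-! ### The items of a packing problem -/

/-- `r` and `p` are the key and the predecessor bound of item `j` for packing with the sorted positions
`b`. If the box is large then the keys do not matter, and they are `0`. -/
def IsPackCell (n : ℕ) (N : ℝ) (b : ℕ → ℝ) (j : ℕ) (r : ℝ) (p : ℤ) : Prop :=
  ((0 ≤ b j ∧ b j + 1 ≤ N) ∧ 0 ≤ p ∧ p ≤ j ∧ (∀ s : ℕ, s < j → ((s : ℤ) < p ↔ b s + 1 ≤ b j)) ∧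
    r = if N < 2 * n then Int.fract (b j) else 0) ∨
  (¬ (0 ≤ b j ∧ b j + 1 ≤ N) ∧ p = -1 ∧ r = 0)

open IExpr in
/-- Compute the item in word variable `2`, where word variable `3` holds the number of positions that
are smaller by `1`. -/
def packCell : Prog :=
  .seq (.rsetArr 4 (var 2) (.ofWord (lit 0)))
    (.ite (.conj (.neg (.rlt (.get 2 (var 2)) (.ofWord (lit 0))))
        (.neg (.rlt (.var 3) (.add (.get 2 (var 2)) (.ofWord (lit 1))))))
      (.seq (.isetArr 1 (var 2) (var 3))
        (.ite (.rlt (.var 3) (.ofWord (add (var 0) (var 0))))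
          (.seq (.floorTo 4 (.get 2 (var 2)))
            (.rsetArr 4 (var 2) (.sub (.get 2 (var 2)) (.ofWord (var 4)))))
          .skip))
      (.isetArr 1 (var 2) (lit (-1))))

open IExpr in
/-- Compute one item or increase the number of smaller positions. -/
def packStep : Prog :=
  .ite (.rlt (.get 2 (var 2)) (.add (.get 2 (var 3)) (.ofWord (lit 1))))
    (.seq packCell (.isetVar 2 (add (var 2) (lit 1))))
    (.isetVar 3 (add (var 3) (lit 1)))

section

variable {W n : ℕ} {N : ℝ} {b : ℕ → ℝ}

theorem packCell_wp {i q : ℕ} {m : Memory} (hW : 4 * (n + 2) ≤ W) (hi : i < n) (hqi : q ≤ i)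
    (h0 : m.ivar 0 = n) (h2 : m.ivar 2 = i) (h3 : m.ivar 3 = q) (hr3 : m.rvar 3 = N)
    (hb : m.rarr 2 = b) (hq : ∀ s : ℕ, s < i → ((s : ℤ) < q ↔ b s + 1 ≤ b i)) :
    packCell.wp W (fun m' => (∀ j, j ≠ i → m'.rarr 4 j = m.rarr 4 j ∧ m'.iarr 1 j = m.iarr 1 j) ∧
      IsPackCell n N b i (m'.rarr 4 i) (m'.iarr 1 i)) m := by
  simp only [packCell, Prog.wp, BExpr.Ok, BExpr.Holds, RExpr.Ok, RExpr.val, IExpr.Ok, IExpr.val, h2,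
    h0, h3, hr3, hb, Int.toNat_natCast, abs_le, Memory.ivar_setIVar, Memory.rarr_setIVar,
    Memory.ivar_setRArr, Memory.rvar_setRArr, Memory.ivar_setIArr, Memory.rvar_setIArr,
    Memory.rarr_setIArr, Memory.rarr_setRArr, Memory.iarr_setIArr, Memory.iarr_setRArr,
    Memory.iarr_setIVar, Nat.reduceEqDiff, reduceIte, false_and, Int.cast_zero, Int.cast_one, not_lt,
    Int.cast_add, Int.cast_natCast, true_and]
  refine ⟨by omega, by omega, by omega, ⟨by omega, fun _ => by omega⟩,
    fun he => ⟨by omega, by omega, by omega, by omega, fun hN => ?_, fun hN => ⟨fun j hj => ?_, ?_⟩⟩,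
    fun he => ⟨by omega, by omega, by omega, fun j hj => ?_, ?_⟩⟩
  · have hfl : -(W : ℤ) ≤ ⌊b i⌋ ∧ ⌊b i⌋ ≤ W := by
      have h3 : (0 : ℤ) ≤ ⌊b i⌋ := Int.floor_nonneg.2 he.1
      have h4 : ⌊b i⌋ < (2 * n : ℕ) := Int.floor_lt.2 (by push_cast; linarith)
      omega
    refine ⟨by omega, hfl, by omega, by omega, by omega, fun j hj => by simp [hj], .inl ⟨he, ?_⟩⟩
    refine ⟨by omega, by omega, hq, ?_⟩
    rw [if_pos (by linarith), Int.fract]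
  · simp [hj]
  · refine .inl ⟨he, ?_⟩
    refine ⟨by omega, by omega, hq, ?_⟩
    rw [if_neg (by linarith)]
  · simp [hj]
  · exact .inr ⟨he, by simp, by simp⟩

/-- The memory while the items of the packing problem are computed. -/
structure PackInv (n : ℕ) (N : ℝ) (b : ℕ → ℝ) (i q : ℕ) (m : Memory) : Prop where
  n_eq : m.ivar 0 = n
  i_eq : m.ivar 2 = i
  q_eq : m.ivar 3 = q
  N_eq : m.rvar 3 = N
  pos : m.rarr 2 = b
  q_le : q ≤ i
  i_le : i ≤ n
  small : ∀ s < q, i < n → b s + 1 ≤ b i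
  cells : ∀ j < i, IsPackCell n N b j (m.rarr 4 j) (m.iarr 1 j)

/-- Two pointers over sorted positions: `q` counts the positions that are at most `b i - 1` and
never moves back as `i` grows. It cannot pass `i`, so `i + q` rises to at most `2 * n`. -/
theorem packStep_spec {i q : ℕ} {m : Memory} (hW : 4 * (n + 2) ≤ W)
    (hs : ∀ x y, x ≤ y → y < n → b x ≤ b y) (hi : i < n) (h : PackInv n N b i q m) :
    Ends W packStep m 100 fun m' => PackInv n N b (i + 1) q m' ∨ PackInv n N b i (q + 1) m' := by
  have hqi := h.q_le
  by_cases hlt : b i < b q + 1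
  · have h1 := (Ends.of_wp (packCell_wp hW hi hqi h.n_eq h.i_eq h.q_eq h.N_eq h.pos fun s hs' =>
      ⟨fun hsq => h.small s (by omega) hi, fun hb => ?_⟩)).frame
    · have h2 := Ends.seq (q := .isetVar 2 (.add (.var 2) (.lit 1))) (T := 4) h1
        (R := fun m' => PackInv n N b (i + 1) q m' ∨ PackInv n N b i (q + 1) m') fun m₁ hm₁ => by
        have hi1 : m₁.ivar 2 = i := by rw [hm₁.2.ivar 2 (by decide), h.i_eq]
        refine Ends.mono (Ends.of_wp (Q := fun m' => m' = m₁.setIVar 2 (i + 1)) ?_) (by decide)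
          fun m₂ hm₂ => .inl ?_
        · simp only [Prog.wp, IExpr.Ok, IExpr.val, hi1, abs_le]
          exact ⟨by omega, trivial⟩
        · subst hm₂
          refine ⟨?_, by simp, ?_, ?_, ?_, by omega, by omega, fun s hs' hi' => ?_, fun j hj => ?_⟩
          · simp [hm₁.2.ivar 0 (by decide), h.n_eq]
          · simp [hm₁.2.ivar 3 (by decide), h.q_eq]
          · simp [hm₁.2.rvar 3 (by decide), h.N_eq]
          · simp [hm₁.2.rarr 2 (by decide), h.pos]
          · exact (h.small s hs' hi).trans (hs _ _ (by omega) hi')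
          · by_cases hji : j = i
            · subst hji; exact hm₁.1.2
            · have := hm₁.1.1 j hji
              simpa [this.1, this.2] using h.cells j (by omega)
      obtain ⟨t, m', hr, ht, hQ⟩ := h2
      refine ⟨_, m', .iteTrue (BExpr.eval_true ?_ ?_) hr, ?_, hQ⟩
      · simp only [BExpr.Ok, RExpr.Ok, IExpr.Ok, IExpr.val, h.i_eq, h.q_eq, abs_le]
        omega
      · simp [BExpr.Holds, RExpr.val, IExpr.val, h.i_eq, h.q_eq, h.pos, hlt]
      · have : packCell.steps ≤ 80 := by decide
        simp only [BExpr.cost, RExpr.cost, IExpr.cost]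
        omega
    · by_contra hsq
      have := hs q s (by omega) (by omega)
      linarith
  · have hr : Runs W (.isetVar 3 (.add (.var 3) (.lit 1))) m 4 (m.setIVar 3 (q + 1)) := by
      have := Runs.isetVar (W := W) (m := m) (x := 3) (e := .add (.var 3) (.lit 1)) (v := q + 1)
        (by rw [IExpr.eval_eq] <;> simp only [IExpr.Ok, IExpr.val, h.q_eq, abs_le]; omega)
      exact this
    have hq : q < i := lt_of_le_of_ne hqi fun e => hlt (by subst e; linarith)
    refine ⟨_, _, .iteFalse (BExpr.eval_false ?_ ?_) hr, ?_, .inr ?_⟩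
    · simp only [BExpr.Ok, RExpr.Ok, IExpr.Ok, IExpr.val, h.i_eq, h.q_eq, abs_le]
      omega
    · simpa [BExpr.Holds, RExpr.val, IExpr.val, h.i_eq, h.q_eq, h.pos] using hlt
    · simp only [BExpr.cost, RExpr.cost, IExpr.cost]
      omega
    · refine ⟨by simp [h.n_eq], by simp [h.i_eq], by simp, by simp [h.N_eq], by simp [h.pos], hq,
        h.i_le, fun s hs' hi' => ?_, h.cells⟩
      by_cases hsq : s = q
      · rw [hsq]; exact not_lt.1 hlt
      · exact h.small s (by omega) hi'

open IExpr in
/-- Compute the items of the packing problem for the sorted positions in real array `2`, and put the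
end height and a larger bound into real variables `4` and `5`. -/
def packKeys : Prog :=
  .seq (.seq (.isetVar 2 (lit 0)) (.isetVar 3 (lit 0)))
  (.seq (.loop (.ilt (var 2) (var 0)) packStep)
    (.seq (.ite (.rlt (.var 3) (.ofWord (add (var 0) (var 0))))
        (.rsetVar 4 (.sub (.var 3) (.ofWord (var 0)))) (.rsetVar 4 (.ofWord (lit 0))))
      (.rsetVar 5 (.ofWord (add (var 0) (lit 5))))))

theorem packKeys_spec {m : Memory} (hW : 4 * (n + 2) ≤ W) (h0 : m.ivar 0 = n)
    (hs : ∀ x y, x ≤ y → y < n → b x ≤ b y) (h3 : m.rvar 3 = N) (hb : m.rarr 2 = b)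
    (hst : m.iarr 0 = fun _ => 0) :
    Ends W packKeys m (300 * (n + 1)) fun m' => m'.ivar 0 = n ∧ m'.iarr 0 = (fun _ => 0) ∧
      (∀ j < n, IsPackCell n N b j (m'.rarr 4 j) (m'.iarr 1 j)) ∧
      (m'.rvar 4 = if N < 2 * n then N - n else 0) ∧ m'.rvar 5 = n + 5 := by
  refine Ends.mono (Ends.seq (Ends.of_wp (Q := PackInv n N b 0 0) ?_).frame fun m₁ hm₁ =>
    Ends.seq (Ends.frame (Ends.loop (T := 100) (Q := fun m' => ∃ q, PackInv n N b n q m')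
      (fun k m' => ∃ i q, i + q + k = 2 * n ∧ PackInv n N b i q m') ?_ (2 * n) m₁
        ⟨0, 0, by omega, hm₁.1⟩))
      fun m₂ hm₂ => Ends.of_wp ?_) ?_ fun m' hm' => hm'
  · simp only [Prog.wp, IExpr.Ok, IExpr.val, abs_le]
    exact ⟨by omega, by omega, by simp [h0], by simp, by simp, by simp [h3], by simp [hb], by omega,
      by omega, by simp, by simp⟩
  · rintro k m' ⟨i, q, hk, h⟩
    simp only [BExpr.Ok, BExpr.Holds, IExpr.Ok, IExpr.val, h.n_eq, h.i_eq, abs_le]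
    have h1 := h.q_le
    have h2 := h.i_le
    refine ⟨by omega, fun hlt => ⟨k - 1, by omega, ?_⟩, fun hlt => ?_⟩
    · refine (packStep_spec hW hs (by omega) h).mono le_rfl fun m'' hm'' => ?_
      rcases hm'' with h' | h'
      · exact ⟨i + 1, q, by omega, h'⟩
      · exact ⟨i, q + 1, by omega, h'⟩
    · obtain rfl : i = n := by omega
      exact ⟨q, h⟩
  · obtain ⟨⟨q, h⟩, hf⟩ := hm₂
    have hst' : m₂.iarr 0 = fun _ => 0 := by
      rw [hf.iarr 0 (by decide), hm₁.2.iarr 0 (by decide), hst]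
    simp only [Prog.wp, BExpr.Ok, BExpr.Holds, RExpr.Ok, RExpr.val, IExpr.Ok, IExpr.val, h.n_eq,
      h.N_eq, abs_le, Memory.ivar_setRVar, Memory.iarr_setRVar, Memory.rarr_setRVar,
      Memory.rvar_setRVar, Nat.reduceEqDiff, reduceIte, hst', true_and]
    refine ⟨by omega, fun hN => ⟨by omega, by omega, h.cells, ?_, by simp⟩,
      fun hN => ⟨by omega, by omega, h.cells, ?_, by simp⟩⟩
    · push_cast at hN ⊢
      rw [if_pos (by linarith)]
    · push_cast at hN ⊢
      rw [if_neg (by linarith)]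
  · simp only [Prog.steps, BExpr.cost, RExpr.cost, IExpr.cost]
    omega

/-- Items with given keys, no flags, and given predecessor bounds for the first `n` of them. -/
def itemsOf (n : ℕ) (f : ℕ → ℝ) (p : ℕ → ℤ) : Items where
  f i := if i < n then f i else 0
  st _ := False
  p i := if i < n then p i else -1

theorem isPackItems_of_cells {r : ℕ → ℝ} {p : ℕ → ℤ} (hs : ∀ x y, x ≤ y → y < n → b x ≤ b y)
    (h : ∀ j < n, IsPackCell n N b j (r j) (p j)) (f : ℕ → ℝ) :
    IsPackItems (itemsOf n f p) n N b where
  sorted := hs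
  st _ h := h
  nonneg i hi := by
    simp only [itemsOf, if_pos hi]
    rcases h i hi with h | h
    · exact iff_of_true h.2.1 h.1
    · exact iff_of_false (by omega) h.1
  lt i hi hp s hsi := by
    simp only [itemsOf, if_pos hi] at hp ⊢
    rcases h i hi with h | h
    · exact h.2.2.2.1 s hsi
    · omega

/-- For a large box the computed keys are 0 and the end height is 0, so only the predecessor bounds
count; `reach_iff_of_large` compares this with the items that have the true positions as keys. -/
theorem keeps_iff_of_cells {r : ℕ → ℝ} {p : ℕ → ℤ} (hN : n ≤ N)
    (hs : ∀ x y, x ≤ y → y < n → b x ≤ b y)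
    (h : ∀ j < n, IsPackCell n N b j (r j) (p j)) {a : Fin n → ℝ}
    (hv : values b n = Finset.univ.val.map a) (s : ℕ) :
    Keeps a (UnitPack N) s ↔ (itemsOf n r p).Reach n s 0 (if N < 2 * n then N - n else 0) := by
  split_ifs with hlt
  · refine (isPackItems_of_cells hs h r).keeps_iff (fun i hi hp => ?_) hN hv s
    simp only [itemsOf, if_pos hi] at hp ⊢
    rcases h i hi with h | h
    · exact ⟨-⌊b i⌋, by rw [h.2.2.2.2, if_pos hlt, Int.fract]; push_cast; ring⟩
    · omega
  · rw [(isPackItems_of_cells hs h b).keeps_iff (fun i hi _ => ⟨0, by simp [itemsOf, hi]⟩) hN hv s]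
    refine ((isPackItems_of_cells hs h r).reach_iff_of_large (not_lt.1 hlt) (itemsOf n b p) rfl
      fun i => ?_).symm
    simp only [itemsOf]
    split_ifs with hi
    · rcases h i hi with h | h
      · rw [h.2.2.2.2, if_neg hlt]
      · exact h.2.2
    · rfl

end

/-! ### Running times -/

theorem natLog_add_one_le {n : ℕ} (hn : 2 ≤ n) : ((Nat.log 2 n + 1 : ℕ) : ℝ) ≤ 4 * Real.log n := by
  have h2 := Real.log_two_gt_d9
  have hn' : (2 : ℝ) ≤ n := by exact_mod_cast hn
  have h3 : Real.log 2 ≤ Real.log n := Real.log_le_log (by norm_num) hn'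
  have h4 : (Nat.log 2 n : ℝ) * Real.log 2 ≤ Real.log n := by
    rw [← Real.log_pow]
    refine Real.log_le_log (by positivity) ?_
    exact_mod_cast Nat.pow_log_le_self 2 (by omega)
  push_cast
  nlinarith [(Nat.log 2 n).cast_nonneg (α := ℝ)]

/-- The summand 1 on the right absorbs the case `n = 1`, where the logarithm vanishes. -/
theorem natLog_pow_le {n : ℕ} (hn : 0 < n) (k : ℕ) :
    (((n + 1) * (Nat.log 2 n + 1) ^ k : ℕ) : ℝ) ≤ 2 * 4 ^ k * (n * Real.log n ^ k + 1) := by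
  rcases Nat.lt_or_ge n 2 with h | h
  · obtain rfl : n = 1 := by omega
    have h1 : (1 : ℝ) ≤ 4 ^ k := one_le_pow₀ (by norm_num)
    have h2 : (0 : ℝ) ≤ (0 : ℝ) ^ k := by positivity
    simp
    nlinarith
  · have h1 := pow_le_pow_left₀ (Nat.cast_nonneg _) (natLog_add_one_le h) k
    have h2 : (0 : ℝ) ≤ 4 ^ k := by positivity
    have h3 : ((n + 1 : ℕ) : ℝ) ≤ 2 * n := by
      have : n + 1 ≤ 2 * n := by omega
      exact_mod_cast this
    calc (((n + 1) * (Nat.log 2 n + 1) ^ k : ℕ) : ℝ)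
        = ((n + 1 : ℕ) : ℝ) * ((Nat.log 2 n + 1 : ℕ) : ℝ) ^ k := by push_cast; ring
      _ ≤ 2 * n * (4 * Real.log n) ^ k := mul_le_mul h3 h1 (by positivity) (by positivity)
      _ = 2 * 4 ^ k * (n * Real.log n ^ k) := by rw [mul_pow]; ring
      _ ≤ _ := by nlinarith

/-- Justifies word size `(n + 2) ^ 4`: table indices and products of a penalty with a height are
quadratic in `n`. -/
theorem four_mul_le_pow (n : ℕ) : 4 * (n + 2) * (n + 2) ≤ (n + 2) ^ 4 := by
  have : 2 ^ 2 ≤ (n + 2) ^ 2 := Nat.pow_le_pow_left (by omega) 2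
  calc 4 * (n + 2) * (n + 2) = 4 * (n + 2) ^ 2 := by ring
    _ ≤ (n + 2) ^ 2 * (n + 2) ^ 2 := Nat.mul_le_mul_right _ this
    _ = (n + 2) ^ 4 := by ring

theorem table_total_time {n : ℕ} (hn : 0 < n) {t s : ℕ}
    (ht : t ≤ 300 * ((n + 1) * (Nat.log 2 n + 1)) + 300 + (300 * (n + 1) + 1000 * (n + 1) * (s + 3))) :
    (t : ℝ) ≤ 40000 * (n * Real.log n + n * (s : ℕ) + 1) := by
  have h1 := natLog_pow_le hn 1
  rw [pow_one, pow_one, pow_one] at h1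
  have h2 : n + 1 ≤ (n + 1) * (Nat.log 2 n + 1) := Nat.le_mul_of_pos_right _ (by omega)
  generalize (n + 1) * (Nat.log 2 n + 1) = X at *
  have h4 : (n + 1) * s ≤ 2 * (n * s) := by nlinarith
  have h3 : t ≤ 3900 * X + 2000 * (n * s) := by nlinarith
  have h5 : (t : ℝ) ≤ 3900 * X + 2000 * (n * s) := by exact_mod_cast h3
  have h6 : (0 : ℝ) ≤ n * s := by positivity
  linarith

/-! ### Algorithms that fill a table -/

theorem Items.isGreatest_best {J : Items} {n : ℕ} {w D : ℝ} (h : w ≤ D) :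
    IsGreatest {s | J.Reach n s w D} (J.best n w D) :=
  ⟨Items.reach_best h, fun _ hr => hr.le_best⟩

theorem pack_solvable : SolvableInTime (fun _ I => I.kappa = 1 ∧ I.totalLen ≤ I.boxLen)
    (fun _ I => I.Pack) (fun n τ σ => n * Real.log n + n * (min σ τ : ℕ)) := by
  refine ⟨.seq (loadProg packLoad) (.seq packKeys tableProg), 4, 40000, fun n I ⟨hk, hle⟩ => ?_⟩
  obtain ⟨hn, L, hL, hlen⟩ := Family.exists_len hk
  have hW := four_mul_le_pow n
  generalize (n + 2) ^ 4 = W at hW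
  have hW' : 4 * (n + 2) ≤ W := by nlinarith
  have hN : (n : ℝ) ≤ I.boxLen / L := by rwa [le_div_iff₀ hL, ← Family.totalLen_eq hlen]
  have hn0 : (0 : ℝ) < n := by exact_mod_cast hn
  obtain ⟨t₁, m₁, hr₁, ht₁, h₁⟩ := (packSort_spec (I := I) hW' hn hL hlen).frame
  obtain ⟨t₂, m₂, hr₂, ht₂, h0, hst, hcells, hD, htop⟩ := packKeys_spec (b := m₁.rarr 2) hW'
    (by rw [h₁.2.ivar 0 (by decide)]; simp [Family.input]) h₁.1.2.1 h₁.1.1 rfl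
    (by rw [h₁.2.iarr 0 (by decide)]; rfl)
  have hkeeps := fun s => (Family.achievable_iff hL (Family.isPacked_iff hL hlen) s).trans
    (keeps_iff_of_cells hN h₁.1.2.1 hcells h₁.1.2.2 s)
  obtain ⟨D, hD'⟩ : ∃ D, D = if I.boxLen / L < 2 * n then I.boxLen / L - n else 0 := ⟨_, rfl⟩
  rw [← hD'] at hkeeps hD
  have hD0 : 0 ≤ D := by rw [hD']; split_ifs <;> linarith
  have hDt : D < n + 5 := by rw [hD']; split_ifs <;> linarith
  have hσ := Items.isGreatest_best (J := itemsOf n (m₂.rarr 4) (m₂.iarr 1)) (n := n) hD0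
  have hopt := Family.isOptimal_of_isGreatest hkeeps hσ
  have hJ : HoldsItems (itemsOf n (m₂.rarr 4) (m₂.iarr 1)) n m₂ := by
    refine ⟨fun i hi => by simp [itemsOf, hi], fun i hi => by simp [itemsOf, hst],
      fun i hi => by simp [itemsOf, hi], fun i hi => ?_, fun i hi => ?_⟩
    · simp only [itemsOf, if_pos hi]
      rcases hcells i hi with h | h
      · rw [h.2.2.2.2]
        split_ifs
        · exact ⟨Int.fract_nonneg _, Int.fract_lt_one _⟩
        · norm_num
      · rw [h.2.2]; norm_num
    · simp only [itemsOf, if_pos hi]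
      rcases hcells i hi with h | h <;> omega
  have hp : ∀ i, (itemsOf n (m₂.rarr 4) (m₂.iarr 1)).p i ≤ i := fun i => by
    simp only [itemsOf]
    split_ifs with hi
    · rcases hcells i hi with h | h <;> omega
    · omega
  obtain ⟨t₃, m₃, hr₃, ht₃, h₃⟩ := tableProg_spec hW (by positivity) le_rfl hDt h0 hJ htop hD hp hσ
  refine ⟨_, _, _, m₃, hopt.1, .seq hr₁ (.seq hr₂ hr₃), h₃.1, h₃.2, table_total_time hn ?_⟩
  omega

/-! ### Covering: the common preparation and the table algorithm -/

/-- The program that loads, sorts and describes a covering problem. -/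
def coverSetup : Prog := .seq (loadProg coverLoad) coverKeys

/-- Serves both covering algorithms. That real array `6` is still zero matters for the second one,
where the array will hold thresholds. -/
theorem coverSetup_spec {n : ℕ} {I : Family n} (hk : I.kappa = 1) (hle : I.boxLen ≤ I.totalLen) {W : ℕ}
    (hW : 4 * (n + 2) ≤ W) : 0 < n ∧ ∃ (N : ℝ) (J : Items), J.Free ∧ 0 < N ∧ N ≤ n ∧
      (∀ s, (∃ t, I.Achievable I.IsCovered t s) ↔ J.Reach n s 0 (n - N)) ∧
      Ends W coverSetup I.input (300 * ((n + 1) * (Nat.log 2 n + 1)) + 300 + 100 * (n + 1)) fun m =>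
        m.ivar 0 = n ∧ HoldsItems J n m ∧ m.rvar 4 = n - N ∧ m.rvar 5 = n + 5 ∧
        m.rarr 6 = fun _ => 0 := by
  obtain ⟨hn, L, hL, hlen⟩ := Family.exists_len hk
  have hN : I.boxLen / L ≤ n := by rwa [div_le_iff₀ hL, ← Family.totalLen_eq hlen]
  have hN0 : 0 < I.boxLen / L := div_pos (sub_pos.2 I.boxLeft_lt_boxRight) hL
  obtain ⟨t₁, m₁, hr₁, ht₁, h₁⟩ := (coverSort_spec (I := I) hW hn hL hlen).frame
  have hm : ∀ i < n, -1 ≤ m₁.rarr 2 i ∧ m₁.rarr 2 i < I.boxLen / L := fun i hi => by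
    have : m₁.rarr 2 i ∈ values (m₁.rarr 2) n :=
      Multiset.mem_map_of_mem _ (Multiset.mem_range.2 hi)
    rw [h₁.1.2.2] at this
    obtain ⟨j, -, hj⟩ := Multiset.mem_map.1 this
    rw [← hj]
    exact clamp_mem hN0 _
  obtain ⟨t₂, m₂, hr₂, ht₂, h₂⟩ := (coverKeys_spec (b := m₁.rarr 2) hW hN
    (by rw [h₁.2.ivar 0 (by decide)]; simp [Family.input]) h₁.1.2.1 hm h₁.1.1 rfl).frame
  refine ⟨hn, I.boxLen / L, coverItems (m₁.rarr 2), fun i => rfl, hN0, hN, fun s => ?_, _, m₂,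
    .seq hr₁ hr₂, by omega, h₂.1.1, h₂.1.2.1, h₂.1.2.2.1, h₂.1.2.2.2, ?_⟩
  · exact (Family.achievable_iff hL (Family.isCovered_iff hL hlen) s).trans
      ((isCoverItems h₁.1.2.1 hm).keeps_iff hN h₁.1.2.2 s)
  · rw [h₂.2.rarr 6 (by decide), h₁.2.rarr 6 (by decide)]
    funext k
    simp [Family.input]

theorem cover_solvable : SolvableInTime (fun _ I => I.kappa = 1 ∧ I.boxLen ≤ I.totalLen)
    (fun _ I => I.Cover) (fun n τ σ => n * Real.log n + n * (min σ τ : ℕ)) := by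
  refine ⟨.seq coverSetup tableProg, 4, 40000, fun n I ⟨hk, hle⟩ => ?_⟩
  have hW := four_mul_le_pow n
  generalize (n + 2) ^ 4 = W at hW
  obtain ⟨hn, N, J, hJ, hN0, hN, hach, t₁, m₁, hr₁, ht₁, h0, hJm, hD, htop, -⟩ :=
    coverSetup_spec hk hle (W := W) (by nlinarith)
  have hσ := Items.isGreatest_best (J := J) (n := n) (sub_nonneg.2 hN)
  have hopt := Family.isOptimal_of_isGreatest hach hσ
  obtain ⟨t₂, m₂, hr₂, ht₂, h₂⟩ := tableProg_spec hW (by positivity) le_rfl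
    (by linarith : (n : ℝ) - N < n + 5) h0 hJm htop hD (fun i => (hJ i).le) hσ
  refine ⟨_, _, _, m₂, hopt.1, .seq hr₁ hr₂, h₂.1, h₂.2, table_total_time hn ?_⟩
  omega

namespace Items

/-! ### Penalized heights -/

variable {J : Items} {l i : ℕ}

/-- The case distinction for the last item, read off the recursion of `minHeight` with `top = D +
1`. -/
theorem reach_succ_iff (hJ : J.Free) {h : ℕ} {D : ℝ} : J.Reach (i + 1) (h + 1) 0 D ↔
    J.Reach i (h + 1) 0 D ∨ ∃ (k : ℤ) (y : ℝ), J.Reach i h 0 y ∧ y ≤ J.f i + k ∧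
      (J.st i → y < J.f i + k) ∧ J.f i + k ≤ D := by
  have hp : ∀ i, J.p i ≤ i := fun i => (hJ i).le
  rw [← minHeight_le_iff hp (lt_add_one D), ← minHeight_le_iff hp (lt_add_one D), minHeight,
    dif_pos ⟨by rw [hJ]; omega, hp i⟩, min_le_iff, hJ, Int.toNat_natCast]
  refine or_congr_right ⟨fun h' => ?_, ?_⟩
  · obtain ⟨k, hk⟩ := lift_congr (J := J) i (J.minHeight (D + 1) i h)
    refine ⟨k, _, (minHeight_le_iff hp ?_).1 le_rfl, hk ▸ le_lift i _, fun hs => hk ▸ lt_lift hs _,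
      hk ▸ h'⟩
    exact (le_lift i _).trans_lt (h'.trans_lt (lt_add_one D))
  · rintro ⟨k, y, hr, hy, hst, hD⟩
    have h1 := (minHeight_le_iff hp (by linarith : y < D + 1)).2 hr
    exact (lift_le (h1.trans hy) (fun hs => h1.trans_lt (hst hs)) ⟨k, rfl⟩).trans hD

/-- On the first `i` items, with the integer part of the end height penalized by `l`, the value `v` can
be attained with fractional part `x` of the end height. -/
def Attains (J : Items) (l i : ℕ) (v : ℤ) (x : ℝ) : Prop :=
  ∃ h e : ℕ, J.Reach i h 0 (e + x) ∧ v ≤ h - l * e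

/-- The value `u` can be attained on the first `i` items in such a way that item `i` can be kept at
height `J.f i` above the integer part that is penalized. -/
def Kept (J : Items) (l i : ℕ) (u : ℤ) : Prop :=
  ∃ (h e : ℕ) (y : ℝ), J.Reach i h 0 y ∧ y ≤ e + J.f i ∧ (J.st i → y < e + J.f i) ∧ u ≤ h - l * e

theorem Attains.mono {v v' : ℤ} {x x' : ℝ} (h : J.Attains l i v x) (hv : v' ≤ v) (hx : x ≤ x') :
    J.Attains l i v' x' := by
  obtain ⟨c, e, hr, hc⟩ := h
  exact ⟨c, e, hr.mono (by linarith), hv.trans hc⟩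

theorem Attains.le {v : ℤ} {x : ℝ} (h : J.Attains l i v x) : v ≤ i := by
  obtain ⟨c, e, hr, hc⟩ := h
  have h1 := hr.card_le
  have h2 : (0 : ℤ) ≤ l * e := by positivity
  omega

theorem attains_zero {x : ℝ} (hx : 0 ≤ x) : J.Attains l i 0 x :=
  ⟨0, 0, reach_zero (by simpa using hx), by simp⟩

/-- If item `i` is kept at height `J.f i + k` and the end has integer part `e`, then either `k = e`,
which needs `J.f i ≤ x`, or `k < e`, which costs at least one more penalty and allows any fractional
part. -/
theorem attains_succ_iff (hJ : J.Free) (hf : 0 ≤ J.f i ∧ J.f i < 1) {v : ℤ} {x : ℝ} (hx : 0 ≤ x)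
    (hx1 : x < 1) : J.Attains l (i + 1) v x ↔
      J.Attains l i v x ∨ (J.f i ≤ x ∧ J.Kept l i (v - 1)) ∨ J.Kept l i (v - 1 + l) := by
  constructor
  · rintro ⟨h, e, hr, hv⟩
    rcases h with - | h
    · exact .inl ⟨0, e, reach_zero (by positivity), hv⟩
    rcases (reach_succ_iff hJ).1 hr with hr | ⟨k, y, hr', hy, hst, hD⟩
    · exact .inl ⟨_, _, hr, hv⟩
    right
    have hy0 := hr'.le
    have hk0 : -1 < k := by
      have : (-1 : ℝ) < k := by linarith
      exact_mod_cast this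
    have hke : k < e + 1 := by
      have : (k : ℝ) < e + 1 := by linarith
      exact_mod_cast this
    obtain ⟨k, rfl⟩ := Int.eq_ofNat_of_zero_le (by omega : 0 ≤ k)
    simp only [Int.cast_natCast] at *
    push_cast at hv
    by_cases hk : k = e
    · subst hk
      exact .inl ⟨by linarith, h, k, y, hr', by linarith, fun hs => by linarith [hst hs], by linarith⟩
    · refine .inr ⟨h, k, y, hr', by linarith, fun hs => by linarith [hst hs], ?_⟩
      have : (l : ℤ) * (k + 1) ≤ l * e := mul_le_mul_of_nonneg_left (by omega) (by positivity)
      linarith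
  · rintro (⟨h, e, hr, hv⟩ | ⟨hfx, h, e, y, hr, hy, hst, hv⟩ | ⟨h, e, y, hr, hy, hst, hv⟩)
    · rcases h with - | h
      · exact ⟨0, e, reach_zero (by positivity), hv⟩
      · exact ⟨h + 1, e, (reach_succ_iff hJ).2 (.inl hr), hv⟩
    · refine ⟨h + 1, e, (reach_succ_iff hJ).2 (.inr ⟨e, y, hr, ?_, fun hs => ?_, ?_⟩), ?_⟩
      · push_cast; linarith
      · push_cast; linarith [hst hs]
      · push_cast; linarith
      · push_cast; linarith
    · refine ⟨h + 1, e + 1, (reach_succ_iff hJ).2 (.inr ⟨e, y, hr, ?_, fun hs => ?_, ?_⟩), ?_⟩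
      · push_cast; linarith
      · push_cast; linarith [hst hs]
      · push_cast; linarith
      · push_cast; linarith

/-- The attainable values for the first `i` items: the largest one is `G`, and a value `v` in the window
above `G - l` needs the fractional part `thr v`. -/
structure Window (J : Items) (l i : ℕ) (G : ℤ) (thr : ℤ → ℝ) : Prop where
  mem : ∀ v, 0 ≤ thr v ∧ thr v < 1
  iff : ∀ v x, 0 ≤ x → x < 1 → (J.Attains l i v x ↔ v ≤ G ∧ (v ≤ G - l ∨ thr v ≤ x))

variable {G : ℤ} {thr thr' : ℤ → ℝ}

theorem window_zero (hm : ∀ v, 0 ≤ thr v ∧ thr v < 1) (h : ∀ v, -(l : ℤ) < v → v ≤ 0 → thr v = 0) :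
    J.Window l 0 0 thr where
  mem := hm
  iff v x hx _ := by
    constructor
    · intro h'
      have := h'.le
      refine ⟨by simpa using this, ?_⟩
      by_cases hv : v ≤ 0 - l
      · exact .inl hv
      · exact .inr (by rw [h v (by omega) (by simpa using this)]; exact hx)
    · rintro ⟨hv, -⟩
      exact (attains_zero hx).mono hv le_rfl

theorem Window.attains (h : J.Window l i G thr) {v : ℤ} (hv : v ≤ G) : J.Attains l i v (thr v) :=
  (h.iff v _ (h.mem v).1 (h.mem v).2).2 ⟨hv, .inr le_rfl⟩

theorem Window.nonneg (h : J.Window l i G thr) : 0 ≤ G :=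
  ((h.iff 0 0 le_rfl one_pos).1 (attains_zero le_rfl)).1

theorem Window.le (h : J.Window l i G thr) : G ≤ i := (h.attains le_rfl).le

theorem Window.monotone (h : J.Window l i G thr) {u v : ℤ} (hu : G - l < u) (huv : u ≤ v)
    (hv : v ≤ G) : thr u ≤ thr v :=
  ((h.iff u _ (h.mem v).1 (h.mem v).2).1 ((h.attains hv).mono huv le_rfl)).2.resolve_left (by omega)

/-- Either the path before item `i` has integer part `e`, and its fractional part is compared with
the key, or its integer part is smaller and a penalty `l` is saved, which means that `u + l` was
attainable. -/
theorem Window.kept_iff (h : J.Window l i G thr) (hf : 0 ≤ J.f i ∧ J.f i < 1) {u : ℤ} :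
    J.Kept l i u ↔ u ≤ G ∧ (u ≤ G - l ∨ (thr u ≤ J.f i ∧ (J.st i → thr u < J.f i))) := by
  constructor
  · rintro ⟨c, e, y, hr, hy, hst, hu⟩
    have hy0 := hr.le
    have hr' : J.Reach i c 0 ((⌊y⌋₊ : ℕ) + Int.fract y) := by
      rwa [natCast_floor_eq_intCast_floor hy0, Int.floor_add_fract]
    have hyf : (⌊y⌋₊ : ℝ) + Int.fract y = y := by
      rw [natCast_floor_eq_intCast_floor hy0, Int.floor_add_fract]
    have hfr := Int.fract_nonneg y
    have he : ⌊y⌋₊ < e + 1 := by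
      have : (⌊y⌋₊ : ℝ) < (e + 1 : ℕ) := by push_cast; linarith
      exact_mod_cast this
    by_cases hee : ⌊y⌋₊ = e
    · rw [hee] at hr' hyf
      have := (h.iff u _ hfr (Int.fract_lt_one y)).1 ⟨c, e, hr', hu⟩
      refine ⟨this.1, this.2.imp_right fun ht => ⟨by linarith, fun hs => ?_⟩⟩
      linarith [hst hs]
    · have hle : (l : ℤ) * (⌊y⌋₊ + 1) ≤ l * e :=
        mul_le_mul_of_nonneg_left (by omega) (by positivity)
      have := (h.iff (u + l) _ hfr (Int.fract_lt_one y)).1 ⟨c, _, hr', by linarith⟩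
      exact ⟨by omega, .inl (by omega)⟩
  · rintro ⟨hu, hu' | ⟨h1, h2⟩⟩
    · obtain ⟨c, e, hr, hc⟩ := h.attains (v := u + l) (by omega)
      have := h.mem (u + l)
      refine ⟨c, e + 1, _, hr, ?_, fun _ => ?_, ?_⟩ <;> push_cast <;> linarith
    · obtain ⟨c, e, hr, hc⟩ := h.attains hu
      exact ⟨c, e, _, hr, by linarith, fun hs => by linarith [h2 hs], hc⟩

/-- Thresholds increase with the value, so the values that item `i` can extend are exactly those up
to `u`. Extending a value below `u` gains nothing, as the next threshold is already at most the key.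
Only `u + 1` gets a new threshold, and the window slides if `u = G`. -/
theorem Window.succ (h : J.Window l i G thr) (hJ : J.Free) (hf : 0 ≤ J.f i ∧ J.f i < 1) {u : ℤ}
    (hu : G - l ≤ u) (huG : u ≤ G)
    (h1 : u = G - l ∨ (thr u ≤ J.f i ∧ (J.st i → thr u < J.f i)))
    (h2 : u = G ∨ ¬ (thr (u + 1) ≤ J.f i ∧ (J.st i → thr (u + 1) < J.f i)))
    (hm : ∀ v, 0 ≤ thr' v ∧ thr' v < 1)
    (hthr : ∀ v, G - l < v → thr' v = if v = u + 1 then J.f i else thr v) :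
    J.Window l (i + 1) (max G (u + 1)) thr' := by
  have hk : ∀ v, J.Kept l i v ↔ v ≤ u := fun v => by
    rw [h.kept_iff hf]
    constructor
    · rintro ⟨hv, hv'⟩
      by_contra hc
      rcases h2 with rfl | h2
      · omega
      rcases hv' with hv' | hv'
      · omega
      have hle := h.monotone (u := u + 1) (v := v) (by omega) (by omega) hv
      exact h2 ⟨hle.trans hv'.1, fun hs => hle.trans_lt (hv'.2 hs)⟩
    · intro hv
      refine ⟨by omega, ?_⟩
      by_cases hvl : v ≤ G - l
      · exact .inl hvl
      · have hle := h.monotone (u := v) (v := u) (by omega) hv huG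
        rcases h1 with h1 | h1
        · omega
        · exact .inr ⟨hle.trans h1.1, fun hs => hle.trans_lt (h1.2 hs)⟩
  have hle : ∀ v, G - l < v → v ≤ u → thr v ≤ J.f i := fun v hv hvu => by
    have := (h.kept_iff hf).1 ((hk v).2 hvu)
    exact (this.2.resolve_left (by omega)).1
  have hge : u < G → J.f i ≤ thr (u + 1) := fun hlt => by
    by_contra hc
    rcases h2 with h2 | h2
    · omega
    · exact h2 ⟨(not_le.1 hc).le, fun _ => not_le.1 hc⟩
  refine ⟨hm, fun v x hx hx1 => ?_⟩
  rw [attains_succ_iff hJ hf hx hx1, hk, hk, h.iff v x hx hx1]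
  by_cases hv : v ≤ max G (u + 1) - l
  · refine iff_of_true ?_ ⟨by omega, .inl hv⟩
    by_cases hv' : v ≤ G - l
    · exact .inl ⟨by omega, .inl hv'⟩
    · exact .inr (.inr (by omega))
  · have hvG : G - l < v := by omega
    rw [hthr v hvG]
    by_cases hvu : v = u + 1
    · rw [if_pos hvu]
      subst hvu
      constructor
      · rintro (⟨h3, h4⟩ | ⟨h3, h4⟩ | h3)
        · exact ⟨by omega, .inr ((hge (by omega)).trans (h4.resolve_left (by omega)))⟩
        · exact ⟨by omega, .inr h3⟩
        · omega
      · rintro ⟨h3, h4⟩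
        exact .inr (.inl ⟨h4.resolve_left hv, by omega⟩)
    · rw [if_neg hvu]
      constructor
      · rintro (⟨h3, h4⟩ | ⟨h3, h4⟩ | h3)
        · exact ⟨by omega, .inr (h4.resolve_left (by omega))⟩
        · exact ⟨by omega, .inr ((hle v hvG (by omega)).trans h3)⟩
        · omega
      · rintro ⟨h3, h4⟩
        exact .inl ⟨by omega, .inr (h4.resolve_left hv)⟩

/-! ### Lagrangian duality -/

variable {n : ℕ} {φ : ℝ}

/-- The largest penalized value. -/
noncomputable def lagrange (J : Items) (n : ℕ) (φ : ℝ) (l : ℕ) : ℤ := sSup {v | J.Attains l n v φ}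

theorem isGreatest_lagrange (hφ : 0 ≤ φ) : IsGreatest {v | J.Attains l n v φ} (J.lagrange n φ l) := by
  have hb : BddAbove {v | J.Attains l n v φ} := ⟨n, fun v hv => hv.le⟩
  exact ⟨Int.csSup_mem ⟨0, attains_zero hφ⟩ hb, fun v hv => le_csSup hb hv⟩

theorem best_le_lagrange (hφ : 0 ≤ φ) (l e : ℕ) :
    (J.best n 0 (e + φ) : ℤ) ≤ J.lagrange n φ l + l * e := by
  have := (isGreatest_lagrange (J := J) (l := l) (n := n) hφ).2
    ⟨J.best n 0 (e + φ), e, reach_best (by positivity), le_rfl⟩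
  linarith

theorem exists_lagrange_le (hφ : 0 ≤ φ) (l : ℕ) :
    ∃ e : ℕ, J.lagrange n φ l + l * e ≤ J.best n 0 (e + φ) := by
  obtain ⟨h, e, hr, hv⟩ := (isGreatest_lagrange (J := J) (l := l) (n := n) hφ).1
  have : (h : ℤ) ≤ J.best n 0 (e + φ) := by exact_mod_cast hr.le_best
  exact ⟨e, by linarith⟩

/-- A maximum of affine functions of `l`: the maximizer for `l + 1` bounds both neighbours from
below. -/
theorem lagrange_convex (hφ : 0 ≤ φ) (l : ℕ) :
    2 * J.lagrange n φ (l + 1) ≤ J.lagrange n φ l + J.lagrange n φ (l + 2) := by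
  obtain ⟨e, he⟩ := exists_lagrange_le (J := J) (n := n) hφ (l + 1)
  have h1 := best_le_lagrange (J := J) (n := n) hφ l e
  have h2 := best_le_lagrange (J := J) (n := n) hφ (l + 2) e
  push_cast at *
  linarith

/-- The strong duality: some penalty attains the bound. -/
theorem exists_lagrange_eq (hJ : J.Free) (hφ : 0 ≤ φ) (d : ℕ) :
    ∃ l ≤ n, J.lagrange n φ l + l * d = J.best n 0 (d + φ) := by
  set B : ℕ → ℤ := fun e => J.best n 0 (e + φ) with hB
  have hmono : ∀ e, B e ≤ B (e + 1) := fun e => by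
    simp only [hB]
    exact_mod_cast best_mono (by positivity) (by push_cast; linarith)
  have hconc : ∀ e, B e + B (e + 2) ≤ 2 * B (e + 1) := fun e => by
    have := best_concave (n := n) (w := 0) (D := ((e + 1 : ℕ) : ℝ) + φ) hJ
      (by push_cast; linarith [(Nat.cast_nonneg e : (0 : ℝ) ≤ e)])
    simp only [hB]
    have e1 : ((e + 1 : ℕ) : ℝ) + φ - 1 = e + φ := by push_cast; ring
    have e2 : ((e + 1 : ℕ) : ℝ) + φ + 1 = (e + 2 : ℕ) + φ := by push_cast; ring
    rw [e1, e2] at this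
    exact_mod_cast this
  have hn : B (d + 1) ≤ n := by
    simp only [hB]
    exact_mod_cast best_le (by positivity)
  have h0 : 0 ≤ B d := by simp [hB]
  -- The tight penalty is the slope of the concave sequence `B` from `d` to `d + 1`. The line with
  -- this slope through `(d, B d)` lies above `B` on both sides, by `hup` and `hdown`.
  obtain ⟨l, hl⟩ := Int.eq_ofNat_of_zero_le (sub_nonneg.2 (hmono d))
  have hdiff : ∀ a k, B (a + k + 1) - B (a + k) ≤ B (a + 1) - B a := fun a k => by
    induction k with
    | zero => simp
    | succ k ih => have := hconc (a + k); rw [← add_assoc]; linarith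
  have hup : ∀ k : ℕ, B (d + k) ≤ B d + l * k := fun k => by
    induction k with
    | zero => simp
    | succ k ih =>
      have := hdiff d k
      rw [← add_assoc]
      push_cast
      linarith
  have hdown : ∀ k ≤ d, B (d - k) ≤ B d - l * k := fun k hk => by
    induction k with
    | zero => simp
    | succ k ih =>
      have h1 := ih (by omega)
      have h2 := hdiff (d - (k + 1)) (k + 1)
      rw [show d - (k + 1) + (k + 1) = d by omega, show d - (k + 1) + 1 = d - k by omega] at h2
      push_cast
      linarith
  refine ⟨l, by omega, le_antisymm ?_ (best_le_lagrange hφ l d)⟩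
  obtain ⟨e, he⟩ := exists_lagrange_le (J := J) (n := n) hφ l
  change _ ≤ B e at he
  change _ ≤ B d
  rcases le_total d e with hde | hde
  · have := hup (e - d)
    rw [Nat.add_sub_cancel' hde, Nat.cast_sub hde] at this
    linarith
  · have := hdown (d - e) (by omega)
    rw [Nat.sub_sub_self hde, Nat.cast_sub hde] at this
    linarith

end Items

/-! ### Searching the window -/

open IExpr in
/-- The threshold of the value `e`. -/
def thrExpr (e : IExpr) : RExpr := .get 6 (add e (sub (var 0) (lit 1)))

/-- The thresholds that the memory holds. -/
def thrOf (n : ℕ) (m : Memory) (v : ℤ) : ℝ := m.rarr 6 (v + (n - 1)).toNat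

open IExpr in
/-- Halve the range of the search. -/
def searchStep : Prog :=
  .seq (.isetVar 3 (div (add (var 18) (var 19)) (lit 2)))
    (.ite (.ilt (lit 0) (var 4))
      (.ite (.rlt (thrExpr (var 3)) (.var 6)) (.isetVar 18 (var 3)) (.isetVar 19 (var 3)))
      (.ite (.rlt (.var 6) (thrExpr (var 3))) (.isetVar 19 (var 3)) (.isetVar 18 (var 3))))

open IExpr in
/-- Find the largest value in the window, with the maximum in word variable `17` and the penalty in
word variable `16`, whose threshold is at most the key in real variable `6`, or less than the key if
word variable `4` is `1`. -/
def searchProg : Prog :=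
  .seq (.seq (.isetVar 18 (sub (var 17) (var 16))) (.isetVar 19 (add (var 17) (lit 1))))
    (.loop (.ilt (add (var 18) (lit 1)) (var 19)) searchStep)

/-- The threshold `t` allows the key `x`, strictly if `s` holds. -/
def Allows (s : Prop) (t x : ℝ) : Prop := t ≤ x ∧ (s → t < x)

/-- The invariant of the search. -/
structure SearchInv (n l : ℕ) (G : ℤ) (s : Prop) (m : Memory) (lo hi : ℤ) (m' : Memory) : Prop where
  lo_eq : m'.ivar 18 = lo
  hi_eq : m'.ivar 19 = hi
  n_eq : m'.ivar 0 = n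
  s_eq : m'.ivar 4 = 0 ∧ ¬ s ∨ m'.ivar 4 = 1 ∧ s
  key : m'.rvar 6 = m.rvar 6
  thr : m'.rarr 6 = m.rarr 6
  le_lo : G - l ≤ lo
  lt : lo < hi
  hi_le : hi ≤ G + 1
  lo_prop : lo = G - l ∨ Allows s (thrOf n m lo) (m.rvar 6)
  hi_prop : hi = G + 1 ∨ ¬ Allows s (thrOf n m hi) (m.rvar 6)

section

variable {W n l : ℕ} {G : ℤ} {s : Prop} {m : Memory}

theorem SearchInv.setLo {lo hi mid : ℤ} {m₁ m₂ : Memory} (h : SearchInv n l G s m lo hi m₁)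
    (h18 : m₂.ivar 18 = mid) (h19 : m₂.ivar 19 = m₁.ivar 19) (h0 : m₂.ivar 0 = m₁.ivar 0)
    (h4 : m₂.ivar 4 = m₁.ivar 4) (h6 : m₂.rvar 6 = m₁.rvar 6) (ht : m₂.rarr 6 = m₁.rarr 6)
    (hlo : lo ≤ mid) (hhi : mid < hi) (hm : Allows s (thrOf n m mid) (m.rvar 6)) :
    SearchInv n l G s m mid hi m₂ :=
  ⟨h18, h19.trans h.hi_eq, h0.trans h.n_eq, h4 ▸ h.s_eq, h6.trans h.key, ht.trans h.thr,
    h.le_lo.trans hlo, hhi, h.hi_le, .inr hm, h.hi_prop⟩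

theorem SearchInv.setHi {lo hi mid : ℤ} {m₁ m₂ : Memory} (h : SearchInv n l G s m lo hi m₁)
    (h19 : m₂.ivar 19 = mid) (h18 : m₂.ivar 18 = m₁.ivar 18) (h0 : m₂.ivar 0 = m₁.ivar 0)
    (h4 : m₂.ivar 4 = m₁.ivar 4) (h6 : m₂.rvar 6 = m₁.rvar 6) (ht : m₂.rarr 6 = m₁.rarr 6)
    (hlo : lo < mid) (hhi : mid ≤ hi) (hm : ¬ Allows s (thrOf n m mid) (m.rvar 6)) :
    SearchInv n l G s m lo mid m₂ :=
  ⟨h18.trans h.lo_eq, h19, h0.trans h.n_eq, h4 ▸ h.s_eq, h6.trans h.key, ht.trans h.thr,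
    h.le_lo, hlo, hhi.trans h.hi_le, h.lo_prop, .inr hm⟩

theorem searchStep_wp {lo hi : ℤ} {m₁ : Memory} (hW : 4 * (n + 2) ≤ W) (hn : 0 < n) (hl : l ≤ n)
    (hG : 0 ≤ G) (hGn : G ≤ n) (h : SearchInv n l G s m lo hi m₁) (hlt : lo + 1 < hi) :
    searchStep.wp W (fun m' => SearchInv n l G s m ((lo + hi) / 2) hi m' ∨
      SearchInv n l G s m lo ((lo + hi) / 2) m') m₁ := by
  have h1 := h.le_lo
  have h2 := h.hi_le
  have h3 := h.s_eq
  obtain ⟨mid, hmid⟩ : ∃ mid, mid = (lo + hi) / 2 := ⟨_, rfl⟩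
  have hfd : Int.fdiv (lo + hi) 2 = mid := by
    rw [Int.fdiv_eq_ediv_of_nonneg _ (by norm_num), hmid]
  rw [← hmid]
  simp only [searchStep, thrExpr, Prog.wp, BExpr.Ok, BExpr.Holds, RExpr.Ok, RExpr.val, IExpr.Ok,
    IExpr.val, h.lo_eq, h.hi_eq, h.n_eq, h.key, h.thr, hfd, Memory.ivar_setIVar, Memory.rvar_setIVar,
    Memory.rarr_setIVar, abs_le, Nat.reduceEqDiff, reduceIte, OfNat.zero_ne_ofNat]
  have ht : m.rarr 6 (mid + (n - 1)).toNat = thrOf n m mid := rfl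
  rw [ht]
  refine ⟨by omega, by omega, fun h4 => ⟨by simp; omega, fun h5 => ⟨by omega, .inl ?_⟩,
    fun h5 => ⟨by omega, .inr ?_⟩⟩, fun h4 => ⟨by simp; omega, fun h5 => ⟨by omega, .inr ?_⟩,
    fun h5 => ⟨by omega, .inl ?_⟩⟩⟩
  · exact h.setLo (by simp) (by simp) (by simp) (by simp) (by simp) (by simp) (by omega) (by omega)
      ⟨h5.le, fun _ => h5⟩
  · have hs : s := by
      rcases h3 with h3 | h3
      · omega
      · exact h3.2
    exact h.setHi (by simp) (by simp) (by simp) (by simp) (by simp) (by simp) (by omega) (by omega)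
      fun ha => h5 (ha.2 hs)
  · exact h.setHi (by simp) (by simp) (by simp) (by simp) (by simp) (by simp) (by omega) (by omega)
      fun ha => absurd ha.1 (not_le.2 h5)
  · have hs : ¬ s := by
      rcases h3 with h3 | h3
      · exact h3.2
      · omega
    exact h.setLo (by simp) (by simp) (by simp) (by simp) (by simp) (by simp) (by omega) (by omega)
      ⟨not_lt.1 h5, fun hs' => absurd hs' hs⟩

/-- The ends `G - l` and `G + 1` are sentinels whose thresholds are never read. The values strictly
between them exceed `-n`, so the offset `n - 1` makes all indices nonnegative. -/
theorem searchProg_spec (hW : 4 * (n + 2) ≤ W) (hn : 0 < n) (hl : l ≤ n)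
    (hG : 0 ≤ G) (hGn : G ≤ n) (h0 : m.ivar 0 = n) (h16 : m.ivar 16 = l) (h17 : m.ivar 17 = G)
    (h4 : m.ivar 4 = 0 ∧ ¬ s ∨ m.ivar 4 = 1 ∧ s) :
    Ends W searchProg m (100 * (Nat.log 2 n + 1) + 20) fun m' => ∃ u, m'.ivar 18 = u ∧ G - l ≤ u ∧
      u ≤ G ∧ (u = G - l ∨ Allows s (thrOf n m u) (m.rvar 6)) ∧
      (u = G ∨ ¬ Allows s (thrOf n m (u + 1)) (m.rvar 6)) := by
  have hnL : n < 2 ^ (Nat.log 2 n + 1) := Nat.lt_pow_succ_log_self (by norm_num) n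
  refine Ends.mono (Ends.seq (Q := fun m' => SearchInv n l G s m (G - l) (G + 1) m')
    (Ends.of_wp ?_) fun m₁ hm₁ => Ends.loop (T := searchStep.steps)
      (fun k m' => ∃ lo hi, hi - lo ≤ 2 ^ k ∧ SearchInv n l G s m lo hi m')
      ?_ (Nat.log 2 n + 1) m₁ ⟨_, _, ?_, hm₁⟩) ?_ fun _ h => h
  · simp only [Prog.wp, IExpr.Ok, IExpr.val, h16, h17, Memory.ivar_setIVar, abs_le,
      Nat.reduceEqDiff, reduceIte]
    exact ⟨by omega, by omega, by simp, by simp, by simp [h0], by simpa using h4, by simp, by simp,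
      le_rfl, by omega, le_rfl, .inl rfl, .inl rfl⟩
  · rintro k m₁ ⟨lo, hi, hk, h⟩
    have h1 := h.le_lo
    have h2 := h.hi_le
    have h3 := h.lt
    simp only [BExpr.Ok, BExpr.Holds, IExpr.Ok, IExpr.val, h.lo_eq, h.hi_eq, abs_le]
    refine ⟨by omega, fun hlt => ?_, fun hlt => ⟨lo, rfl, h1, by omega, h.lo_prop, ?_⟩⟩
    · rcases k with - | k
      · simp at hk; omega
      refine ⟨k, rfl, (Ends.of_wp (searchStep_wp hW hn hl hG hGn h hlt)).mono le_rfl fun m₂ hm₂ => ?_⟩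
      rw [pow_succ] at hk
      rcases hm₂ with hm₂ | hm₂
      · exact ⟨_, _, by omega, hm₂⟩
      · exact ⟨_, _, by omega, hm₂⟩
    · have : hi = lo + 1 := by omega
      subst this
      exact h.hi_prop.imp_left fun h => by omega
  · have : ((n + 1 : ℕ) : ℤ) ≤ ((2 ^ (Nat.log 2 n + 1) : ℕ) : ℤ) := by exact_mod_cast hnL
    push_cast at this
    omega
  · have : searchStep.steps ≤ 80 := by decide
    simp only [Prog.steps, BExpr.cost, IExpr.cost]
    have h2 : (Nat.log 2 n + 1) * (1 + 1 + 1 + 1 + 1 + 1 + searchStep.steps) ≤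
      (Nat.log 2 n + 1) * 90 := Nat.mul_le_mul_left _ (by omega)
    omega

end

/-! ### The penalized optimum -/

open IExpr in
/-- Insert the item in word variable `2` into the window. -/
def insertItem : Prog :=
  .seq (.seq (.rsetVar 6 (.get 4 (var 2))) (.isetVar 4 (get 0 (var 2))))
    (.seq searchProg
    (.seq (.rsetArr 6 (add (var 18) (var 0)) (.var 6))
      (.ite (.ilt (var 17) (add (var 18) (lit 1))) (.isetVar 17 (add (var 18) (lit 1))) .skip)))

/-- All thresholds that the memory holds are fractional parts. -/
def FracArray (m : Memory) : Prop := ∀ k, 0 ≤ m.rarr 6 k ∧ m.rarr 6 k < 1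

/-- The memory while the items are inserted into the window. -/
structure InsertInv (J : Items) (n l i : ℕ) (m : Memory) : Prop where
  items : HoldsItems J n m
  l_eq : m.ivar 16 = l
  frac : FracArray m
  window : J.Window l i (m.ivar 17) (thrOf n m)

section

variable {W n l i : ℕ} {J : Items} {m : Memory}

theorem insertItem_spec (hW : 4 * (n + 2) ≤ W) (hJ : J.Free) (hl : l ≤ n) (hi : i < n)
    (h0 : m.ivar 0 = n) (h2 : m.ivar 2 = i) (h : InsertInv J n l i m) :
    Ends W insertItem m (100 * (Nat.log 2 n + 1) + 60) fun m' =>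
      InsertInv J n l (i + 1) (m'.setIVar 2 (i + 1)) := by
  have hst := h.items.st i hi
  have hf := h.items.f_mem i hi
  have hG := h.window.nonneg
  have hGn := h.window.le
  have hwin := h.window
  obtain ⟨G, hGe⟩ : ∃ G, G = m.ivar 17 := ⟨_, rfl⟩
  rw [← hGe] at hG hGn hwin
  refine Ends.mono (Ends.seq (Q := fun m₁ => m₁ = (m.setRVar 6 (J.f i)).setIVar 4 (m.iarr 0 i))
    (Ends.of_wp ?_) fun m₁ hm₁ => Ends.seq (Ends.frame (searchProg_spec (n := n) (l := l) (G := G)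
      (s := J.st i) (m := m₁) hW (by omega) hl hG (by omega) ?_ ?_ ?_ ?_)) fun m₂ hm₂ =>
        Ends.of_wp ?_) ?_ fun _ h => h
  · simp only [Prog.wp, RExpr.Ok, RExpr.val, IExpr.Ok, IExpr.val, h2, Memory.ivar_setRVar,
      Memory.iarr_setRVar, Int.toNat_natCast, h.items.f i hi, abs_le]
    exact ⟨by omega, by omega, trivial⟩
  · simp [hm₁, h0]
  · simp [hm₁, h.l_eq]
  · simp [hm₁, hGe]
  · simpa [hm₁] using hst
  · obtain ⟨⟨u, hu, hu1, hu2, hu3, hu4⟩, hfr⟩ := hm₂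
    have e0 : m₂.ivar 0 = n := by rw [hfr.ivar 0 (by decide), hm₁]; simp [h0]
    have e16 : m₂.ivar 16 = l := by rw [hfr.ivar 16 (by decide), hm₁]; simp [h.l_eq]
    have e17 : m₂.ivar 17 = G := by rw [hfr.ivar 17 (by decide), hm₁]; simp [hGe]
    have e6 : m₂.rvar 6 = J.f i := by rw [hfr.rvar 6 (by decide), hm₁]; simp
    have er6 : m₂.rarr 6 = m.rarr 6 := by rw [hfr.rarr 6 (by decide), hm₁]; simp
    have er4 : m₂.rarr 4 = m.rarr 4 := by rw [hfr.rarr 4 (by decide), hm₁]; simp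
    have ei0 : m₂.iarr 0 = m.iarr 0 := by rw [hfr.iarr 0 (by decide), hm₁]; simp
    have ei1 : m₂.iarr 1 = m.iarr 1 := by rw [hfr.iarr 1 (by decide), hm₁]; simp
    have et : thrOf n m₁ = thrOf n m := by funext v; simp [thrOf, hm₁]
    have ek : m₁.rvar 6 = J.f i := by simp [hm₁]
    rw [et, ek] at hu3 hu4
    -- Cell `u + n` is the cell of value `u + 1`, because thresholds are stored with offset `n - 1`.
    have key : ∀ G' : ℤ, G' = max G (u + 1) → ∀ m₃ : Memory, m₃.ivar 17 = G' → m₃.ivar 16 = l →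
        m₃.iarr = m₂.iarr → m₃.rarr = (m₂.setRArr 6 (u + n).toNat (J.f i)).rarr →
        InsertInv J n l (i + 1) m₃ := by
      intro G' hG' m₃ h17 h16 hia hra
      have hfrac : FracArray m₃ := fun k => by
        rw [hra]
        simp only [Memory.rarr_setRArr, true_and, er6]
        split_ifs
        exacts [hf, h.frac k]
      refine ⟨h.items.congr ?_ ?_ ?_, h16, hfrac, ?_⟩
      · rw [hra]; funext k; simp [er4]
      · rw [hia, ei0]
      · rw [hia, ei1]
      · rw [h17, hG']
        refine hwin.succ hJ hf hu1 hu2 hu3 hu4 (fun v => hfrac _) fun v hv => ?_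
        simp only [thrOf, hra, Memory.rarr_setRArr, true_and, er6]
        exact if_congr (by omega) rfl rfl
    simp only [Prog.wp, BExpr.Ok, BExpr.Holds, RExpr.Ok, RExpr.val, IExpr.Ok, IExpr.val, hu, e0, e17,
      e6, Memory.ivar_setRArr, abs_le, true_and]
    refine ⟨by omega, by omega, by omega, fun hlt => ⟨by omega, ?_⟩, fun hlt => ?_⟩
    · exact key (u + 1) (by omega) _ (by simp) (by simp [e16]) (by simp) (by simp)
    · exact key G (by omega) _ (by simp [e17]) (by simp [e16]) (by simp) (by simp)
  · simp only [Prog.steps, BExpr.cost, RExpr.cost, IExpr.cost]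
    omega

open IExpr in
/-- Compute the penalized optimum for the penalty in word variable `16` and the fractional part in real
variable `8`, and put it into word variable `20` after adding the penalty for the height in word
variable `21`. -/
def penaltyProg : Prog :=
  .seq (forLoop (.rsetArr 6 (var 2) (.ofWord (lit 0))))
  (.seq (.isetVar 17 (lit 0))
  (.seq (forLoop insertItem)
  (.seq (.seq (.rsetVar 6 (.var 8)) (.isetVar 4 (lit 0)))
  (.seq searchProg
  (.isetVar 20 (add (var 18) (mul (var 16) (var 21))))))))

/-- The memory holds what the computation of penalized optima needs. -/
structure PenaltyInput (J : Items) (n : ℕ) (φ : ℝ) (d : ℕ) (m : Memory) : Prop where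
  n_eq : m.ivar 0 = n
  items : HoldsItems J n m
  φ_eq : m.rvar 8 = φ
  d_eq : m.ivar 21 = d
  frac : FracArray m

variable {φ : ℝ} {d : ℕ}

theorem clearThr_spec (hW : 4 * (n + 2) ≤ W) (h0 : m.ivar 0 = n) (hf : FracArray m) :
    Ends W (forLoop (.rsetArr 6 (.var 2) (.ofWord (.lit 0)))) m (30 * n + 20) fun m' =>
      FracArray m' ∧ ∀ k < n, m'.rarr 6 k = 0 := by
  refine (forLoop_spec (T := 4) (n := n) (fun i m => FracArray m ∧ ∀ k < i, m.rarr 6 k = 0)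
    (by decide) (by decide) (by omega) h0 ⟨hf, by simp⟩ fun i hi m h0 h2 h =>
      Ends.of_wp ?_).mono (by omega) fun _ h => h
  simp only [Prog.wp, RExpr.Ok, RExpr.val, IExpr.Ok, IExpr.val, h2, Int.toNat_natCast, abs_le]
  refine ⟨by omega, by omega, by omega, fun k => ?_, fun k hk => ?_⟩
  · simp only [Memory.rarr_setIVar, Memory.rarr_setRArr, true_and, Int.cast_zero]
    split_ifs
    · norm_num
    · exact h.1 k
  · simp only [Memory.rarr_setIVar, Memory.rarr_setRArr, true_and, Int.cast_zero]
    split_ifs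
    · rfl
    · exact h.2 k (by omega)

theorem penalty_time {n L : ℕ} : 30 * n + 20 + (2 + ((100 * (L + 1) + 80) * n + 20 +
    (4 + (100 * (L + 1) + 20 + 6)))) ≤ 600 * ((n + 1) * (L + 1)) := by
  nlinarith [Nat.zero_le (n * L)]

theorem penaltyProg_spec (hW : 4 * (n + 2) * (n + 2) ≤ W) (hn : 0 < n) (hJ : J.Free) (hl : l ≤ n)
    (hd : d ≤ n) (hφ : 0 ≤ φ ∧ φ < 1) (h16 : m.ivar 16 = l) (h : PenaltyInput J n φ d m) :
    Ends W penaltyProg m (600 * ((n + 1) * (Nat.log 2 n + 1))) fun m' =>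
      PenaltyInput J n φ d m' ∧ m'.ivar 20 = J.lagrange n φ l + l * d := by
  have hW' : 4 * (n + 2) ≤ W := by nlinarith
  refine Ends.mono (Ends.seq (clearThr_spec hW' h.n_eq h.frac).frame fun m₁ hm₁ =>
    Ends.seq (T := (100 * (Nat.log 2 n + 1) + 80) * n + 20 + (4 + (100 * (Nat.log 2 n + 1) + 20 + 6)))
      (S := 2)
      (Q := fun m₂ => m₂ = m₁.setIVar 17 0) (Ends.of_wp ?_) fun m₂ hm₂ => Ends.seq
      (S := (100 * (Nat.log 2 n + 1) + 80) * n + 20)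
    (Ends.frame (forLoop_spec (T := 100 * (Nat.log 2 n + 1) + 60) (n := n) (fun i => InsertInv J n l i)
      (by decide) (by decide) (by omega) ?_ ?_ fun i hi m h0 h2 h =>
        insertItem_spec hW' hJ hl hi h0 h2 h)) fun m₃ hm₃ => ?_)
    penalty_time fun _ h => h
  · simp only [Prog.wp, IExpr.Ok, IExpr.val, abs_le]
    exact ⟨by omega, trivial⟩
  · simp [hm₂, hm₁.2.ivar 0 (by decide), h.n_eq]
  · refine ⟨h.items.congr ?_ ?_ ?_, ?_, ?_, ?_⟩
    · simp [hm₂, hm₁.2.rarr 4 (by decide)]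
    · simp [hm₂, hm₁.2.iarr 0 (by decide)]
    · simp [hm₂, hm₁.2.iarr 1 (by decide)]
    · simp [hm₂, hm₁.2.ivar 16 (by decide), h16]
    · simpa [hm₂, FracArray] using hm₁.1.1
    · have : ((m₂.setIVar 2 0).ivar 17) = 0 := by simp [hm₂]
      rw [this]
      refine Items.window_zero (fun v => ?_) fun v h1 h2 => ?_
      · simpa [hm₂, thrOf] using hm₁.1.1 _
      · simpa [hm₂, thrOf] using hm₁.1.2 _ (by omega)
  have e : ∀ x, x ∉ (forLoop insertItem).iv → x ≠ 17 →
      x ∉ (forLoop (.rsetArr 6 (.var 2) (.ofWord (.lit 0)))).iv → m₃.ivar x = m.ivar x :=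
    fun x h1 h2 h3 => by rw [hm₃.2.ivar x h1, hm₂, Memory.ivar_setIVar, if_neg h2, hm₁.2.ivar x h3]
  have e0 : m₃.ivar 0 = n := by rw [e 0 (by decide) (by decide) (by decide), h.n_eq]
  have e21 : m₃.ivar 21 = d := by rw [e 21 (by decide) (by decide) (by decide), h.d_eq]
  have e8 : m₃.rvar 8 = φ := by
    rw [hm₃.2.rvar 8 (by decide), hm₂, Memory.rvar_setIVar, hm₁.2.rvar 8 (by decide), h.φ_eq]
  have hwin := hm₃.1.window
  have hG := hwin.nonneg
  have hGn := hwin.le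
  refine Ends.seq (S := 4) (Q := fun m₄ => m₄ = (m₃.setRVar 6 φ).setIVar 4 0) (Ends.of_wp ?_)
    fun m₄ hm₄ => Ends.seq (Ends.frame (searchProg_spec (n := n) (l := l) (G := m₃.ivar 17)
      (s := False) (m := m₄) hW' hn hl hG hGn ?_ ?_ ?_ ?_)) fun m₅ hm₅ => Ends.of_wp ?_
  · simp only [Prog.wp, RExpr.Ok, RExpr.val, IExpr.Ok, IExpr.val, e8, abs_le, true_and]
    exact ⟨by omega, trivial⟩
  · simp [hm₄, e0]
  · simp [hm₄, hm₃.1.l_eq]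
  · simp [hm₄]
  · simp [hm₄]
  obtain ⟨⟨u, hu, hu1, hu2, hu3, hu4⟩, hfr⟩ := hm₅
  have e16 : m₅.ivar 16 = l := by rw [hfr.ivar 16 (by decide), hm₄]; simp [hm₃.1.l_eq]
  have e21' : m₅.ivar 21 = d := by rw [hfr.ivar 21 (by decide), hm₄]; simp [e21]
  have et : thrOf n m₄ = thrOf n m₃ := by funext v; simp [thrOf, hm₄]
  have ek : m₄.rvar 6 = φ := by simp [hm₄]
  rw [et, ek] at hu3 hu4
  -- A last search, not strict and with key `φ`, finds the largest value attainable with fractional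
  -- part `φ`.
  have hlag : u = J.lagrange n φ l := by
    refine IsGreatest.unique ?_ (Items.isGreatest_lagrange hφ.1)
    refine ⟨(hwin.iff u φ hφ.1 hφ.2).2 ⟨hu2, hu3.imp (fun h => h.le) fun h => h.1⟩, fun v hv => ?_⟩
    have hv' := (hwin.iff v φ hφ.1 hφ.2).1 hv
    by_contra hc
    rcases hu4 with hu4 | hu4
    · omega
    · exact hu4 ⟨(hwin.monotone (by omega) (by omega : u + 1 ≤ v) hv'.1).trans
        (hv'.2.resolve_left (by omega)), False.elim⟩
  have hld : (l : ℤ) * d ≤ n * n := by gcongr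
  have hld0 : (0 : ℤ) ≤ l * d := by positivity
  have hWz : 4 * ((n : ℤ) + 2) * (n + 2) ≤ W := by exact_mod_cast hW
  have hWn : (n : ℤ) * n + 4 * n ≤ W := by nlinarith
  generalize hp : (l : ℤ) * d = X at *
  simp only [Prog.wp, IExpr.Ok, IExpr.val, hu, e16, e21', hp, abs_le]
  refine ⟨by omega, ⟨?_, ?_, ?_, ?_, fun k => ?_⟩, ?_⟩
  · simp [hfr.ivar 0 (by decide), hm₄, e0]
  · refine hm₃.1.items.congr ?_ ?_ ?_
    · simp [hfr.rarr 4 (by decide), hm₄]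
    · simp [hfr.iarr 0 (by decide), hm₄]
    · simp [hfr.iarr 1 (by decide), hm₄]
  · simp [hfr.rvar 8 (by decide), hm₄, e8]
  · simp [e21']
  · simpa [hfr.rarr 6 (by decide), hm₄] using hm₃.1.frac k
  · simp [hlag]

end

/-! ### Searching the penalty -/

section Convex

variable {F : ℕ → ℤ}

theorem diff_le_of_convex (hF : ∀ l, 2 * F (l + 1) ≤ F l + F (l + 2)) (a k : ℕ) :
    F (a + 1) - F a ≤ F (a + k + 1) - F (a + k) := by
  induction k with
  | zero => simp
  | succ k ih => have := hF (a + k); rw [← add_assoc]; linarith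

theorem le_of_convex_right (hF : ∀ l, 2 * F (l + 1) ≤ F l + F (l + 2)) {m l : ℕ}
    (h : F m ≤ F (m + 1)) (hl : m ≤ l) : F m ≤ F l := by
  induction l, hl using Nat.le_induction with
  | base => exact le_rfl
  | succ l hl ih =>
    have := diff_le_of_convex hF m (l - m)
    rw [Nat.add_sub_cancel' hl] at this
    linarith

theorem le_of_convex_left (hF : ∀ l, 2 * F (l + 1) ≤ F l + F (l + 2)) {m l : ℕ}
    (h : F (m + 1) ≤ F m) (hl : l ≤ m) : F m ≤ F l := by
  obtain ⟨k, rfl⟩ := Nat.exists_eq_add_of_le hl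
  induction k with
  | zero => exact le_rfl
  | succ k ih =>
    have h1 := diff_le_of_convex hF (l + k) 1
    have h2 : F (l + (k + 1)) ≤ F (l + k) := by rw [← add_assoc] at h ⊢; linarith
    exact h2.trans (ih (by rw [← add_assoc] at h2; exact h2) (by omega))

end Convex

open IExpr in
/-- Halve the range of penalties, which word variables `22` and `23` hold. -/
def dualStep : Prog :=
  .seq (.isetVar 16 (div (add (var 22) (var 23)) (lit 2)))
  (.seq penaltyProg
  (.seq (.seq (.isetVar 24 (var 20)) (.isetVar 16 (add (var 16) (lit 1))))
  (.seq penaltyProg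
  (.ite (.ilt (var 20) (var 24)) (.isetVar 22 (var 16)) (.isetVar 23 (sub (var 16) (lit 1)))))))

section

variable {W n d : ℕ} {J : Items} {φ : ℝ} {m : Memory}

/-- The memory when the best penalty is known to lie between `lo` and `hi`. -/
structure DualInv (J : Items) (n : ℕ) (φ : ℝ) (d lo hi : ℕ) (m : Memory) : Prop where
  input : PenaltyInput J n φ d m
  lo_eq : m.ivar 22 = lo
  hi_eq : m.ivar 23 = hi
  le : lo ≤ hi
  hi_le : hi ≤ n
  opt : ∃ l, lo ≤ l ∧ l ≤ hi ∧ J.lagrange n φ l + l * d = J.best n 0 (d + φ)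

theorem PenaltyInput.congr {m' : Memory} (h : PenaltyInput J n φ d m) (h0 : m'.ivar 0 = m.ivar 0)
    (h21 : m'.ivar 21 = m.ivar 21) (hia : m'.iarr = m.iarr) (hrv : m'.rvar = m.rvar)
    (hra : m'.rarr = m.rarr) : PenaltyInput J n φ d m' :=
  ⟨h0.trans h.n_eq, h.items.congr (by rw [hra]) (by rw [hia]) (by rw [hia]), hrv ▸ h.φ_eq,
    h21.trans h.d_eq, fun k => hra ▸ h.frac k⟩

theorem lagrange_bounds (hW : 4 * (n + 2) * (n + 2) ≤ W) {l : ℕ} (hl : l ≤ n) (hd : d ≤ n)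
    (hφ : 0 ≤ φ) : 0 ≤ J.lagrange n φ l + l * d ∧ J.lagrange n φ l + l * d ≤ (W : ℤ) := by
  have h := Items.isGreatest_lagrange (J := J) (l := l) (n := n) hφ
  have h1 : J.lagrange n φ l ≤ n := h.1.le
  have h2 : 0 ≤ J.lagrange n φ l := h.2 (Items.attains_zero hφ)
  have hld : (l : ℤ) * d ≤ n * n := by gcongr
  have hld0 : (0 : ℤ) ≤ l * d := by positivity
  have hWz : 4 * ((n : ℤ) + 2) * (n + 2) ≤ W := by exact_mod_cast hW
  exact ⟨by omega, by nlinarith⟩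

theorem lagrange_add_convex (hφ : 0 ≤ φ) (l : ℕ) :
    2 * (J.lagrange n φ (l + 1) + ((l + 1 : ℕ) : ℤ) * d) ≤
      (J.lagrange n φ l + (l : ℤ) * d) + (J.lagrange n φ (l + 2) + ((l + 2 : ℕ) : ℤ) * d) := by
  have := Items.lagrange_convex (J := J) (n := n) hφ l
  push_cast
  linarith

/-- The function `F l = lagrange l + l * d` is convex and bounded below by the optimum, so tight
penalties are its minimizers. Its values at `mid` and `mid + 1` tell on which side a minimizer lies.
-/
theorem dualStep_spec {lo hi : ℕ} (hW : 4 * (n + 2) * (n + 2) ≤ W) (hn : 0 < n) (hJ : J.Free)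
    (hd : d ≤ n) (hφ : 0 ≤ φ ∧ φ < 1) (hlt : lo < hi) (h : DualInv J n φ d lo hi m) :
    Ends W dualStep m (1200 * ((n + 1) * (Nat.log 2 n + 1)) + 50) fun m' =>
      DualInv J n φ d ((lo + hi) / 2 + 1) hi m' ∨ DualInv J n φ d lo ((lo + hi) / 2) m' := by
  have hW' : 4 * (n + 2) ≤ W := by nlinarith
  have hhi := h.hi_le
  obtain ⟨mid, hmid⟩ : ∃ mid : ℕ, mid = (lo + hi) / 2 := ⟨_, rfl⟩
  have hfd : Int.fdiv ((lo : ℤ) + hi) 2 = mid := by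
    rw [Int.fdiv_eq_ediv_of_nonneg _ (by norm_num), hmid]; omega
  rw [← hmid]
  have hb1 := lagrange_bounds (J := J) (φ := φ) (l := mid) hW (by omega) hd hφ.1
  have hb2 := lagrange_bounds (J := J) (φ := φ) (l := mid + 1) hW (by omega) hd hφ.1
  have hconv := lagrange_add_convex (J := J) (n := n) (d := d) hφ.1
  have hmin := fun l => Items.best_le_lagrange (J := J) (n := n) hφ.1 l d
  obtain ⟨F, hF⟩ : ∃ F : ℕ → ℤ, F = fun l => J.lagrange n φ l + (l : ℤ) * d := ⟨_, rfl⟩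
  have hFl : ∀ l, J.lagrange n φ l + (l : ℤ) * d = F l := fun l => by rw [hF]
  simp only [hFl] at hb1 hb2 hconv hmin
  obtain ⟨l₀, hl1, hl2, hl3⟩ := h.opt
  rw [hFl] at hl3
  refine Ends.mono (Ends.seq (Q := fun m₁ => m₁ = m.setIVar 16 mid) (Ends.of_wp ?_) fun m₁ hm₁ =>
    Ends.seq (Ends.frame (penaltyProg_spec (l := mid) (m := m₁) hW hn hJ (by omega) hd hφ ?_ ?_))
    fun m₂ hm₂ => Ends.seq (Q := fun m₃ => m₃ = (m₂.setIVar 24 (F mid)).setIVar 16 ((mid + 1 : ℕ) : ℤ))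
      (Ends.of_wp ?_) fun m₃ hm₃ =>
    Ends.seq (Ends.frame (penaltyProg_spec (l := mid + 1) (m := m₃) hW hn hJ (by omega) hd hφ ?_ ?_))
    fun m₄ hm₄ => Ends.of_wp ?_) ?_ fun _ h => h
  · simp only [Prog.wp, IExpr.Ok, IExpr.val, h.lo_eq, h.hi_eq, hfd, abs_le]
    exact ⟨by omega, trivial⟩
  · simp [hm₁]
  · exact h.input.congr (by simp [hm₁]) (by simp [hm₁]) (by simp [hm₁]) (by simp [hm₁])
      (by simp [hm₁])
  · have e16 : m₂.ivar 16 = mid := by rw [hm₂.2.ivar 16 (by decide), hm₁]; simp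
    have e20 : m₂.ivar 20 = F mid := by rw [hm₂.1.2, hFl]
    simp only [Prog.wp, IExpr.Ok, IExpr.val, e20, e16, Memory.ivar_setIVar, abs_le, Nat.reduceEqDiff,
      reduceIte]
    exact ⟨by omega, by omega, by push_cast; trivial⟩
  · simp [hm₃]
  · exact hm₂.1.1.congr (by simp [hm₃]) (by simp [hm₃]) (by simp [hm₃]) (by simp [hm₃])
      (by simp [hm₃])
  · have e16 : m₄.ivar 16 = (mid + 1 : ℕ) := by rw [hm₄.2.ivar 16 (by decide), hm₃]; simp
    have e20 : m₄.ivar 20 = F (mid + 1) := by rw [hm₄.1.2, hFl]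
    have e24 : m₄.ivar 24 = F mid := by rw [hm₄.2.ivar 24 (by decide), hm₃]; simp
    have e22 : m₄.ivar 22 = lo := by
      rw [hm₄.2.ivar 22 (by decide), hm₃]; simp [hm₂.2.ivar 22 (by decide), hm₁, h.lo_eq]
    have e23 : m₄.ivar 23 = hi := by
      rw [hm₄.2.ivar 23 (by decide), hm₃]; simp [hm₂.2.ivar 23 (by decide), hm₁, h.hi_eq]
    simp only [Prog.wp, BExpr.Ok, BExpr.Holds, IExpr.Ok, IExpr.val, e20, e16, e24, abs_le]
    refine ⟨by omega, fun hlt' => ⟨by omega, .inl ⟨?_, by simp, by simp [e23], by omega, hhi, l₀, ?_,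
      hl2, by rw [hFl, hl3]⟩⟩, fun hle => ⟨by omega, .inr ⟨?_, by simp [e22], by simp, by omega,
        by omega, ?_⟩⟩⟩
    · exact hm₄.1.1.congr (by simp) (by simp) (by simp) (by simp) (by simp)
    -- If `F` falls after `mid`, convexity gives `F mid ≤ F l₀` for `l₀ ≤ mid`, and then `F (mid +
    -- 1)` would be below the minimum.
    · by_contra hc
      have := le_of_convex_left hconv hlt'.le (by omega : l₀ ≤ mid)
      have := hmin (mid + 1)
      omega
    · exact hm₄.1.1.congr (by simp) (by simp) (by simp) (by simp) (by simp)
    · by_cases hl : l₀ ≤ mid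
      · exact ⟨l₀, hl1, hl, by rw [hFl, hl3]⟩
      -- If `F` does not fall after `mid`, then `F mid ≤ F l₀` for the tight `l₀` beyond `mid`, so
      -- `mid` is tight as well.
      · refine ⟨mid, by omega, le_rfl, ?_⟩
        have := le_of_convex_right hconv (not_lt.1 hle) (by omega : mid ≤ l₀)
        have := hmin mid
        rw [hFl]
        omega
  · simp only [Prog.steps, BExpr.cost, IExpr.cost]
    omega

open IExpr in
/-- Find the optimum for the end height in real variable `4` by a search for the best penalty. -/
def dualProg : Prog :=
  .seq (.seq (.floorTo 21 (.var 4)) (.seq (.rsetVar 8 (.sub (.var 4) (.ofWord (var 21))))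
    (.seq (.isetVar 22 (lit 0)) (.isetVar 23 (var 0)))))
  (.seq (.loop (.ilt (var 22) (var 23)) dualStep)
  (.seq (.isetVar 16 (var 22))
  (.seq penaltyProg
  (.seq (.isetVar 1 (sub (var 0) (var 20))) (.isetVar 0 (var 20))))))

theorem dual_time {X L : ℕ} (hX : 0 < X) :
    10 + 10 + ((L + 1) * (10 + (1200 * X + 50)) + 10 + (10 + (600 * X + 20))) ≤
      2000 * (X * (L + 1)) := by
  nlinarith [Nat.mul_le_mul hX (Nat.zero_le L), Nat.le_mul_of_pos_left L hX]

/-- Splitting `D` into integer part `d` and fractional part `φ` turns the optimum into `B d` for a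
concave sequence; the range `0, …, n` of penalties contains a tight one and is halved in each round.
-/
theorem dualProg_spec {D : ℝ} (hW : 4 * (n + 2) * (n + 2) ≤ W) (hn : 0 < n) (hJ : J.Free)
    (hD : 0 ≤ D) (hDn : D ≤ n) (h0 : m.ivar 0 = n) (h4 : m.rvar 4 = D) (hJm : HoldsItems J n m)
    (hf : FracArray m) :
    Ends W dualProg m (2000 * ((n + 1) * (Nat.log 2 n + 1) * (Nat.log 2 n + 1))) fun m' =>
      m'.ivar 0 = J.best n 0 D ∧ m'.ivar 1 = (n - J.best n 0 D : ℕ) := by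
  have hW' : 4 * (n + 2) ≤ W := by nlinarith
  have hφ : 0 ≤ Int.fract D ∧ Int.fract D < 1 := ⟨Int.fract_nonneg D, Int.fract_lt_one D⟩
  obtain ⟨d, hd⟩ := Int.eq_ofNat_of_zero_le (Int.floor_nonneg.2 hD)
  have hdφ : (d : ℝ) + Int.fract D = D := by
    have := Int.floor_add_fract D
    rw [hd] at this
    exact_mod_cast this
  have hdn : d ≤ n := by
    have : (d : ℝ) ≤ n := by linarith
    exact_mod_cast this
  have hnL : n < 2 ^ (Nat.log 2 n + 1) := Nat.lt_pow_succ_log_self (by norm_num) n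
  have hbest : J.best n 0 D ≤ n := Items.best_le hD
  refine Ends.mono (Ends.seq (Q := DualInv J n (Int.fract D) d 0 n) (Ends.of_wp ?_) fun m₁ hm₁ =>
    Ends.seq (Q := fun m' => ∃ l, DualInv J n (Int.fract D) d l l m')
      (Ends.loop (T := 1200 * ((n + 1) * (Nat.log 2 n + 1)) + 50)
      (fun k m' => ∃ lo hi, hi < lo + 2 ^ k ∧ DualInv J n (Int.fract D) d lo hi m')
      ?_ (Nat.log 2 n + 1) m₁ ⟨_, _, by omega, hm₁⟩) fun m₂ hm₂ => ?_) (T := _)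
    ((Nat.add_le_add ?_ (Nat.add_le_add ?_ le_rfl)).trans
      (dual_time (X := (n + 1) * (Nat.log 2 n + 1)) (by positivity))) fun _ h => h
  · simp only [Prog.wp, RExpr.Ok, RExpr.val, IExpr.Ok, IExpr.val, h4, hd, h0, Memory.ivar_setIVar,
      Memory.rvar_setIVar, Memory.ivar_setRVar, abs_le, reduceIte, true_and, OfNat.zero_ne_ofNat]
    obtain ⟨l, hl, hl'⟩ := Items.exists_lagrange_eq (n := n) hJ hφ.1 d
    refine ⟨by omega, by omega, by omega, by omega, ⟨by simp [h0], hJm.congr (by simp) (by simp)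
      (by simp), ?_, by simp, by simpa [FracArray] using hf⟩, by simp, by simp, by omega, le_rfl, l,
      by omega, hl, hl'⟩
    simp
    linarith
  · rintro k m' ⟨lo, hi, hk, h⟩
    have h1 := h.hi_le
    have h2 := h.le
    simp only [BExpr.Ok, BExpr.Holds, IExpr.Ok, IExpr.val, h.lo_eq, h.hi_eq, abs_le]
    refine ⟨by omega, fun hlt => ?_, fun hlt => ?_⟩
    · rcases k with - | k
      · simp at hk; omega
      refine ⟨k, rfl, (dualStep_spec hW hn hJ hdn hφ (by omega) h).mono le_rfl fun m'' hm'' => ?_⟩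
      rw [pow_succ] at hk
      rcases hm'' with h' | h'
      · exact ⟨_, _, by omega, h'⟩
      · exact ⟨_, _, by omega, h'⟩
    · obtain rfl : lo = hi := by omega
      exact ⟨lo, h⟩
  · obtain ⟨l, h⟩ := hm₂
    have hln := h.hi_le
    obtain ⟨l', hl1, hl2, hl3⟩ := h.opt
    obtain rfl : l' = l := by omega
    rw [hdφ] at hl3
    refine Ends.seq (S := 10) (Q := fun m₃ => m₃ = m₂.setIVar 16 l') (Ends.of_wp ?_ |>.mono (by decide)
      fun _ h => h) fun m₃ hm₃ =>
      Ends.seq (T := 20) (penaltyProg_spec (l := l') (m := m₃) hW hn hJ hln hdn hφ ?_ ?_)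
        fun m₄ hm₄ => (Ends.of_wp ?_).mono (by decide) fun _ h => h
    · simp only [Prog.wp, IExpr.Ok, IExpr.val, h.lo_eq, abs_le]
      exact ⟨by omega, trivial⟩
    · simp [hm₃]
    · exact h.input.congr (by simp [hm₃]) (by simp [hm₃]) (by simp [hm₃]) (by simp [hm₃])
        (by simp [hm₃])
    · have e20 : m₄.ivar 20 = J.best n 0 D := by rw [hm₄.2, hl3]
      simp only [Prog.wp, IExpr.Ok, IExpr.val, hm₄.1.n_eq, e20, Memory.ivar_setIVar, abs_le,
        Nat.reduceEqDiff, reduceIte]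
      refine ⟨by omega, by simp; omega, by simp, ?_⟩
      omega
  · decide
  · exact Nat.add_le_add (Nat.mul_le_mul_left _ (Nat.add_le_add_right (by decide) _)) (by decide)

end

theorem dual_total_time {n : ℕ} (hn : 0 < n) {t : ℕ}
    (ht : t ≤ 300 * ((n + 1) * (Nat.log 2 n + 1)) + 300 + 100 * (n + 1) +
      2000 * ((n + 1) * (Nat.log 2 n + 1) * (Nat.log 2 n + 1))) :
    (t : ℝ) ≤ 100000 * (n * Real.log n ^ 2 + 1) := by
  have h1 := natLog_pow_le hn 2
  have h2 : n + 1 ≤ (n + 1) * (Nat.log 2 n + 1) := Nat.le_mul_of_pos_right _ (by omega)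
  have h3 : (n + 1) * (Nat.log 2 n + 1) ≤ (n + 1) * (Nat.log 2 n + 1) * (Nat.log 2 n + 1) :=
    Nat.le_mul_of_pos_right _ (by omega)
  rw [sq (Nat.log 2 n + 1), ← mul_assoc] at h1
  generalize (n + 1) * (Nat.log 2 n + 1) * (Nat.log 2 n + 1) = Y at *
  generalize (n + 1) * (Nat.log 2 n + 1) = X at *
  have h4 : t ≤ 3000 * Y := by omega
  have h5 : (t : ℝ) ≤ 3000 * Y := by exact_mod_cast h4
  have h6 : 0 ≤ (n : ℝ) * Real.log n ^ 2 := by positivity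
  linarith

/-- Covering is solved by the search for the best penalty. -/
theorem cover_solvable_log_sq : SolvableInTime (fun _ I => I.kappa = 1 ∧ I.boxLen ≤ I.totalLen)
    (fun _ I => I.Cover) (fun n _ _ => n * Real.log n ^ 2) := by
  refine ⟨.seq coverSetup dualProg, 4, 100000, fun n I ⟨hk, hle⟩ => ?_⟩
  have hW := four_mul_le_pow n
  generalize (n + 2) ^ 4 = W at hW
  obtain ⟨hn, N, J, hJ, hN0, hN, hach, t₁, m₁, hr₁, ht₁, h0, hJm, hD, -, h6⟩ :=
    coverSetup_spec hk hle (W := W) (by nlinarith)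
  have hopt := Family.isOptimal_of_isGreatest hach
    (Items.isGreatest_best (J := J) (n := n) (sub_nonneg.2 hN))
  obtain ⟨t₂, m₂, hr₂, ht₂, h₂⟩ := dualProg_spec hW hn hJ (sub_nonneg.2 hN) (by linarith) h0 hD hJm
    (fun k => by rw [h6]; norm_num)
  exact ⟨_, _, _, m₂, hopt.1, .seq hr₁ hr₂, h₂.1, h₂.2, dual_total_time hn (by omega)⟩

end MoveIntervals

theorem theorem4 :
    MoveIntervals.SolvableInTime (fun _ I => I.kappa = 1 ∧ I.totalLen ≤ I.boxLen)
      (fun _ I => I.Pack)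
      (fun n τ σ => n * Real.log n + n * (min σ τ : ℕ)) ∧
    MoveIntervals.SolvableInTime (fun _ I => I.kappa = 1 ∧ I.boxLen ≤ I.totalLen)
      (fun _ I => I.Cover)
      (fun n τ σ => n * Real.log n + n * (min σ τ : ℕ)) ∧
    MoveIntervals.SolvableInTime (fun _ I => I.kappa = 1 ∧ I.boxLen ≤ I.totalLen)
      (fun _ I => I.Cover)
      (fun n _ _ => n * Real.log n ^ 2) ∧
    ∀ (n : ℕ) (π : Equiv.Perm (Fin (n + 2))) (d : ℕ), 1 < d → d < n + 1 →
      (MoveIntervals.maxKept π (d + 1) : ℤ) - MoveIntervals.maxKept π d ≤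
        (MoveIntervals.maxKept π d : ℤ) - MoveIntervals.maxKept π (d - 1) :=
  ⟨MoveIntervals.pack_solvable, MoveIntervals.cover_solvable, MoveIntervals.cover_solvable_log_sq,
    fun _ π _ hd _ => MoveIntervals.maxKept_concave π hd⟩
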